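/- \textbf{Setting.} Let $\mathbb K\in\{\mathbb R,\mathbb C\}$. Consider one of the following two models. (F) $N\ge 2$, $X=\mathbb R^N$ with the Euclidean scalar product, $\sigma=(\sigma_{ij})$ is a real $N\times N$ matrix with $\sigma_{ij}\ge 0$, $e=(1,\dots,1)$ and $(Az)_i=\sum_j\sigma_{ij}(z_j-z_i)$ for $z\in \mathbb K^N$. The directed graph of $\sigma$ has vertices $1,\dots,N$ and an edge from $i$ to $j$ when $\sigma_{ij}>0$; $\sigma$ is \emph{strongly connected} if any two distinct vertices $i,j$ are joined by a path $i=i_0,\dots,i_r=j$ ($r\geq 1$) of pairwise distinct vertices with $\sigma_{i_ki_{k+1}}>0$. (C) $\Omega\subset\mathbb R^d$ ($d\ge1$) is bounded and open with $|\Omega|=1$, $X=L^2(\Omega;\mathbb R)$, $\sigma\in L^\infty(\Omega^2)$ is nonnegative, $e=1$ and $(Az)(x)=\int_\Omega\sigma(x,x_*)(z(x_*)-z(x))\,dx_*$ for $z\in L^2(\Omega;\mathbb K)$. The vertices of the directed graph of $\sigma$ are the Lebesgue points $x\in\Omega$ of $\sigma$, i.e. those for which there is $f\in L^1(\Omega)$,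 denoted $\sigma(x,\cdot)$, such that the mean of $\|\sigma(x',\cdot)-f\|_{L^1(\Omega)}$ over $x'\in B(x,r)$ tends to $0$ as $r\to0^+$. There is an arc from $x_1$ to $x_2\ne x_1$ when $x_2\in\operatorname{ess\,supp}\sigma(x_1,\cdot)$, where $\operatorname{ess\,supp} f$ denotes the essential closure of $\{f\ne0\}$ in $\Omega$: the set of points of $\Omega$ at which $\{f\neq 0\}$ does not have Lebesgue density zero. Then $\sigma$ is \emph{strongly connected} if any two distinct vertices are joined by a path of $r\ge1$ arcs through pairwise distinct vertices and, with $S(x)=\int_\Omega\sigma(x,x_*)\,dx_*$, $\delta:=\operatorname{ess\,inf}S>0$. Denote by $A^*$ the adjoint of $A$ on $X$, and by $A_2:\operatorname{im}A\to\operatorname{im}A$, $z\mapsto Az$, the restriction of $A$ acting on the complex space ($\mathbb C^N$ or $L^2(\Omega;\mathbb C)$) to its image; $s(A_2)$ is the supremum of the real parts of the points of the spectrum of $A_2$. A discrete eigenvalue is an isolated point of the spectrum whose Riesz projector has finite rank. \textbf{Theorem.} Assume that $\sigma$ is strongly connected. There is a unique $v\in X$ with $A^*v=0$, $v>0$ (componentwise,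 resp. almost everywhere) and $\langle v,e\rangle=1$; for every solution $y:[0,\infty)\to X$ of $\dot y=Ay$, $y(0)=y^{\rm in}$, the element $\bar y^v=\langle y(t),v\rangle e$ does not depend on $t$. The number $\rho:=-s(A_2)$ is positive, and for every $\varepsilon\in(0,\rho)$ there is $M_\varepsilon>0$ such that, for every solution $y$, $$\|y(t)-\bar y^v\|\le M_\varepsilon\,\|y^{\rm in}-\bar y^v\|\,e^{(-\rho+\varepsilon)t}\qquad\text{for all }t\ge0 .$$ This rate is sharp: for every $\rho'>\rho$ there are $\varepsilon\in(0,\rho')$ and a solution $y$ for which the estimate with $\rho'$ in place of $\rho$ holds for no constant $M_\varepsilon$. In case (F), $\rho=|\operatorname{Re}\lambda_2|$, where $\lambda_2$ is a nonzero eigenvalue of $A$ whose real part is the highest among the nonzero eigenvalues. In case (C), if $A_2$ has no eigenvalue with real part in $(-\delta,0)$, then $s(A_2)=-\rho=-\delta$; otherwise $s(A_2)=-\rho=\operatorname{Re}\lambda_2$, where $\lambda_2$ is a discrete eigenvalue of $A_2$, with the highest real part among the eigenvalues of $A_2$. -/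

import Mathlib

open MeasureTheory Filter Topology

noncomputable section

/-- A directed graph is strongly connected if any two distinct vertices `i`, `j` are joined by a
path `i = p 0, p 1, …, p r = j`, with `r ≥ 1`, of pairwise distinct vertices. -/
def Digraph.StronglyConnected {V : Type*} (G : Digraph V) : Prop :=
  ∀ i j : V, i ≠ j → ∃ r : ℕ, 1 ≤ r ∧ ∃ p : Fin (r + 1) → V, Function.Injective p ∧
    p 0 = i ∧ p (Fin.last r) = j ∧ ∀ k : Fin r, G.Adj (p k.castSucc) (p k.succ)

/-! ### Linear evolution equations and their consensus -/

section Evolution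

variable {X : Type*} [NormedAddCommGroup X] [InnerProductSpace ℝ X]

/-- `y` solves `ẏ(t) = A y(t)` on `[0, ∞)` (with initial datum `y 0`); the values of `y` at negative
times are irrelevant. -/
def IsSolution (A : X →L[ℝ] X) (y : ℝ → X) : Prop :=
  ∀ t, 0 ≤ t → HasDerivWithinAt y (A (y t)) (Set.Ici 0) t

/-- The weighted mean `⟨z, v⟩ e` of `z`. -/
def weightedMean (e v z : X) : X := inner ℝ z v • e

/-- The consensus estimate at rate `ρ`: for every `ε ∈ (0, ρ)` there is `M > 0` such that
`‖y(t) - ȳ‖ ≤ M ‖y(0) - ȳ‖ exp((-ρ + ε) t)` for every solution `y` and all `t ≥ 0`, where `ȳ` is the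
weighted mean of `y(0)`. -/
def ConvergesAtRate (A : X →L[ℝ] X) (e v : X) (ρ : ℝ) : Prop :=
  ∀ ε : ℝ, 0 < ε → ε < ρ → ∃ M : ℝ, 0 < M ∧ ∀ y : ℝ → X, IsSolution A y → ∀ t : ℝ, 0 ≤ t →
    ‖y t - weightedMean e v (y 0)‖ ≤
      M * ‖y 0 - weightedMean e v (y 0)‖ * Real.exp ((-ρ + ε) * t)

/-- No rate larger than `ρ` is admissible: for every `ρ' > ρ`, the consensus estimate at rate `ρ'`
fails, for some `ε ∈ (0, ρ')` and some solution `y`, whatever the constant `M`. -/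
def NoBetterRate (A : X →L[ℝ] X) (e v : X) (ρ : ℝ) : Prop :=
  ∀ ρ' : ℝ, ρ < ρ' → ∃ ε : ℝ, 0 < ε ∧ ε < ρ' ∧ ∃ y : ℝ → X, IsSolution A y ∧
    ∀ M : ℝ, ∃ t : ℝ, 0 ≤ t ∧
      M * ‖y 0 - weightedMean e v (y 0)‖ * Real.exp ((-ρ' + ε) * t) <
        ‖y t - weightedMean e v (y 0)‖

end Evolution

/-! ### Restriction to the image, spectral bound, discrete spectrum -/

section Spectral

variable {E : Type*} [NormedAddCommGroup E] [NormedSpace ℂ E]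

/-- The operator `im T → im T`, `z ↦ T z`. -/
def restrictToImage (T : E →L[ℂ] E) : T.range →L[ℂ] T.range :=
  (T.comp T.range.subtypeL).codRestrict T.range fun z => ⟨z, rfl⟩

/-- The spectral bound: the supremum of the real parts of the elements of the spectrum. -/
def spectralBound (T : E →L[ℂ] E) : ℝ := sSup (Complex.re '' spectrum ℂ T)

/-- `μ` is an eigenvalue of the bounded operator `T`. -/
def IsEigenvalue (T : E →L[ℂ] E) (μ : ℂ) : Prop :=
  Module.End.HasEigenvalue (T : E →ₗ[ℂ] E) μ

/-- The discrete spectrum: isolated points `μ` of the spectrum whose Riesz projector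
`(1 / 2iπ) ∮ (z - T)⁻¹ dz`, over a circle enclosing no other point of the spectrum, has finite
rank. -/
def discreteSpectrum (T : E →L[ℂ] E) : Set ℂ :=
  {μ | ∃ r : ℝ, 0 < r ∧ spectrum ℂ T ∩ Metric.closedBall μ r = {μ} ∧
    FiniteDimensional ℂ
      ((2 * Real.pi * Complex.I : ℂ)⁻¹ • ∮ z in C(μ, r), resolvent T z : E →L[ℂ] E).range}

end Spectral

/-! ### The finite-dimensional model -/

section Finite

variable {N : ℕ}

/-- The directed graph on `{1, …, N}` with an edge from `i` to `j` when `σ i j > 0`. -/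
def interactionGraph (σ : Matrix (Fin N) (Fin N) ℝ) : Digraph (Fin N) where
  Adj i j := 0 < σ i j

/-- The matrix `A = σ - diag(σ e)`. -/
def consensusMatrix (σ : Matrix (Fin N) (Fin N) ℝ) : Matrix (Fin N) (Fin N) ℝ :=
  σ - Matrix.diagonal (σ.mulVec 1)

/-- The matrix `A` as an operator on `𝕜 ^ N` with its Euclidean structure, for `𝕜 = ℝ` or `ℂ`. -/
def finiteOperator (𝕜 : Type*) [RCLike 𝕜] (σ : Matrix (Fin N) (Fin N) ℝ) :
    EuclideanSpace 𝕜 (Fin N) →L[𝕜] EuclideanSpace 𝕜 (Fin N) :=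
  Matrix.toEuclideanCLM (𝕜 := 𝕜) ((consensusMatrix σ).map (algebraMap ℝ 𝕜))

/-- The vector `e = (1, …, 1)`. -/
def finiteOnes (N : ℕ) : EuclideanSpace ℝ (Fin N) := WithLp.toLp 2 fun _ => 1

/-- `v ∈ ker A*`, `v > 0` and `⟨v, e⟩ = 1`. -/
structure IsFiniteWeight (σ : Matrix (Fin N) (Fin N) ℝ) (v : EuclideanSpace ℝ (Fin N)) : Prop where
  mem_ker : ContinuousLinearMap.adjoint (finiteOperator ℝ σ) v = 0
  pos : ∀ i, 0 < v i
  normalized : inner ℝ v (finiteOnes N) = 1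

end Finite

/-! ### Interaction operators on `L²` of a probability space -/

section Kernel

variable {α : Type*} [MeasurableSpace α] {μ : Measure α} [IsProbabilityMeasure μ]
  {𝕜 : Type*} [RCLike 𝕜] {σ : α × α → ℝ}

lemma kernel_ae_bound (hσ : MemLp σ ⊤ (μ.prod μ)) :
    ∀ᵐ x ∂μ, ∀ᵐ x' ∂μ, ‖σ (x, x')‖ ≤ (eLpNorm σ ⊤ (μ.prod μ)).toReal := by
  have h : ∀ᵐ p ∂(μ.prod μ), ‖σ p‖ ≤ (eLpNorm σ ⊤ (μ.prod μ)).toReal := by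
    filter_upwards [ae_le_eLpNormEssSup (f := σ) (μ := μ.prod μ)] with p hp
    rw [← toReal_enorm]
    exact ENNReal.toReal_mono hσ.2.ne (by rwa [eLpNorm_exponent_top])
  exact Measure.ae_ae_of_ae_prod h

lemma kernel_section_aestronglyMeasurable (hσ : MemLp σ ⊤ (μ.prod μ)) :
    ∀ᵐ x ∂μ, AEStronglyMeasurable (fun x' => σ (x, x')) μ :=
  hσ.1.prodMk_left

lemma kernel_integrable (hσ : MemLp σ ⊤ (μ.prod μ)) (f : Lp 𝕜 2 μ) :
    ∀ᵐ x ∂μ, Integrable (fun x' => σ (x, x') • (f x' - f x)) μ := by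
  filter_upwards [kernel_ae_bound hσ, kernel_section_aestronglyMeasurable hσ] with x hb hm
  have hf : Integrable (fun x' => f x' - f x) μ :=
    ((Lp.memLp f).integrable (by norm_num)).sub (integrable_const _)
  exact hf.bdd_smul _ hm hb

lemma integral_norm_le_norm (f : Lp 𝕜 2 μ) : ∫ x, ‖f x‖ ∂μ ≤ ‖f‖ := by
  rw [integral_norm_eq_lintegral_enorm (Lp.memLp f).1, ← eLpNorm_one_eq_lintegral_enorm, Lp.norm_def]
  exact ENNReal.toReal_mono (Lp.memLp f).2.ne
    (eLpNorm_le_eLpNorm_of_exponent_le (by norm_num) (Lp.memLp f).1)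

lemma kernel_integral_bound (hσ : MemLp σ ⊤ (μ.prod μ)) (f : Lp 𝕜 2 μ) :
    ∀ᵐ x ∂μ, ‖∫ x', σ (x, x') • (f x' - f x) ∂μ‖ ≤
      (eLpNorm σ ⊤ (μ.prod μ)).toReal * ‖(‖f‖ + ‖f x‖ : ℝ)‖ := by
  filter_upwards [kernel_ae_bound hσ] with x hb
  set C := (eLpNorm σ ⊤ (μ.prod μ)).toReal
  have hC : 0 ≤ C := ENNReal.toReal_nonneg
  have hfi : Integrable (fun x' => ‖f x'‖) μ := ((Lp.memLp f).integrable (by norm_num)).norm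
  have hi : Integrable (fun x' => C * (‖f x'‖ + ‖f x‖)) μ :=
    (hfi.add (integrable_const _)).const_mul C
  have h1 : ‖∫ x', σ (x, x') • (f x' - f x) ∂μ‖ ≤ ∫ x', C * (‖f x'‖ + ‖f x‖) ∂μ := by
    refine norm_integral_le_of_norm_le hi ?_
    filter_upwards [hb] with x' hx'
    rw [norm_smul]
    exact mul_le_mul hx' (norm_sub_le _ _) (norm_nonneg _) hC
  refine h1.trans ?_
  rw [integral_const_mul, integral_add hfi (integrable_const _), integral_const,
    Real.norm_of_nonneg (by positivity)]
  simp only [probReal_univ, one_smul]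
  exact mul_le_mul_of_nonneg_left (by linarith [integral_norm_le_norm f]) hC

lemma memLp_kernel_dominant (f : Lp 𝕜 2 μ) : MemLp (fun x => (‖f‖ + ‖f x‖ : ℝ)) 2 μ :=
  MemLp.add (f := fun _ => ‖f‖) (g := fun x => ‖f x‖) (memLp_const ‖f‖) (Lp.memLp f).norm

lemma kernel_memLp (hσ : MemLp σ ⊤ (μ.prod μ)) (f : Lp 𝕜 2 μ) :
    MemLp (fun x => ∫ x', σ (x, x') • (f x' - f x) ∂μ) 2 μ := by
  refine (memLp_kernel_dominant f).of_le_mul ?_ (kernel_integral_bound hσ f)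
  have hf := (Lp.memLp f).1
  exact (hσ.1.smul (hf.comp_snd.sub hf.comp_fst)).integral_prod_right'

/-- The interaction operator `(A z)(x) = ∫ σ(x, x') (z(x') - z(x)) dx'` on `L²(μ; 𝕜)`, for
`σ ∈ L^∞(μ ⊗ μ)` and `𝕜 = ℝ` or `ℂ`. -/
def kernelOperator (𝕜 : Type*) [RCLike 𝕜] (hσ : MemLp σ ⊤ (μ.prod μ)) :
    Lp 𝕜 2 μ →L[𝕜] Lp 𝕜 2 μ :=
  LinearMap.mkContinuous
    { toFun := fun z => (kernel_memLp hσ z).toLp (fun x => ∫ x', σ (x, x') • (z x' - z x) ∂μ)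
      map_add' := fun f g => by
        refine Lp.ext ?_
        filter_upwards [(kernel_memLp hσ (f + g)).coeFn_toLp, (kernel_memLp hσ f).coeFn_toLp,
          (kernel_memLp hσ g).coeFn_toLp, Lp.coeFn_add ((kernel_memLp hσ f).toLp _)
            ((kernel_memLp hσ g).toLp _), kernel_integrable hσ f, kernel_integrable hσ g,
          Lp.coeFn_add f g] with x h1 h2 h3 h4 h5 h6 h7
        rw [h1, h4, Pi.add_apply, h2, h3, ← integral_add h5 h6]
        refine integral_congr_ae ?_
        filter_upwards [Lp.coeFn_add f g] with x' h8
        rw [h7, h8, Pi.add_apply, Pi.add_apply, ← smul_add]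
        congr 1
        ring
      map_smul' := fun c f => by
        refine Lp.ext ?_
        filter_upwards [(kernel_memLp hσ (c • f)).coeFn_toLp, (kernel_memLp hσ f).coeFn_toLp,
          Lp.coeFn_smul c ((kernel_memLp hσ f).toLp _), Lp.coeFn_smul c f] with x h1 h2 h3 h4
        rw [h1, RingHom.id_apply, h3, Pi.smul_apply, h2, ← integral_smul]
        refine integral_congr_ae ?_
        filter_upwards [Lp.coeFn_smul c f] with x' h5
        rw [h4, h5, Pi.smul_apply, Pi.smul_apply, ← smul_sub, smul_comm] }
    ((eLpNorm σ ⊤ (μ.prod μ)).toReal * 2) (fun f => by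
      have h : ∀ᵐ x ∂μ, ‖(kernel_memLp hσ f).toLp _ x‖ ≤ (eLpNorm σ ⊤ (μ.prod μ)).toReal *
          ‖(memLp_kernel_dominant f).toLp _ x‖ := by
        filter_upwards [(kernel_memLp hσ f).coeFn_toLp, (memLp_kernel_dominant f).coeFn_toLp,
          kernel_integral_bound hσ f] with x h1 h2 h3
        rw [h1, h2]
        exact h3
      refine (Lp.norm_le_mul_norm_of_ae_le_mul h).trans ?_
      rw [mul_assoc]
      refine mul_le_mul_of_nonneg_left ?_ ENNReal.toReal_nonneg
      have h' : (memLp_kernel_dominant f).toLp _ =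
          (memLp_const ‖f‖).toLp (fun _ : α => ‖f‖) + (Lp.memLp f).norm.toLp (fun x => ‖f x‖) :=
        MemLp.toLp_add (memLp_const ‖f‖) (Lp.memLp f).norm
      rw [h', two_mul]
      refine (norm_add_le _ _).trans (add_le_add ?_ ?_)
      · rw [Lp.norm_toLp]
        refine ENNReal.toReal_le_of_le_ofReal (norm_nonneg _) ?_
        rw [eLpNorm_const _ (by norm_num) (IsProbabilityMeasure.ne_zero μ)]
        simp
      · rw [Lp.norm_toLp, eLpNorm_norm, ← Lp.norm_def])

end Kernel

/-! ### The infinite-dimensional model -/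

/-- The data of the infinite-dimensional model: a bounded open set `Ω ⊆ ℝ^d` of Lebesgue measure `1`
and a nonnegative interaction function `σ ∈ L^∞(Ω × Ω)`. -/
structure ContinuumModel (d : ℕ) where
  Ω : Set (EuclideanSpace ℝ (Fin d))
  isOpen : IsOpen Ω
  isBounded : Bornology.IsBounded Ω
  volume_eq_one : volume Ω = 1
  σ : EuclideanSpace ℝ (Fin d) × EuclideanSpace ℝ (Fin d) → ℝ
  memLp : MemLp σ ⊤ ((volume.restrict Ω).prod (volume.restrict Ω))
  nonneg : ∀ᵐ p ∂((volume.restrict Ω).prod (volume.restrict Ω)), 0 ≤ σ p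

namespace ContinuumModel

variable {d : ℕ} (P : ContinuumModel d)

/-- Lebesgue measure on `Ω`. -/
abbrev measure : Measure (EuclideanSpace ℝ (Fin d)) := volume.restrict P.Ω

instance : IsProbabilityMeasure P.measure := ⟨by simp [measure, P.volume_eq_one]⟩

/-- The operator `(A z)(x) = ∫_Ω σ(x, x') (z(x') - z(x)) dx'` on `L²(Ω; 𝕜)`. -/
def operator (𝕜 : Type*) [RCLike 𝕜] : Lp 𝕜 2 P.measure →L[𝕜] Lp 𝕜 2 P.measure :=
  kernelOperator 𝕜 P.memLp

/-- The constant function `e = 1`. -/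
def ones : Lp ℝ 2 P.measure := Lp.const 2 P.measure 1

/-- `S(x) = ∫_Ω σ(x, x') dx'`. -/
def S (x : EuclideanSpace ℝ (Fin d)) : ℝ := ∫ x', P.σ (x, x') ∂P.measure

/-- `δ = ess inf S`. -/
def δ : ℝ := essInf P.S P.measure

/-- `f = σ(x, ·)` is the value at `x` of the `L¹(Ω)`-valued map `x' ↦ σ(x', ·)` and `x` is a Lebesgue
point of that map: `f` is integrable and the mean of `‖σ(x', ·) - f‖_{L¹(Ω)}` over `x'` in the ball of
centre `x` and radius `r` tends to `0` with `r`. The point `x` determines `f` up to null sets,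
and null modifications of `σ` are immaterial. -/
def IsSectionAt (x : EuclideanSpace ℝ (Fin d)) (f : EuclideanSpace ℝ (Fin d) → ℝ) : Prop :=
  Integrable f P.measure ∧
  Tendsto (fun r : ℝ =>
    (∫⁻ x' in Metric.ball x r, (∫⁻ z, ‖P.σ (x', z) - f z‖ₑ ∂P.measure) ∂P.measure) /
      P.measure (Metric.ball x r)) (𝓝[>] 0) (𝓝 0)

/-- The essential support of `f`: the essential (measure-theoretic) closure of `{f ≠ 0}`, that is, the
set of the points of `Ω` at which `{f ≠ 0}` does not have density zero. It agrees with `{f ≠ 0}` up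
to a null set, and depends only on the class of `f` modulo null sets. -/
def essSupport (f : EuclideanSpace ℝ (Fin d) → ℝ) : Set (EuclideanSpace ℝ (Fin d)) :=
  {x ∈ P.Ω | ¬ Tendsto (fun r : ℝ =>
    P.measure ({z | f z ≠ 0} ∩ Metric.ball x r) / P.measure (Metric.ball x r)) (𝓝[>] 0) (𝓝 0)}

/-- The vertices: the Lebesgue points of `σ` in `Ω`. -/
def Vertex : Type := {x : EuclideanSpace ℝ (Fin d) // x ∈ P.Ω ∧ ∃ f, P.IsSectionAt x f}

/-- The directed graph with an arc from `x₁` to `x₂` when `x₁ ≠ x₂` and `x₂ ∈ ess supp σ(x₁, ·)`. -/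
def graph : Digraph P.Vertex where
  Adj x₁ x₂ := x₁ ≠ x₂ ∧ ∃ f, P.IsSectionAt x₁.1 f ∧ x₂.1 ∈ P.essSupport f

/-- Strong connectivity in infinite dimension: the graph is strongly connected and
`ess inf S > 0`. -/
def StronglyConnected : Prop := P.graph.StronglyConnected ∧ 0 < P.δ

/-- `v ∈ ker A*`, `v > 0` almost everywhere and `⟨v, e⟩ = 1`. -/
structure IsWeight (v : Lp ℝ 2 P.measure) : Prop where
  mem_ker : ContinuousLinearMap.adjoint (P.operator ℝ) v = 0
  pos : ∀ᵐ x ∂P.measure, 0 < v x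
  normalized : inner ℝ v P.ones = 1

end ContinuumModel

end

/-!
Both models have the same shape: a bounded real operator `A` with `A e = 0`, whose complexification `T`
is `B + K` with `K` compact and `B` invertible (in finite dimension everything is compact).

*Null vectors.* Let `z` be an eigenvector for an eigenvalue `l` with `Re l ≥ 0`. Kato's inequality
`(S + Re l) |z| ≤ K |z|`, integrated against a positive left null vector, must be an equality, so
`l = 0` and `|z|` is itself a null vector. An irreducible kernel forces a nonnegative null vector to
vanish almost everywhere or almost nowhere, so real null vectors have a constant sign. For `A` this
shows that the kernel is spanned by `e`; for the transposed kernel, which has `1` as a left null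
vector, it gives the positivity and the uniqueness of the weight `v`. The weight exists by the Fredholm
alternative, because the range of the adjoint is orthogonal to `e`. In the integral model,
irreducibility comes from the graph: if a set `B` does not interact with its complement, the set of
the points where `B` does not have density zero is closed under arcs, and by the Lebesgue density theorem
it separates vertices unless `B` or its complement is null.

*Rates.* By the Fredholm alternative for `T + ⟨·, v⟩ e`, the image of `T` is the hyperplane `⟨·, v⟩ = 0`.
It is a closed complement of the line of `e`, on which `T` is invertible and has the spectrum of `T` with
`0` removed. A solution is `exp(tT)` applied to its initial datum, and subtracting the weighted mean
projects on the image. The growth bound of `exp(tT)` there is the spectral bound: the upper bound follows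
from the spectral radius formula applied to `exp T` and spectral mapping, and the lower bound from the
uniform boundedness principle, since a better bound for each solution would bound the norm of the
semigroup and hence the spectral radius of the exponential.

*The spectral bound.* In the integral model, `B` is the multiplication by `-S`, so the half-plane
`Re l > -δ` is in its resolvent set. There the spectrum of `T` consists of eigenvalues, and nonzero ones
have negative real part. The point `-δ` itself is in the spectrum: normalised indicators of
small sets on which `S` is close to `δ` are approximate eigenvectors. The spectral bound is
attained in the spectrum, so it is either `-δ` or the real part of an eigenvalue `l` to the right of
`-δ`. In the latter case the points to the right of `l` are in the resolvent set, and the analytic Fredholm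
alternative makes `l` isolated; its Riesz projector is the integral of the difference of the
resolvents of `T` and `B`, hence a compact projector, hence of finite rank.
-/

noncomputable section


/-! ### Exponential growth and the spectrum -/

section Growth

variable {A : Type*} [NormedRing A] [NormedAlgebra ℂ A] [CompleteSpace A]

/-- The nontrivial inclusion of the spectral mapping theorem for `exp`. Gelfand theory applies in the
double commutant of `a`, a commutative Banach algebra that contains the inverses of the elements
`w - a`. -/
lemma exists_mem_spectrum_exp_eq (a : A) {z : ℂ} (hz : z ∈ spectrum ℂ (NormedSpace.exp a)) :
    ∃ w ∈ spectrum ℂ a, Complex.exp w = z := by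
  let B : Subalgebra ℂ A := Subalgebra.centralizer ℂ (Set.centralizer {a})
  have haB : a ∈ B := by
    rw [Subalgebra.mem_centralizer_iff]
    intro g hg
    exact ((Set.mem_centralizer_iff.1 hg) a rfl).symm
  have hclosed : IsClosed (B : Set A) := Set.isClosed_centralizer _
  have hcomplete : CompleteSpace B := hclosed.completeSpace_coe
  let instB : NormedCommRing B :=
    { (inferInstance : NormedRing B) with
      mul_comm := fun x y => by
        ext
        refine (Subalgebra.mem_centralizer_iff ℂ).1 y.2 x ?_
        rw [Set.mem_centralizer_iff]
        rintro m rfl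
        refine (Subalgebra.mem_centralizer_iff ℂ).1 x.2 m ?_
        simp [Set.mem_centralizer_iff] }
  let b : B := ⟨a, haB⟩
  let +nondep : NormedAlgebra ℚ A := .restrictScalars ℚ ℂ A
  let +nondep : NormedAlgebra ℚ B := .restrictScalars ℚ ℂ B
  have hexp : (NormedSpace.exp b : B) = NormedSpace.exp a :=
    NormedSpace.map_exp B.val continuous_subtype_val b
  have hzB : z ∈ spectrum ℂ (NormedSpace.exp b) := fun h => hz (by
    have := h.map B.val
    rwa [map_sub, AlgHomClass.commutes, Subalgebra.val_apply, hexp] at this)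
  obtain ⟨φ, hφ⟩ := WeakDual.CharacterSpace.mem_spectrum_iff_exists.1 hzB
  refine ⟨φ b, ?_, ?_⟩
  · intro h
    obtain ⟨u, hu⟩ := h
    refine AlgHom.apply_mem_spectrum φ b ?_
    have hinv : (↑u⁻¹ : A) ∈ B := by
      rw [Subalgebra.mem_centralizer_iff]
      intro g hg
      have hga : Commute g (u : A) := by
        rw [hu]
        have h1 : Commute g (algebraMap ℂ A (φ b)) := (Algebra.commutes (φ b) g).symm
        exact h1.sub_right ((Set.mem_centralizer_iff.1 hg) a rfl).symm
      exact hga.units_inv_right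
    refine ⟨⟨algebraMap ℂ B (φ b) - b, ⟨_, hinv⟩, ?_, ?_⟩, rfl⟩
    · ext
      change (algebraMap ℂ A (φ b) - a) * ↑u⁻¹ = 1
      rw [← hu, Units.mul_inv]
    · ext
      change ↑u⁻¹ * (algebraMap ℂ A (φ b) - a) = 1
      rw [← hu, Units.inv_mul]
  · rw [← hφ, Complex.exp_eq_exp_ℂ]
    exact (NormedSpace.map_exp φ (map_continuous φ) b).symm

/-- The spectral bound controls the growth of `exp (t a)`: this is Gelfand's formula for `exp a`,
whose spectral radius is read off the spectrum of `a`. -/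
lemma exists_norm_exp_smul_le [NormOneClass A] (a : A) {ω : ℝ} (h : ∀ w ∈ spectrum ℂ a, w.re < ω) :
    ∃ M : ℝ, 0 < M ∧ ∀ t : ℝ, 0 ≤ t →
      ‖NormedSpace.exp ((t : ℂ) • a)‖ ≤ M * Real.exp (ω * t) := by
  have : Nontrivial A := NormOneClass.nontrivial
  let +nondep : NormedAlgebra ℚ A := .restrictScalars ℚ ℂ A
  have hrad : spectralRadius ℂ (NormedSpace.exp a) < ((Real.exp ω).toNNReal : ENNReal) := by
    refine spectrum.spectralRadius_lt_of_forall_lt _ fun z hz => ?_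
    obtain ⟨w, hw, rfl⟩ := exists_mem_spectrum_exp_eq a hz
    rw [← NNReal.coe_lt_coe, coe_nnnorm, Complex.norm_exp, Real.coe_toNNReal _ (Real.exp_pos _).le]
    exact Real.exp_lt_exp.2 (h w hw)
  obtain ⟨n, hn, hn1⟩ := ((spectrum.pow_norm_pow_one_div_tendsto_nhds_spectralRadius
    (NormedSpace.exp a)).eventually_lt_const hrad |>.and (eventually_ge_atTop 1)).exists
  have hn0 : (0 : ℝ) < n := by exact_mod_cast hn1
  have hpow : ‖NormedSpace.exp ((n : ℂ) • a)‖ ≤ Real.exp (ω * n) := by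
    have h1 : NormedSpace.exp ((n : ℂ) • a) = NormedSpace.exp a ^ n := by
      rw [← NormedSpace.exp_nsmul, Nat.cast_smul_eq_nsmul]
    have h2 : ‖NormedSpace.exp a ^ n‖ ^ (1 / n : ℝ) < Real.exp ω :=
      (ENNReal.ofReal_lt_ofReal_iff (Real.exp_pos _)).1 hn
    rw [h1]
    calc ‖NormedSpace.exp a ^ n‖ = (‖NormedSpace.exp a ^ n‖ ^ (1 / n : ℝ)) ^ (n : ℝ) := by
          rw [← Real.rpow_mul (norm_nonneg _), one_div, inv_mul_cancel₀ hn0.ne', Real.rpow_one]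
      _ ≤ Real.exp ω ^ (n : ℝ) := Real.rpow_le_rpow (by positivity) h2.le hn0.le
      _ = Real.exp (ω * n) := by rw [Real.exp_mul]
  have hcont : Continuous fun t : ℝ => NormedSpace.exp ((t : ℂ) • a) :=
    NormedSpace.exp_continuous.comp (by fun_prop)
  obtain ⟨C, hC⟩ := (isCompact_Icc (a := (0 : ℝ)) (b := n)).exists_bound_of_continuousOn
    hcont.continuousOn
  have hC0 : 0 ≤ C := (norm_nonneg _).trans (hC 0 ⟨le_rfl, hn0.le⟩)
  refine ⟨(C + 1) * Real.exp (|ω| * n), by positivity, fun t ht => ?_⟩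
  set k := ⌊t / n⌋₊
  have hk : (k : ℝ) * n ≤ t := (le_div_iff₀ hn0).1 (Nat.floor_le (by positivity))
  have hk' : t ≤ k * n + n := by
    have := ((div_lt_iff₀ hn0).1 (Nat.lt_floor_add_one (t / n))).le
    linarith
  have hsplit : NormedSpace.exp ((t : ℂ) • a) =
      NormedSpace.exp ((n : ℂ) • a) ^ k * NormedSpace.exp (((t - k * n : ℝ) : ℂ) • a) := by
    rw [← NormedSpace.exp_nsmul, ← NormedSpace.exp_add_of_commute]
    · congr 1
      rw [← Nat.cast_smul_eq_nsmul ℂ, smul_smul, ← add_smul]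
      congr 1
      push_cast
      ring
    · exact (((Commute.refl a).smul_left _).smul_right _).smul_left _
  calc ‖NormedSpace.exp ((t : ℂ) • a)‖
      ≤ ‖NormedSpace.exp ((n : ℂ) • a) ^ k‖ * C := by
        rw [hsplit]
        exact (norm_mul_le _ _).trans (mul_le_mul_of_nonneg_left
          (hC _ ⟨by linarith, by linarith⟩) (norm_nonneg _))
    _ ≤ Real.exp (ω * n) ^ k * (C + 1) := by
        refine mul_le_mul ?_ (by linarith) hC0 (by positivity)
        exact (norm_pow_le _ k).trans (pow_le_pow_left₀ (norm_nonneg _) hpow k)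
    _ ≤ (C + 1) * Real.exp (|ω| * n) * Real.exp (ω * t) := by
        rw [← Real.exp_nat_mul, mul_comm, mul_assoc, ← Real.exp_add]
        gcongr
        have h3 : ω * (k * n - t) ≤ |ω| * n := by
          calc ω * (k * n - t) ≤ |ω * (k * n - t)| := le_abs_self _
            _ = |ω| * |k * n - t| := abs_mul _ _
            _ ≤ |ω| * n := by
              gcongr
              rw [abs_le]; constructor <;> linarith
        linarith

end Growth

section Flow

variable {E : Type*} [NormedAddCommGroup E] [NormedSpace ℂ E] [CompleteSpace E] (T : E →L[ℂ] E)

lemma hasDerivAt_exp_smul_apply (z : E) (t : ℝ) :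
    HasDerivAt (fun s : ℝ => NormedSpace.exp ((s : ℂ) • T) z)
      (T (NormedSpace.exp ((t : ℂ) • T) z)) t := by
  have h1 := hasDerivAt_exp_smul_const' (𝕂 := ℝ) T t
  have h2 := ((ContinuousLinearMap.apply ℂ E z).restrictScalars ℝ).hasFDerivAt.comp_hasDerivAt t h1
  simpa [Function.comp_def, Complex.coe_smul] using! h2

/-- The solutions of `ẏ = T y` are given by the exponential. -/
lemma eq_exp_smul_apply_of_hasDerivWithinAt {y : ℝ → E}
    (hy : ∀ t, 0 ≤ t → HasDerivWithinAt y (T (y t)) (Set.Ici 0) t) {t : ℝ} (ht : 0 ≤ t) :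
    y t = NormedSpace.exp ((t : ℂ) • T) (y 0) := by
  refine ODE_solution_unique (v := fun _ => T) (K := ‖T‖₊) (a := 0) (b := t) (fun _ => T.lipschitz)
    (fun s hs => ((hy s hs.1).continuousWithinAt).mono Set.Icc_subset_Ici_self)
    (fun s hs => (hy s hs.1).mono (Set.Ici_subset_Ici.2 hs.1))
    (fun s _ => (hasDerivAt_exp_smul_apply T (y 0) s).continuousAt.continuousWithinAt)
    (fun s _ => (hasDerivAt_exp_smul_apply T (y 0) s).hasDerivWithinAt) ?_ ⟨ht, le_rfl⟩
  simp [NormedSpace.exp_zero]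

end Flow

/-! ### Spectral bound and consensus rate -/

section Bound

variable {E : Type*} [NormedAddCommGroup E] [NormedSpace ℂ E] [CompleteSpace E]

lemma bddAbove_re_spectrum (T : E →L[ℂ] E) : BddAbove (Complex.re '' spectrum ℂ T) :=
  ((spectrum.isCompact T).image Complex.continuous_re).bddAbove

lemma re_le_spectralBound (T : E →L[ℂ] E) {w : ℂ} (hw : w ∈ spectrum ℂ T) :
    w.re ≤ spectralBound T :=
  le_csSup (bddAbove_re_spectrum T) ⟨w, hw, rfl⟩

lemma exists_mem_spectrum_re_eq_spectralBound [Nontrivial E] (T : E →L[ℂ] E) :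
    ∃ w ∈ spectrum ℂ T, w.re = spectralBound T := by
  obtain ⟨w, hw, h⟩ := ((spectrum.isCompact T).image Complex.continuous_re).sSup_mem
    ((spectrum.nonempty T).image _)
  exact ⟨w, hw, h⟩

end Bound

/-- A presentation of the complex normed space `H` as the complexification of the real normed space
`X`: an isometric embedding of `X`, with real and imaginary part. -/
structure Complexification (X H : Type*) [NormedAddCommGroup X] [NormedSpace ℝ X]
    [NormedAddCommGroup H] [NormedSpace ℂ H] where
  ofReal : X →ₗᵢ[ℝ] H
  re : H →L[ℝ] X
  im : H →L[ℝ] X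
  re_ofReal : ∀ x, re (ofReal x) = x
  re_I_smul_ofReal : ∀ x, re (Complex.I • ofReal x) = 0
  decomp : ∀ z, z = ofReal (re z) + Complex.I • ofReal (im z)

section Range

variable {H : Type*} [NormedAddCommGroup H] [NormedSpace ℂ H]

/-- An operator whose range is the kernel of a continuous linear form has closed range. -/
lemma completeSpace_range_of_mem_iff [CompleteSpace H] {T : H →L[ℂ] H} {φ : H →L[ℂ] ℂ}
    (hrange : ∀ z, z ∈ T.range ↔ φ z = 0) : CompleteSpace T.range := by
  have h : (T.range : Set H) = φ ⁻¹' {0} := by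
    ext z; simpa using hrange z
  have hc : IsClosed (T.range : Set H) := h ▸ isClosed_singleton.preimage φ.continuous
  exact hc.completeSpace_coe

/-- Exponentials of intertwined operators are intertwined. -/
lemma map_exp_smul_apply [CompleteSpace H] {E : Type*} [NormedAddCommGroup E] [NormedSpace ℂ E]
    [CompleteSpace E] {T : H →L[ℂ] H} {S : E →L[ℂ] E} (j : E →ₗᵢ[ℂ] H)
    (hj : ∀ w, j (S w) = T (j w)) (w : E) {t : ℝ} (ht : 0 ≤ t) :
    j (NormedSpace.exp ((t : ℂ) • S) w) = NormedSpace.exp ((t : ℂ) • T) (j w) := by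
  have h := eq_exp_smul_apply_of_hasDerivWithinAt T
    (y := fun s => j (NormedSpace.exp ((s : ℂ) • S) w)) (fun s _ => ?_) ht
  · simpa [NormedSpace.exp_zero] using h
  · rw [← hj]
    exact ((j.toContinuousLinearMap.restrictScalars ℝ).hasFDerivAt.comp_hasDerivAt s
      (hasDerivAt_exp_smul_apply S w s)).hasDerivWithinAt

end Range

section Consensus

variable {X H : Type*} [NormedAddCommGroup X] [InnerProductSpace ℝ X]
  [NormedAddCommGroup H] [NormedSpace ℂ H] [CompleteSpace H]
  {A : X →L[ℝ] X} {T : H →L[ℂ] H} {e v : X}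

lemma inner_eq_of_isSolution (hAv : ∀ x, inner ℝ (A x) v = 0) {y : ℝ → X} (hy : IsSolution A y)
    {t : ℝ} (ht : 0 ≤ t) : inner ℝ (y t) v = inner ℝ (y 0) v := by
  refine constant_of_has_deriv_right_zero (f := fun s => inner ℝ (y s) v) (a := 0) (b := t)
    (fun s hs => ?_) (fun s hs => ?_) t ⟨ht, le_rfl⟩
  · exact ((hy s hs.1).continuousWithinAt.mono Set.Icc_subset_Ici_self).inner
      continuousWithinAt_const
  · have h := ((hy s hs.1).mono (Set.Ici_subset_Ici.2 hs.1)).inner ℝ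
      (hasDerivWithinAt_const s (Set.Ici s) v)
    simpa [hAv] using h

lemma inner_sub_weightedMean (hev : inner ℝ e v = 1) (x : X) :
    inner ℝ (x - weightedMean e v x) v = 0 := by
  rw [weightedMean, inner_sub_left, inner_smul_left, hev]
  simp

variable (c : Complexification X H) (hTA : ∀ x, T (c.ofReal x) = c.ofReal (A x))
  (hre : ∀ z, c.re (T z) = A (c.re z))

include hTA in
lemma ofReal_eq_exp_smul_of_isSolution {y : ℝ → X} (hy : IsSolution A y) {t : ℝ} (ht : 0 ≤ t) :
    c.ofReal (y t) = NormedSpace.exp ((t : ℂ) • T) (c.ofReal (y 0)) := by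
  refine eq_exp_smul_apply_of_hasDerivWithinAt T (y := fun s => c.ofReal (y s)) (fun s hs => ?_) ht
  rw [hTA]
  exact c.ofReal.toContinuousLinearMap.hasFDerivAt.comp_hasDerivWithinAt s (hy s hs)

include hre in
lemma isSolution_re_exp_smul (x : X) :
    IsSolution A fun t => c.re (NormedSpace.exp ((t : ℂ) • T) (c.ofReal x)) := by
  intro t _
  have h := c.re.hasFDerivAt.comp_hasDerivAt t (hasDerivAt_exp_smul_apply T (c.ofReal x) t)
  simpa only [hre] using! h.hasDerivWithinAt

variable {φ : H →L[ℂ] ℂ} (hφ : ∀ x, φ (c.ofReal x) = (inner ℝ x v : ℝ))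
  {E : Type*} [NormedAddCommGroup E] [NormedSpace ℂ E] [CompleteSpace E] [Nontrivial E]
  {S : E →L[ℂ] E} (j : E →ₗᵢ[ℂ] H) (hj : ∀ w, j (S w) = T (j w))
  (hrange : ∀ z, (∃ w, j w = z) ↔ φ z = 0) (he : A e = 0) (hev : inner ℝ e v = 1)

include hTA he in
lemma exp_smul_ofReal_weightedMean (x : X) {t : ℝ} (ht : 0 ≤ t) :
    NormedSpace.exp ((t : ℂ) • T) (c.ofReal (weightedMean e v x)) =
      c.ofReal (weightedMean e v x) := by
  have h : IsSolution A fun _ => weightedMean e v x := fun s _ => by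
    rw [weightedMean, map_smul, he, smul_zero]
    exact hasDerivWithinAt_const s _ _
  exact (ofReal_eq_exp_smul_of_isSolution c hTA h ht).symm

include hTA hφ hrange hj he hev in
lemma convergesAtRate_neg_spectralBound :
    ConvergesAtRate A e v (-spectralBound S) := by
  intro ε hε _
  obtain ⟨M, hM, hb⟩ := exists_norm_exp_smul_le S
    (ω := spectralBound S + ε)
    fun w hw => (re_le_spectralBound _ hw).trans_lt (by linarith)
  refine ⟨M, hM, fun y hy t ht => ?_⟩
  set m := weightedMean e v (y 0)
  obtain ⟨w, hw⟩ : ∃ w, j w = c.ofReal (y 0 - m) := by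
    rw [hrange, hφ, inner_sub_weightedMean hev, Complex.ofReal_zero]
  have h1 : c.ofReal (y t - m) = NormedSpace.exp ((t : ℂ) • T) (c.ofReal (y 0 - m)) := by
    rw [map_sub, map_sub, map_sub, ofReal_eq_exp_smul_of_isSolution c hTA hy ht,
      exp_smul_ofReal_weightedMean c hTA he _ ht]
  rw [← c.ofReal.norm_map, h1, ← hw, ← map_exp_smul_apply j hj w ht, j.norm_map]
  refine (ContinuousLinearMap.le_opNorm _ _).trans ?_
  refine (mul_le_mul_of_nonneg_right (hb t ht) (norm_nonneg _)).trans_eq ?_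
  rw [← j.norm_map, hw, c.ofReal.norm_map, neg_neg]
  ring

include hTA hre hφ hrange hj in
/-- A better rate, with constants depending on the solution, becomes uniform by the Banach–Steinhaus
theorem, and then contradicts `exp (t σ(S)) ⊆ σ(exp (t S))`. -/
lemma noBetterRate_neg_spectralBound
    (hneg : spectralBound S < 0) :
    NoBetterRate A e v (-spectralBound S) := by
  set s := spectralBound S with hs
  intro ρ' hρ'
  by_contra! hcon
  -- With this choice `ρ' - ε` still exceeds the rate `-s`.
  set ε := (ρ' + s) / 2 with hε
  have hdecay : ∀ x, inner ℝ x v = 0 → ∃ C : ℝ, ∀ t : ℝ, 0 ≤ t →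
      ‖NormedSpace.exp ((t : ℂ) • T) (c.ofReal x)‖ ≤ C * Real.exp ((-ρ' + ε) * t) := by
    intro x hx
    have hy := isSolution_re_exp_smul c hre x
    obtain ⟨M, hM⟩ := hcon ε (by linarith) (by linarith) _ hy
    refine ⟨M * ‖x‖, fun t ht => ?_⟩
    have h0 : c.re (NormedSpace.exp (((0 : ℝ) : ℂ) • T) (c.ofReal x)) = x := by
      simp [NormedSpace.exp_zero, c.re_ofReal]
    have h1 := hM t ht
    have h2 := ofReal_eq_exp_smul_of_isSolution c hTA hy ht
    simp only [h0] at h1 h2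
    simp only [weightedMean, hx, zero_smul, sub_zero] at h1
    rwa [← h2, c.ofReal.norm_map]
  have hbound : ∀ w : E, ∃ C : ℝ, ∀ t : Set.Ici (0 : ℝ),
      ‖((Real.exp ((ρ' - ε) * t) : ℂ) • NormedSpace.exp (((t : ℝ) : ℂ) • S)) w‖ ≤ C := by
    intro w
    have hw := (hrange (j w)).1 ⟨w, rfl⟩
    have hsplit := c.decomp (j w)
    rw [hsplit, map_add, map_smul, hφ, hφ] at hw
    have hw' := Complex.ext_iff.1 hw
    simp at hw'
    obtain ⟨C₁, h₁⟩ := hdecay _ hw'.1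
    obtain ⟨C₂, h₂⟩ := hdecay _ hw'.2
    refine ⟨C₁ + C₂, fun ⟨t, ht⟩ => ?_⟩
    have hle : ‖NormedSpace.exp ((t : ℂ) • T) (j w)‖ ≤ (C₁ + C₂) * Real.exp ((-ρ' + ε) * t) := by
      rw [hsplit, map_add, map_smul, add_mul]
      refine (norm_add_le _ _).trans (add_le_add (h₁ t ht) ?_)
      rw [norm_smul, Complex.norm_I, one_mul]
      exact h₂ t ht
    rw [smul_apply, norm_smul, ← j.norm_map,
      map_exp_smul_apply j hj w ht, Complex.norm_real,
      Real.norm_of_nonneg (Real.exp_pos _).le]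
    calc _ ≤ Real.exp ((ρ' - ε) * t) * ((C₁ + C₂) * Real.exp ((-ρ' + ε) * t)) := by gcongr
      _ = (C₁ + C₂) * Real.exp ((ρ' - ε) * t + (-ρ' + ε) * t) := by rw [Real.exp_add]; ring
      _ = C₁ + C₂ := by rw [show (ρ' - ε) * t + (-ρ' + ε) * t = 0 by ring, Real.exp_zero, mul_one]
  obtain ⟨C, hC⟩ := banach_steinhaus hbound
  obtain ⟨w, hw, hws⟩ := exists_mem_spectrum_re_eq_spectralBound S
  have hgrow : ∀ t : ℝ, 0 ≤ t → Real.exp (((ρ' - ε) + s) * t) ≤ C := by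
    intro t ht
    refine le_trans ?_ (hC ⟨t, ht⟩)
    have hmem : (t : ℂ) * w ∈ spectrum ℂ ((t : ℂ) • S) := by
      rcases eq_or_ne (t : ℂ) 0 with h0 | h0
      · rw [h0, zero_mul, zero_smul, spectrum.zero_eq]; rfl
      · have := (spectrum.smul_mem_smul_iff (r := Units.mk0 _ h0)).2 hw
        simpa [Units.smul_def] using this
    have h1 := spectrum.norm_le_norm_of_mem (spectrum.exp_mem_exp _ hmem)
    rw [← Complex.exp_eq_exp_ℂ, Complex.norm_exp] at h1
    rw [norm_smul, Complex.norm_real, Real.norm_of_nonneg (Real.exp_pos _).le,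
      add_mul, Real.exp_add]
    refine mul_le_mul_of_nonneg_left ?_ (Real.exp_pos _).le
    rwa [Complex.re_ofReal_mul, hws, ← hs, mul_comm] at h1
  have hpos : 0 < (ρ' - ε) + s := by linarith
  have h1 := hgrow (|C| / ((ρ' - ε) + s)) (by positivity)
  rw [mul_div_cancel₀ _ hpos.ne'] at h1
  have h2 := Real.add_one_le_exp |C|
  linarith [le_abs_self C]

end Consensus

/-! ### The spectrum of the restriction to the image -/

section Restriction

lemma isEigenvalue_iff {E : Type*} [NormedAddCommGroup E] [NormedSpace ℂ E] {T : E →L[ℂ] E} {l : ℂ} :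
    IsEigenvalue T l ↔ ∃ z, z ≠ 0 ∧ T z = l • z := by
  constructor
  · intro h
    obtain ⟨z, hz⟩ := Module.End.HasEigenvalue.exists_hasEigenvector h
    exact ⟨z, hz.2, hz.apply_eq_smul⟩
  · rintro ⟨z, hz, h⟩
    exact Module.End.hasEigenvalue_of_hasEigenvector (x := z)
      (Module.End.hasEigenvector_iff.2 ⟨Module.End.mem_eigenspace_iff.2 h, hz⟩)

lemma IsEigenvalue.mem_spectrum {E : Type*} [NormedAddCommGroup E] [NormedSpace ℂ E]
    {T : E →L[ℂ] E} {l : ℂ} (h : IsEigenvalue T l) : l ∈ spectrum ℂ T := by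
  obtain ⟨z, hz, hzl⟩ := isEigenvalue_iff.1 h
  rintro ⟨u, hu⟩
  refine hz ?_
  have h1 : (u : E →L[ℂ] E) z = 0 := by
    rw [hu]
    simp [hzl, Algebra.algebraMap_eq_smul_one]
  have h2 : ((↑u⁻¹ * (u : E →L[ℂ] E) : E →L[ℂ] E)) z = 0 := by
    rw [mul_apply_eq_comp, h1, map_zero]
  simpa using h2

variable {H : Type*} [NormedAddCommGroup H] [NormedSpace ℂ H] [CompleteSpace H]
  {T : H →L[ℂ] H} {φ : H →L[ℂ] ℂ} {e : H}

omit [CompleteSpace H] in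
/-- If `ker T` is spanned by `e` and `T` plus a rank one operator satisfies the Fredholm
alternative, then the image of `T` is the annihilator of the left null form `φ`. -/
lemma mem_range_iff_of_surjective_of_injective (hφT : ∀ z, φ (T z) = 0) (hφe : φ e = 1)
    (hker : ∀ z, T z = 0 → ∃ a : ℂ, z = a • e)
    (hF : Function.Injective (T + φ.smulRight e) → Function.Surjective (T + φ.smulRight e))
    (z : H) : z ∈ T.range ↔ φ z = 0 := by
  constructor
  · rintro ⟨w, rfl⟩
    exact hφT w
  · intro hz
    have hinj : Function.Injective (T + φ.smulRight e) := by
      rw [injective_iff_map_eq_zero]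
      intro w hw
      simp only [add_apply, ContinuousLinearMap.smulRight_apply] at hw
      have h1 : φ w = 0 := by
        have := congrArg φ hw
        simpa [hφT, hφe] using this
      rw [h1, zero_smul, add_zero] at hw
      obtain ⟨a, rfl⟩ := hker w hw
      have : a = 0 := by simpa [hφe] using h1
      rw [this, zero_smul]
    obtain ⟨w, hw⟩ := hF hinj z
    simp only [add_apply, ContinuousLinearMap.smulRight_apply] at hw
    have h1 : φ w = 0 := by
      have := congrArg φ hw
      simpa [hφT, hφe, hz] using this
    rw [h1, zero_smul, add_zero] at hw
    exact ⟨w, hw⟩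

lemma mem_resolventSet_iff_bijective {E : Type*} [NormedAddCommGroup E] [NormedSpace ℂ E]
    [CompleteSpace E] {T : E →L[ℂ] E} {l : ℂ} :
    l ∈ resolventSet ℂ T ↔ Function.Bijective fun z => l • z - T z := by
  rw [spectrum.mem_resolventSet_iff, ContinuousLinearMap.isUnit_iff_bijective]
  have : ⇑(algebraMap ℂ (E →L[ℂ] E) l - T) = fun z => l • z - T z := by
    ext z
    simp [Algebra.algebraMap_eq_smul_one]
  rw [this]

variable {E : Type*} [NormedAddCommGroup E] [NormedSpace ℂ E] [CompleteSpace E]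
  {S : E →L[ℂ] E} {j : E →ₗᵢ[ℂ] H} (hj : ∀ w, j (S w) = T (j w))
  (hrange : ∀ z, (∃ w, j w = z) ↔ φ z = 0) (hφT : ∀ z, φ (T z) = 0)

include hj hrange hφT in
lemma mem_resolventSet_restriction {l : ℂ} (hl : l ≠ 0) :
    l ∈ resolventSet ℂ S ↔ l ∈ resolventSet ℂ T := by
  have hjS : ∀ w, j (l • w - S w) = l • j w - T (j w) := fun w => by
    rw [map_sub, map_smul, hj]
  rw [mem_resolventSet_iff_bijective, mem_resolventSet_iff_bijective]
  constructor
  · rintro ⟨hi, hs⟩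
    constructor
    · have : Function.Injective (l • (1 : H →L[ℂ] H) - T) := by
        rw [injective_iff_map_eq_zero]
        intro z hz
        replace hz : l • z = T z := by simpa [sub_eq_zero] using hz
        obtain ⟨w, rfl⟩ := (hrange z).2 (by
          have := congrArg φ hz
          simpa [hφT, hl] using this)
        rw [← hj, ← map_smul] at hz
        have h0 : w = 0 := hi (by simp [j.injective hz])
        rw [h0, map_zero]
      intro z w h
      exact this (by simpa using h)
    · intro y
      obtain ⟨w, hw⟩ : ∃ w, j w = T y := (hrange _).2 (hφT y)
      obtain ⟨u, hu⟩ := hs w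
      refine ⟨l⁻¹ • (y + j u), ?_⟩
      have h1 : l • j u - T (j u) = T y := by rw [← hjS, ← hw, ← hu]
      simp only [map_smul, map_add, smul_inv_smul₀ hl]
      rw [← h1, sub_add_cancel, inv_smul_smul₀ hl, add_sub_cancel_right]
  · rintro ⟨hi, hs⟩
    constructor
    · intro w₁ w₂ h
      exact j.injective (hi (by simpa only [hjS] using congrArg j h))
    · intro w
      obtain ⟨z, hz⟩ := hs (j w)
      obtain ⟨u, rfl⟩ := (hrange z).2 (by
        have := congrArg φ hz
        simpa [hφT, hl, (hrange (j w)).1 ⟨w, rfl⟩] using this)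
      exact ⟨u, j.injective (by rw [hjS]; exact hz)⟩

include hj hrange hφT in
lemma mem_spectrum_restriction {l : ℂ} (hl : l ≠ 0) :
    l ∈ spectrum ℂ S ↔ l ∈ spectrum ℂ T :=
  not_congr (mem_resolventSet_restriction hj hrange hφT hl)

omit [CompleteSpace H] in
include hj hrange in
/-- The restriction to a complement of the kernel inside the image is invertible. -/
lemma zero_notMem_spectrum_restriction (hφe : φ e = 1) (hTe : T e = 0)
    (hker : ∀ z, T z = 0 → ∃ a : ℂ, z = a • e) (hT : ∀ z, z ∈ T.range ↔ φ z = 0) :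
    (0 : ℂ) ∉ spectrum ℂ S := by
  rw [spectrum.mem_iff, not_not, ← spectrum.mem_resolventSet_iff, mem_resolventSet_iff_bijective]
  simp only [zero_smul, zero_sub]
  have hinj : Function.Injective S := by
    rw [injective_iff_map_eq_zero]
    intro w hw
    obtain ⟨a, ha⟩ := hker (j w) (by rw [← hj, hw, map_zero])
    have h1 : φ (j w) = 0 := (hrange _).1 ⟨w, rfl⟩
    have h2 : a = 0 := by simpa [ha, hφe] using h1
    exact j.injective (by rw [ha, h2, zero_smul, map_zero])
  constructor
  · intro w₁ w₂ h
    exact hinj (neg_injective h)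
  · intro w
    obtain ⟨z, hz⟩ := (hT (j w)).2 ((hrange _).1 ⟨w, rfl⟩)
    obtain ⟨u, hu⟩ := (hrange (z - φ z • e)).2 (by simp [hφe])
    refine ⟨-u, j.injective ?_⟩
    simp only [map_neg, neg_neg]
    rw [hj, hu, map_sub, map_smul, hTe, smul_zero, sub_zero]
    exact hz

omit [CompleteSpace H] [CompleteSpace E] in
include hj hrange hφT in
lemma isEigenvalue_restriction {l : ℂ} (hl : l ≠ 0) : IsEigenvalue S l ↔ IsEigenvalue T l := by
  rw [isEigenvalue_iff, isEigenvalue_iff]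
  constructor
  · rintro ⟨w, hw, h⟩
    exact ⟨j w, fun h0 => hw (j.injective (by rw [h0, map_zero])), by rw [← hj, h, map_smul]⟩
  · rintro ⟨z, hz, h⟩
    obtain ⟨w, rfl⟩ := (hrange z).2 (by
      have := congrArg φ h
      simpa [hφT, hl] using this)
    refine ⟨w, fun h0 => hz (by rw [h0, map_zero]), j.injective (by rw [hj, h, map_smul])⟩

include hj hrange hφT in
lemma map_resolvent_restriction {l : ℂ} (hl : l ≠ 0) (hlT : l ∈ resolventSet ℂ T) (w : E) :
    j (resolvent S l w) = resolvent T l (j w) := by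
  have hlS := (mem_resolventSet_restriction hj hrange hφT hl).2 hlT
  have h1 : (algebraMap ℂ (E →L[ℂ] E) l - S) * resolvent S l = 1 := Ring.mul_inverse_cancel _ hlS
  have h2 : resolvent T l * (algebraMap ℂ (H →L[ℂ] H) l - T) = 1 := Ring.inverse_mul_cancel _ hlT
  have h3 := congrArg (fun f => resolvent T l (j (f w))) h1
  have h4 := congrArg (fun f => f (j (resolvent S l w))) h2
  simp only [mul_apply_eq_comp, one_apply_eq_self, sub_apply,
    Algebra.algebraMap_eq_smul_one, smul_apply] at h3 h4
  rw [← h4, ← h3]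
  simp only [map_sub, map_smul, hj]

end Restriction

/-! ### The analytic Fredholm theorem -/

section AnalyticFredholm

variable {H : Type*} [NormedAddCommGroup H] [InnerProductSpace ℂ H] [CompleteSpace H]

omit [CompleteSpace H] in
/-- A compact operator on a Hilbert space is nearly fixed by the orthogonal projection onto the span of
a finite net of the image of the unit ball. -/
lemma IsCompactOperator.exists_norm_sub_starProjection_mul_lt {C : H →L[ℂ] H}
    (hC : IsCompactOperator C) {ε : ℝ} (hε : 0 < ε) :
    ∃ (W : Submodule ℂ H) (_ : FiniteDimensional ℂ W), ‖(1 - W.starProjection) * C‖ < ε := by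
  have hK := (isCompactOperator_iff_isCompact_closure_image_closedBall
    (C : H →ₗ[ℂ] H) one_pos).1 hC
  obtain ⟨t, -, htf, htc⟩ := hK.finite_cover_balls (half_pos hε)
  have hfin : FiniteDimensional ℂ (Submodule.span ℂ t) := FiniteDimensional.span_of_finite ℂ htf
  refine ⟨Submodule.span ℂ t, hfin, ?_⟩
  refine lt_of_le_of_lt ?_ (half_lt_self hε)
  refine ContinuousLinearMap.opNorm_le_of_unit_norm (half_pos hε).le fun x hx => ?_
  obtain ⟨w, hwt, hw⟩ := Set.mem_iUnion₂.1 (htc (subset_closure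
    ⟨x, mem_closedBall_zero_iff.2 hx.le, rfl⟩))
  have hPw : (Submodule.span ℂ t).starProjection w = w :=
    Submodule.starProjection_eq_self_iff.2 (Submodule.subset_span hwt)
  have h1 : ((1 - (Submodule.span ℂ t).starProjection) * C) x =
      (Submodule.span ℂ t)ᗮ.starProjection (C x - w) := by
    rw [Submodule.starProjection_orthogonal', map_sub]
    simp [hPw]
  rw [h1]
  refine (ContinuousLinearMap.le_opNorm _ _).trans ?_
  refine (mul_le_of_le_one_left (norm_nonneg _) (Submodule.starProjection_norm_le _)).trans ?_
  rw [← dist_eq_norm]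
  exact (Metric.mem_ball.1 hw).le

/-- The compression of `Y` to the subspace `W`. -/
def compression (W : Submodule ℂ H) [W.HasOrthogonalProjection] (Y : H →L[ℂ] H) : W →ₗ[ℂ] W :=
  (W.orthogonalProjectionOnto ∘L Y ∘L W.subtypeL : W →L[ℂ] W)

/-- If `P` is the orthogonal projection on `W`, then `1 - P Y` is block triangular: it is invertible
if and only if the compression of `1 - Y` to `W` is. -/
lemma isUnit_one_sub_starProjection_mul_iff (W : Submodule ℂ H) [FiniteDimensional ℂ W]
    (Y : H →L[ℂ] H) :
    IsUnit (1 - W.starProjection * Y) ↔ LinearMap.det (1 - compression W Y) ≠ 0 := by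
  rw [← isUnit_iff_ne_zero, ← LinearMap.isUnit_iff_isUnit_det,
    ContinuousLinearMap.isUnit_iff_bijective, Module.End.isUnit_iff]
  have hc : ∀ w : W, ((((1 : W →ₗ[ℂ] W) - compression W Y) w : W) : H) = (1 - W.starProjection * Y) w := by
    intro w
    simp [compression]
  constructor
  · rintro ⟨hi, -⟩
    have hinj : Function.Injective ((1 : W →ₗ[ℂ] W) - compression W Y) := fun w₁ w₂ h =>
      Subtype.ext (hi (by rw [← hc, ← hc, h]))
    exact ⟨hinj, LinearMap.injective_iff_surjective.1 hinj⟩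
  · rintro ⟨hi, hs⟩
    constructor
    · rw [injective_iff_map_eq_zero]
      intro z hz
      have h1 : z = W.starProjection (Y z) := by simpa [sub_eq_zero] using hz
      have hzW : z ∈ W := by rw [h1]; exact Submodule.starProjection_apply_mem _ _
      have h2 : (⟨z, hzW⟩ : W) = 0 := hi (by
        rw [map_zero]
        exact Subtype.ext (by rw [hc]; exact hz))
      simpa using congrArg Subtype.val h2
    · intro y
      obtain ⟨w, hw⟩ := hs ⟨W.starProjection (Y y), Submodule.starProjection_apply_mem _ _⟩
      refine ⟨y + w, ?_⟩
      rw [map_add, ← hc, hw]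
      simp

lemma analyticAt_det_one_sub_compression (W : Submodule ℂ H) [FiniteDimensional ℂ W]
    {Y : ℂ → H →L[ℂ] H} {l : ℂ} (hY : AnalyticAt ℂ Y l) :
    AnalyticAt ℂ (fun z => LinearMap.det (1 - compression W (Y z))) l := by
  let b := stdOrthonormalBasis ℂ W
  have h : (fun z => LinearMap.det (1 - compression W (Y z))) = fun z =>
      ∑ τ : Equiv.Perm (Fin (Module.finrank ℂ W)), ((Equiv.Perm.sign τ : ℤ) : ℂ) *
        ∏ i, ((1 : Matrix _ _ ℂ) (τ i) i - inner ℂ (b (τ i) : H) (Y z (b i : H))) := by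
    ext z
    rw [← LinearMap.det_toMatrix b.toBasis, Matrix.det_apply']
    refine Finset.sum_congr rfl fun τ _ => ?_
    congr 1
    refine Finset.prod_congr rfl fun i _ => ?_
    rw [map_sub, Matrix.sub_apply, LinearMap.toMatrix_one]
    congr 1
    rw [LinearMap.toMatrix_apply]
    simp only [OrthonormalBasis.coe_toBasis, OrthonormalBasis.coe_toBasis_repr_apply,
      OrthonormalBasis.repr_apply_apply, compression]
    simp
  rw [h]
  refine Finset.analyticAt_fun_sum _ fun τ _ => ?_
  refine analyticAt_const.mul ?_
  refine Finset.analyticAt_fun_prod _ fun i _ => ?_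
  refine analyticAt_const.sub ?_
  have hl : AnalyticAt ℂ (fun z => ((innerSL ℂ (b (τ i) : H)) ∘L
      (ContinuousLinearMap.apply ℂ H (b i : H))) (Y z)) l :=
    (ContinuousLinearMap.analyticAt _ _).comp hY
  simpa using hl

/-- The analytic Fredholm theorem, near one point: an analytic family `1 - C z` with `C l` compact
which is invertible at points arbitrarily close to `l` is invertible on a punctured
neighbourhood of `l`. -/
lemma eventually_isUnit_one_sub {C : ℂ → H →L[ℂ] H} {l : ℂ} (hC : AnalyticAt ℂ C l)
    (hcomp : IsCompactOperator (C l)) (hfreq : ∃ᶠ z in 𝓝 l, IsUnit (1 - C z)) :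
    ∀ᶠ z in 𝓝[≠] l, IsUnit (1 - C z) := by
  obtain ⟨W, hW, hlt⟩ := hcomp.exists_norm_sub_starProjection_mul_lt one_pos
  set P := W.starProjection
  have hXan : AnalyticAt ℂ (fun z => 1 - (1 - P) * C z) l :=
    analyticAt_const.sub (analyticAt_const.mul hC)
  have hXunit : ∀ᶠ z in 𝓝 l, IsUnit (1 - (1 - P) * C z) := by
    have hc : ContinuousAt (fun z => ‖(1 - P) * C z‖) l :=
      (continuousAt_const.mul hC.continuousAt).norm
    filter_upwards [hc.eventually_lt continuousAt_const hlt] with z hz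
    exact isUnit_one_sub_of_norm_lt_one hz
  set Y : ℂ → H →L[ℂ] H := fun z => C z * Ring.inverse (1 - (1 - P) * C z)
  have hYan : AnalyticAt ℂ Y l := by
    obtain ⟨u, hu⟩ := hXunit.self_of_nhds
    refine hC.mul ?_
    have h := analyticAt_inverse (𝕜 := ℂ) u
    rw [hu] at h
    exact h.comp (f := fun z => 1 - (1 - P) * C z) hXan
  have hiff : ∀ᶠ z in 𝓝 l,
      (IsUnit (1 - C z) ↔ LinearMap.det (1 - compression W (Y z)) ≠ 0) := by
    filter_upwards [hXunit] with z hz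
    rw [← isUnit_one_sub_starProjection_mul_iff]
    have hfac : 1 - C z = (1 - P * Y z) * (1 - (1 - P) * C z) := by
      have h1 : Y z * (1 - (1 - P) * C z) = C z := by
        simp only [Y, mul_assoc, Ring.inverse_mul_cancel _ hz, mul_one]
      rw [sub_mul, one_mul, mul_assoc, h1]
      noncomm_ring
    rw [hfac]
    constructor
    · intro h
      have := h.mul hz.ringInverse
      rwa [mul_assoc, Ring.mul_inverse_cancel _ hz, mul_one] at this
    · intro h
      exact h.mul hz
  rcases (analyticAt_det_one_sub_compression W hYan).eventually_eq_zero_or_eventually_ne_zero with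
    h0 | h0
  · exact absurd (hiff.and h0) fun h => hfreq (h.mono fun z hz hu => hz.1.1 hu hz.2)
  · filter_upwards [h0, hiff.filter_mono nhdsWithin_le_nhds] with z h1 h2
    exact h2.2 h1

end AnalyticFredholm

/-! ### Compact perturbations -/

section CompactPerturbation

variable {H : Type*} [NormedAddCommGroup H] [NormedSpace ℂ H] [CompleteSpace H]
  {B K : H →L[ℂ] H} {l : ℂ}

omit [CompleteSpace H] in
lemma mem_resolventSet_add_iff (hl : l ∈ resolventSet ℂ B) :
    l ∈ resolventSet ℂ (B + K) ↔ IsUnit (1 - resolvent B l * K) := by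
  have hfac : algebraMap ℂ (H →L[ℂ] H) l - (B + K) =
      (algebraMap ℂ (H →L[ℂ] H) l - B) * (1 - resolvent B l * K) := by
    rw [mul_sub, mul_one, ← mul_assoc, resolvent, Ring.mul_inverse_cancel _ hl, one_mul, sub_sub]
  rw [spectrum.mem_resolventSet_iff, hfac]
  constructor
  · intro h
    have := (IsUnit.ringInverse hl).mul h
    rwa [← mul_assoc, Ring.inverse_mul_cancel _ hl, one_mul] at this
  · exact fun h => IsUnit.mul hl h

/-- Outside the spectrum of `B`, the spectrum of a compact perturbation of `B` consists of
eigenvalues. -/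
lemma isEigenvalue_of_mem_spectrum_add (hK : IsCompactOperator K) (hl : l ∈ resolventSet ℂ B)
    (h : l ∈ spectrum ℂ (B + K)) : IsEigenvalue (B + K) l := by
  have hC : IsCompactOperator (resolvent B l * K : H →L[ℂ] H) := hK.clm_comp (resolvent B l)
  have h1 : (1 : ℂ) ∉ resolventSet ℂ (resolvent B l * K) := by
    rw [spectrum.mem_resolventSet_iff, map_one]
    exact fun hu => h ((mem_resolventSet_add_iff hl).2 hu)
  have h2 : IsEigenvalue (resolvent B l * K) 1 :=
    (hC.hasEigenvalue_or_mem_resolventSet one_ne_zero).resolve_right h1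
  obtain ⟨z, hz, hz1⟩ := isEigenvalue_iff.1 h2
  refine isEigenvalue_iff.2 ⟨z, hz, ?_⟩
  have h3 : (algebraMap ℂ (H →L[ℂ] H) l - B) * (resolvent B l * K) = K := by
    rw [← mul_assoc, resolvent, Ring.mul_inverse_cancel _ hl, one_mul]
  have h4 := congrArg (fun f => f z) h3
  simp only [mul_apply_eq_comp, sub_apply, Algebra.algebraMap_eq_smul_one, smul_apply,
    one_apply_eq_self] at h4
  rw [mul_apply_eq_comp, one_smul] at hz1
  rw [hz1] at h4
  rw [add_apply, ← h4]
  abel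

/-- The Fredholm alternative for a compact perturbation of an invertible operator. -/
lemma surjective_add_of_injective (hK : IsCompactOperator K) (hl : (0 : ℂ) ∈ resolventSet ℂ B)
    (hinj : Function.Injective (B + K)) : Function.Surjective (B + K) := by
  by_contra hs
  have h : (0 : ℂ) ∈ spectrum ℂ (B + K) := by
    intro h
    rw [mem_resolventSet_iff_bijective] at h
    refine hs fun y => ?_
    obtain ⟨z, hz⟩ := h.2 (-y)
    exact ⟨z, by simpa only [zero_smul, zero_sub, neg_inj] using hz⟩
  obtain ⟨z, hz, h0⟩ := isEigenvalue_iff.1 (isEigenvalue_of_mem_spectrum_add hK hl h)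
  exact hz (hinj (by rw [h0, zero_smul, map_zero]))

/-- Outside the spectrum of `B`, the boundary points of the spectrum of a compact perturbation of `B`
are isolated. -/
lemma eventually_mem_resolventSet_add {H : Type*} [NormedAddCommGroup H] [InnerProductSpace ℂ H]
    [CompleteSpace H] {B K : H →L[ℂ] H} {l : ℂ} (hK : IsCompactOperator K)
    (hl : l ∈ resolventSet ℂ B) (hfreq : ∃ᶠ z in 𝓝 l, z ∈ resolventSet ℂ (B + K)) :
    ∀ᶠ z in 𝓝[≠] l, z ∈ resolventSet ℂ (B + K) := by
  have hopen : ∀ᶠ z in 𝓝 l, z ∈ resolventSet ℂ B :=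
    (spectrum.isOpen_resolventSet B).mem_nhds hl
  have han : AnalyticAt ℂ (fun z => resolvent B z * K) l := by
    refine AnalyticAt.mul ?_ analyticAt_const
    refine DifferentiableOn.analyticAt (s := resolventSet ℂ B) (fun z hz => ?_) hopen
    exact (spectrum.hasDerivAt_resolvent_const_left hz).differentiableAt.differentiableWithinAt
  have h := eventually_isUnit_one_sub han (hK.clm_comp (resolvent B l)) ?_
  · filter_upwards [h, hopen.filter_mono nhdsWithin_le_nhds] with z h1 h2
    exact (mem_resolventSet_add_iff h2).2 h1
  · exact (hfreq.and_eventually hopen).mono fun z hz => (mem_resolventSet_add_iff hz.2).1 hz.1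

end CompactPerturbation

/-! ### Riesz projectors -/

section RieszProjector

/-- The Riesz projector `(1 / 2iπ) ∮ (z - a)⁻¹ dz` over a circle. -/
def rieszProjector {A : Type*} [NormedRing A] [NormedAlgebra ℂ A] (a : A) (l : ℂ) (r : ℝ) : A :=
  (2 * Real.pi * Complex.I : ℂ)⁻¹ • ∮ z in C(l, r), resolvent a z

/-- A bounded operator between Banach spaces commutes with contour integrals. -/
lemma ContinuousLinearMap.circleIntegral_comp_comm {E F : Type*} [NormedAddCommGroup E]
    [NormedSpace ℂ E] [CompleteSpace E] [NormedAddCommGroup F] [NormedSpace ℂ F] [CompleteSpace F]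
    (L : E →L[ℂ] F) {f : ℂ → E} {c : ℂ} {R : ℝ} (hf : CircleIntegrable f c R) :
    (∮ z in C(c, R), L (f z)) = L (∮ z in C(c, R), f z) := by
  simp only [circleIntegral, ← L.map_smul]
  exact L.intervalIntegral_comp_comm hf.out

variable {A : Type*} [NormedRing A] [NormedAlgebra ℂ A] [CompleteSpace A] {a : A} {l : ℂ} {r : ℝ}

lemma continuousOn_resolvent (a : A) : ContinuousOn (resolvent a) (resolventSet ℂ a) :=
  fun _ hz => (spectrum.hasDerivAt_resolvent_const_left hz).continuousAt.continuousWithinAt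

/-- If `l` is the only point of the spectrum in a disc, the Riesz projector of `l` is idempotent. With
two concentric circles, `(z - a)⁻¹ P = (z - a)⁻¹ - h z` on the inner one, where `h` is a Cauchy
integral over the outer one, hence holomorphic inside. -/
lemma isIdempotentElem_rieszProjector (hr : 0 < r)
    (hres : ∀ z ∈ Metric.closedBall l r, z ≠ l → z ∈ resolventSet ℂ a) :
    IsIdempotentElem (rieszProjector a l r) := by
  have h2pi : (2 * Real.pi * Complex.I : ℂ) ≠ 0 := Complex.two_pi_I_ne_zero
  have hcont : ContinuousOn (resolvent a) (Metric.closedBall l r \ Metric.ball l (r / 2)) :=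
    (continuousOn_resolvent a).mono fun z hz => hres z hz.1 (by
      rintro rfl
      exact hz.2 (Metric.mem_ball_self (half_pos hr)))
  have hsph : ContinuousOn (resolvent a) (Metric.sphere l r) :=
    hcont.mono fun z hz => ⟨Metric.sphere_subset_closedBall hz, by
      simp only [Metric.mem_sphere] at hz
      simp only [Metric.mem_ball, hz]
      linarith⟩
  have hsph' : ContinuousOn (resolvent a) (Metric.sphere l (r / 2)) :=
    hcont.mono fun z hz => by
      simp only [Metric.mem_sphere] at hz
      simp only [Set.mem_sdiff, Metric.mem_closedBall, Metric.mem_ball, hz]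
      exact ⟨by linarith, lt_irrefl _⟩
  have hint : CircleIntegrable (resolvent a) l r := hsph.circleIntegrable hr.le
  have hint' : CircleIntegrable (resolvent a) l (r / 2) := hsph'.circleIntegrable (half_pos hr).le
  set P := rieszProjector a l r with hP
  have hPeq : rieszProjector a l (r / 2) = P := by
    rw [hP, rieszProjector, rieszProjector]
    congr 1
    refine (Complex.circleIntegral_eq_of_differentiable_on_annulus_off_countable (half_pos hr)
      (by linarith) Set.countable_empty hcont fun z hz => ?_).symm
    refine (spectrum.hasDerivAt_resolvent_const_left (hres z
      (Metric.ball_subset_closedBall hz.1.1) ?_)).differentiableAt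
    rintro rfl
    exact hz.1.2 (Metric.mem_closedBall_self (half_pos hr).le)
  set h : ℂ → A := fun w => (2 * Real.pi * Complex.I : ℂ)⁻¹ •
    ∮ z in C(l, r), (z - w)⁻¹ • resolvent a z with hh
  have hhol : DifferentiableOn ℂ h (Metric.ball l r) := by
    let R : NNReal := ⟨r, hr.le⟩
    have := (hasFPowerSeriesOn_cauchy_integral (R := R) hint hr).differentiableOn
    have e : Metric.eball l (R : ENNReal) = Metric.ball l r := Metric.eball_coe
    exact this.mono e.symm.subset
  have hball : Metric.closedBall l (r / 2) ⊆ Metric.ball l r :=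
    Metric.closedBall_subset_ball (by linarith)
  have hzero : (∮ z in C(l, r / 2), h z) = 0 :=
    Complex.circleIntegral_eq_zero_of_differentiable_on_off_countable (half_pos hr).le
      Set.countable_empty (hhol.continuousOn.mono hball) fun z hz =>
        (hhol z (hball (Metric.ball_subset_closedBall hz.1))).differentiableAt
          (Metric.isOpen_ball.mem_nhds (hball (Metric.ball_subset_closedBall hz.1)))
  have hkey : ∀ z ∈ Metric.sphere l (r / 2), resolvent a z * P = resolvent a z - h z := by
    intro z hz
    have hzb : z ∈ Metric.ball l r := hball (Metric.sphere_subset_closedBall hz)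
    have hzres : z ∈ resolventSet ℂ a := hres z (Metric.ball_subset_closedBall hzb) (by
      rintro rfl
      simp at hz
      linarith)
    have h1 : resolvent a z * P = (2 * Real.pi * Complex.I : ℂ)⁻¹ •
        ∮ w in C(l, r), resolvent a z * resolvent a w := by
      rw [hP, rieszProjector, mul_smul_comm]
      congr 1
      exact (ContinuousLinearMap.circleIntegral_comp_comm
        (ContinuousLinearMap.mul ℂ A (resolvent a z)) hint).symm
    have hne : ∀ w ∈ Metric.sphere l r, w - z ≠ 0 := fun w hw h0 => by
      rw [sub_eq_zero.1 h0] at hw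
      simp only [Metric.mem_sphere, Metric.mem_ball] at hw hzb
      linarith
    have hcinv : ContinuousOn (fun w => (w - z)⁻¹) (Metric.sphere l r) :=
      (continuousOn_id.sub continuousOn_const).inv₀ hne
    have h2 : (∮ w in C(l, r), resolvent a z * resolvent a w) =
        ∮ w in C(l, r), ((w - z)⁻¹ • resolvent a z - (w - z)⁻¹ • resolvent a w) := by
      refine circleIntegral.integral_congr hr.le fun w hw => ?_
      have hwres : w ∈ resolventSet ℂ a := hres w (Metric.sphere_subset_closedBall hw) (by
        rintro rfl
        simp at hw
        linarith)
      have h3 : resolvent a z - resolvent a w = (w - z) • (resolvent a z * resolvent a w) := by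
        have e1 : resolvent a z * (algebraMap ℂ A z - a) = 1 := Ring.inverse_mul_cancel _ hzres
        have e2 : (algebraMap ℂ A w - a) * resolvent a w = 1 := Ring.mul_inverse_cancel _ hwres
        calc resolvent a z - resolvent a w
            = resolvent a z * ((algebraMap ℂ A w - a) * resolvent a w) -
              (resolvent a z * (algebraMap ℂ A z - a)) * resolvent a w := by
              rw [e1, e2, mul_one, one_mul]
          _ = resolvent a z * (algebraMap ℂ A (w - z)) * resolvent a w := by
              rw [map_sub]; noncomm_ring
          _ = (w - z) • (resolvent a z * resolvent a w) := by
              rw [Algebra.algebraMap_eq_smul_one]; simp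
      rw [← smul_sub, h3, inv_smul_smul₀ (hne w hw)]
    have h4 := circleIntegral.integral_sub (f := fun w => (w - z)⁻¹ • resolvent a z)
      (g := fun w => (w - z)⁻¹ • resolvent a w)
      ((hcinv.smul continuousOn_const).circleIntegrable hr.le)
      ((hcinv.smul hsph).circleIntegrable hr.le)
    rw [h1, h2, h4, circleIntegral.integral_smul_const,
      circleIntegral.integral_sub_inv_of_mem_ball hzb, smul_sub, inv_smul_smul₀ h2pi]
  have hfin : rieszProjector a l (r / 2) * P = rieszProjector a l (r / 2) := by
    have hhint : CircleIntegrable h l (r / 2) := (hhol.continuousOn.mono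
      (Metric.sphere_subset_closedBall.trans hball)).circleIntegrable (half_pos hr).le
    have h1 := ContinuousLinearMap.circleIntegral_comp_comm
      ((ContinuousLinearMap.mul ℂ A).flip P) hint'
    simp only [ContinuousLinearMap.flip_apply, ContinuousLinearMap.mul_apply'] at h1
    rw [rieszProjector, smul_mul_assoc, ← h1,
      circleIntegral.integral_congr (half_pos hr).le hkey,
      circleIntegral.integral_sub hint' hhint, hzero, sub_zero]
  rwa [hPeq] at hfin

end RieszProjector

section FiniteRank

/-- The integral of a function with values in a closed subspace belongs to that subspace. -/
lemma Submodule.circleIntegral_mem {E : Type*} [NormedAddCommGroup E] [NormedSpace ℂ E]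
    [CompleteSpace E] (N : Submodule ℂ E) (hN : IsClosed (N : Set E)) {f : ℂ → E} {c : ℂ} {R : ℝ}
    (hR : 0 ≤ R) (hf : ContinuousOn f (Metric.sphere c R)) (hfN : ∀ z ∈ Metric.sphere c R, f z ∈ N) :
    (∮ z in C(c, R), f z) ∈ N := by
  have hc : Continuous fun θ : ℝ => deriv (circleMap c R) θ • f (circleMap c R θ) := by
    refine Continuous.smul ?_ (hf.comp_continuous (continuous_circleMap c R)
      fun θ => circleMap_mem_sphere c hR θ)
    have h : deriv (circleMap c R) = fun θ => circleMap 0 R θ * Complex.I :=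
      funext fun θ => deriv_circleMap c R θ
    rw [h]
    exact (continuous_circleMap 0 R).mul continuous_const
  have hconv : Convex ℝ (N : Set E) := (N.restrictScalars ℝ).convex
  have hav := hconv.set_average_mem (μ := volume) (t := Set.uIoc 0 (2 * Real.pi)) hN
    (f := fun θ : ℝ => deriv (circleMap c R) θ • f (circleMap c R θ))
    (by rw [Set.uIoc_of_le Real.two_pi_pos.le]; simp [Real.pi_pos])
    (by rw [Set.uIoc_of_le Real.two_pi_pos.le]; exact measure_Ioc_lt_top.ne)
    (Eventually.of_forall fun θ => N.smul_mem _ (hfN _ (circleMap_mem_sphere c hR θ)))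
    (hc.intervalIntegrable 0 (2 * Real.pi)).def'
  rw [interval_average_eq] at hav
  have := (N.restrictScalars ℝ).smul_mem (2 * Real.pi - 0) hav
  rwa [smul_inv_smul₀ (by simp [Real.pi_ne_zero])] at this

lemma finiteDimensional_range_of_isCompactOperator {H : Type*} [NormedAddCommGroup H]
    [NormedSpace ℂ H] {P : H →L[ℂ] H} (hP : IsCompactOperator P) (hid : IsIdempotentElem P) :
    FiniteDimensional ℂ P.range := by
  have hfix : ∀ z : P.range, P z = z := by
    rintro ⟨_, z, rfl⟩
    exact congrArg (fun f => f z) hid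
  have hclosed : IsClosed (P.range : Set H) := by
    have : (P.range : Set H) = {z | P z = z} := by
      ext z
      exact ⟨fun hz => hfix ⟨z, hz⟩, fun hz => ⟨z, hz⟩⟩
    rw [this]
    exact isClosed_eq P.continuous continuous_id
  have h := IsCompactOperator.restrict (f := (P : H →ₗ[ℂ] H)) hP (V := P.range)
    (fun z _ => ⟨z, rfl⟩) hclosed
  refine FiniteDimensional.of_isCompactOperator_id (𝕜 := ℂ) ?_
  have e : ⇑((P : H →ₗ[ℂ] H).restrict (p := P.range) (q := P.range) fun z _ => ⟨z, rfl⟩) = id :=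
    funext fun z => Subtype.ext (hfix z)
  rwa [e] at h

variable {H : Type*} [NormedAddCommGroup H] [NormedSpace ℂ H] [CompleteSpace H]
  {B K : H →L[ℂ] H} {l : ℂ} {r : ℝ}

/-- The Riesz projectors of a compact perturbation of `B` have finite rank, off the spectrum of `B`:
up to the holomorphic family `(z - B)⁻¹`, the resolvent is compact. -/
lemma finiteDimensional_range_rieszProjector_add (hK : IsCompactOperator K) (hr : 0 < r)
    (hB : Metric.closedBall l r ⊆ resolventSet ℂ B)
    (hres : ∀ z ∈ Metric.closedBall l r, z ≠ l → z ∈ resolventSet ℂ (B + K)) :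
    FiniteDimensional ℂ (rieszProjector (B + K) l r).range := by
  refine finiteDimensional_range_of_isCompactOperator ?_ (isIdempotentElem_rieszProjector hr hres)
  have hsphB : Metric.sphere l r ⊆ resolventSet ℂ B := Metric.sphere_subset_closedBall.trans hB
  have hsphT : Metric.sphere l r ⊆ resolventSet ℂ (B + K) := fun z hz =>
    hres z (Metric.sphere_subset_closedBall hz) (by
      rintro rfl
      simp at hz
      linarith)
  have hcB := (continuousOn_resolvent B).mono hsphB
  have hcT := (continuousOn_resolvent (B + K)).mono hsphT
  have hc : ContinuousOn (fun z => resolvent (B + K) z * K * resolvent B z) (Metric.sphere l r) :=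
    (hcT.mul continuousOn_const).mul hcB
  have hsplit : ∀ z ∈ Metric.sphere l r,
      resolvent (B + K) z = resolvent B z + resolvent (B + K) z * K * resolvent B z := by
    intro z hz
    have e1 : resolvent (B + K) z * (algebraMap ℂ (H →L[ℂ] H) z - (B + K)) = 1 :=
      Ring.inverse_mul_cancel _ (hsphT hz)
    have e2 : (algebraMap ℂ (H →L[ℂ] H) z - B) * resolvent B z = 1 :=
      Ring.mul_inverse_cancel _ (hsphB hz)
    calc resolvent (B + K) z
        = resolvent (B + K) z * ((algebraMap ℂ (H →L[ℂ] H) z - B) * resolvent B z) := by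
          rw [e2, mul_one]
      _ = (resolvent (B + K) z * (algebraMap ℂ (H →L[ℂ] H) z - (B + K))) * resolvent B z +
            resolvent (B + K) z * K * resolvent B z := by noncomm_ring
      _ = _ := by rw [e1, one_mul]
  have hzero : (∮ z in C(l, r), resolvent B z) = 0 :=
    Complex.circleIntegral_eq_zero_of_differentiable_on_off_countable hr.le
      Set.countable_empty ((continuousOn_resolvent B).mono hB) fun z hz =>
        (spectrum.hasDerivAt_resolvent_const_left
          (hB (Metric.ball_subset_closedBall hz.1))).differentiableAt
  have hmem : (∮ z in C(l, r), resolvent (B + K) z * K * resolvent B z) ∈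
      compactOperator (RingHom.id ℂ) H H :=
    Submodule.circleIntegral_mem _ isClosed_setOfPred_isCompactOperator hr.le hc fun z _ =>
      (hK.clm_comp (resolvent (B + K) z)).comp_clm (resolvent B z)
  have hP : rieszProjector (B + K) l r ∈ compactOperator (RingHom.id ℂ) H H := by
    rw [rieszProjector, circleIntegral.integral_congr hr.le hsplit,
      circleIntegral.integral_add (hcB.circleIntegrable hr.le) (hc.circleIntegrable hr.le), hzero,
      zero_add]
    exact Submodule.smul_mem _ _ hmem
  exact hP

/-- The Riesz projector of the restriction of `T` to an invariant subspace is a restriction of the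
Riesz projector of `T`; finiteness of the rank is inherited. -/
lemma finiteDimensional_range_rieszProjector_restriction {E : Type*} [NormedAddCommGroup E]
    [NormedSpace ℂ E] [CompleteSpace E] {T : H →L[ℂ] H} {S : E →L[ℂ] E} (j : E →ₗᵢ[ℂ] H)
    (hr : 0 < r) (hT : Metric.sphere l r ⊆ resolventSet ℂ T)
    (hS : Metric.sphere l r ⊆ resolventSet ℂ S)
    (hj : ∀ z ∈ Metric.sphere l r, ∀ w, j (resolvent S z w) = resolvent T z (j w))
    (hfin : FiniteDimensional ℂ (rieszProjector T l r).range) :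
    FiniteDimensional ℂ (rieszProjector S l r).range := by
  have hcS := ((continuousOn_resolvent S).mono hS).circleIntegrable hr.le
  have hcT := ((continuousOn_resolvent T).mono hT).circleIntegrable hr.le
  have hint : ∀ w, j (rieszProjector S l r w) = rieszProjector T l r (j w) := by
    intro w
    have h1 := ContinuousLinearMap.circleIntegral_comp_comm
      (j.toContinuousLinearMap ∘L ContinuousLinearMap.apply ℂ E w) hcS
    have h2 := ContinuousLinearMap.circleIntegral_comp_comm (ContinuousLinearMap.apply ℂ H (j w)) hcT
    have h3 := circleIntegral.integral_congr hr.le fun z hz => hj z hz w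
    simp only [rieszProjector, smul_apply, map_smul]
    congr 1
    exact h1.symm.trans (h3.trans h2)
  let g : (rieszProjector S l r).range →ₗ[ℂ] (rieszProjector T l r).range :=
    (j.toLinearMap.comp (rieszProjector S l r).range.subtype).codRestrict _ (by
      rintro ⟨_, w, rfl⟩
      exact ⟨j w, (hint w).symm⟩)
  refine FiniteDimensional.of_injective g fun x y hxy => ?_
  exact Subtype.ext (j.injective (congrArg Subtype.val hxy))

end FiniteRank

/-! ### Positivity for irreducible kernels -/

section Positivity

variable {α : Type*} [MeasurableSpace α] {μ : Measure α} {k : α × α → ℝ} {C : ℝ} {S w : α → ℝ}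

/-- A nonnegative integrable kernel `k` is irreducible if there is no interaction from `B` to its
complement only when `B` or its complement is negligible. -/
def IsIrreducibleKernel (k : α × α → ℝ) (μ : Measure α) : Prop :=
  ∀ B : Set α, MeasurableSet B → ∫ p in B ×ˢ Bᶜ, k p ∂(μ.prod μ) = 0 → μ B = 0 ∨ μ Bᶜ = 0

/-- A bounded nonnegative measurable kernel. -/
structure IsBoundedKernel (k : α × α → ℝ) (C : ℝ) (μ : Measure α) : Prop where
  aestronglyMeasurable : AEStronglyMeasurable k (μ.prod μ)
  nonneg : ∀ᵐ p ∂(μ.prod μ), 0 ≤ k p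
  le : ∀ᵐ p ∂(μ.prod μ), k p ≤ C

lemma IsBoundedKernel.ae_norm_le (hk : IsBoundedKernel k C μ) : ∀ᵐ p ∂(μ.prod μ), ‖k p‖ ≤ C := by
  filter_upwards [hk.nonneg, hk.le] with p h0 h1
  rwa [Real.norm_of_nonneg h0]

variable [IsFiniteMeasure μ]

lemma IsBoundedKernel.swap (hk : IsBoundedKernel k C μ) : IsBoundedKernel (k ∘ Prod.swap) C μ where
  aestronglyMeasurable := hk.aestronglyMeasurable.prod_swap
  nonneg := Measure.measurePreserving_swap.quasiMeasurePreserving.ae hk.nonneg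
  le := Measure.measurePreserving_swap.quasiMeasurePreserving.ae hk.le

lemma IsIrreducibleKernel.swap (hk : IsIrreducibleKernel k μ) :
    IsIrreducibleKernel (k ∘ Prod.swap) μ := by
  intro B hB h
  have h1 : ∫ p in Bᶜ ×ˢ Bᶜᶜ, k p ∂(μ.prod μ) = 0 := by
    rw [compl_compl, ← setIntegral_prod_swap]
    exact h
  have := hk Bᶜ hB.compl h1
  rw [compl_compl] at this
  exact this.symm

lemma IsBoundedKernel.integrable (hk : IsBoundedKernel k C μ) : Integrable k (μ.prod μ) :=
  .of_bound hk.aestronglyMeasurable C hk.ae_norm_le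

lemma IsBoundedKernel.ae_integrable_smul {F : Type*} [NormedAddCommGroup F] [NormedSpace ℝ F]
    (hk : IsBoundedKernel k C μ) {z : α → F} (hz : Integrable z μ) :
    ∀ᵐ x ∂μ, Integrable (fun y => k (x, y) • z y) μ := by
  filter_upwards [hk.aestronglyMeasurable.prodMk_left, Measure.ae_ae_of_ae_prod hk.ae_norm_le] with
    x hm hb
  exact hz.bdd_smul _ hm hb

omit [IsFiniteMeasure μ] in
lemma IsBoundedKernel.integrable_mul_mul (hk : IsBoundedKernel k C μ) {f g : α → ℝ}
    (hf : Integrable f μ) (hg : Integrable g μ) :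
    Integrable (fun p : α × α => k p * (f p.1 * g p.2)) (μ.prod μ) :=
  (hf.mul_prod hg).bdd_mul hk.aestronglyMeasurable hk.ae_norm_le

/-- Kato's inequality, tested against a positive left null vector `w`: if `K z = (S + l) z` with
`Re l ≥ 0`, then `|z|` is a null vector of `K - S`, and `S + l` has modulus `S` wherever `z ≠ 0`. -/
lemma ae_integral_kernel_norm_eq {𝕜 : Type*} [RCLike 𝕜] (hk : IsBoundedKernel k C μ)
    (hw : Integrable w μ) (hw0 : ∀ᵐ x ∂μ, 0 < w x)
    (hleft : ∀ᵐ y ∂μ, ∫ x, k (x, y) * w x ∂μ = S y * w y)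
    {z : α → 𝕜} (hz : Integrable z μ) {l : 𝕜} (hl : 0 ≤ RCLike.re l)
    (heq : ∀ᵐ x ∂μ, ∫ y, k (x, y) • z y ∂μ = ((S x : 𝕜) + l) * z x) :
    ∀ᵐ x ∂μ, ∫ y, k (x, y) * ‖z y‖ ∂μ = S x * ‖z x‖ ∧ ‖(S x : 𝕜) + l‖ * ‖z x‖ = S x * ‖z x‖ := by
  have hint : Integrable (fun p : α × α => k p * (w p.1 * ‖z p.2‖)) (μ.prod μ) :=
    hk.integrable_mul_mul hw hz.norm
  have hle : ∀ᵐ x ∂μ, ‖(S x : 𝕜) + l‖ * ‖z x‖ ≤ ∫ y, k (x, y) * ‖z y‖ ∂μ := by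
    filter_upwards [heq, Measure.ae_ae_of_ae_prod hk.nonneg] with x hx h0
    rw [← norm_mul, ← hx]
    refine (norm_integral_le_integral_norm _).trans_eq (integral_congr_ae ?_)
    filter_upwards [h0] with y hy
    rw [norm_smul, Real.norm_of_nonneg hy]
  have hS : ∀ x, S x ≤ ‖(S x : 𝕜) + l‖ := fun x => by
    refine le_trans ?_ (RCLike.re_le_norm _)
    rw [map_add, RCLike.ofReal_re]
    linarith
  have hleft_int : (fun x => ∫ y, k (x, y) * (w x * ‖z y‖) ∂μ) =
      fun x => w x * ∫ y, k (x, y) * ‖z y‖ ∂μ := by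
    ext x
    rw [← integral_const_mul]
    congr 1
    ext y
    ring
  have hright_int : (fun y => ∫ x, k (x, y) * (w x * ‖z y‖) ∂μ) =ᵐ[μ] fun y => w y * (S y * ‖z y‖) := by
    filter_upwards [hleft] with y hy
    have : (fun x => k (x, y) * (w x * ‖z y‖)) = fun x => (k (x, y) * w x) * ‖z y‖ := by
      ext x; ring
    rw [this, integral_mul_const, hy]
    ring
  have hi1 : Integrable (fun x => w x * ∫ y, k (x, y) * ‖z y‖ ∂μ) μ := by
    rw [← hleft_int]
    exact hint.integral_prod_left
  have hi2 : Integrable (fun y => w y * (S y * ‖z y‖)) μ :=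
    hint.integral_prod_right.congr hright_int
  have hzero : ∫ x, (w x * (∫ y, k (x, y) * ‖z y‖ ∂μ) - w x * (S x * ‖z x‖)) ∂μ = 0 := by
    rw [integral_sub hi1 hi2, sub_eq_zero, ← integral_congr_ae hright_int, ← hleft_int]
    exact integral_integral_swap hint
  have hnn : 0 ≤ᵐ[μ] fun x => w x * (∫ y, k (x, y) * ‖z y‖ ∂μ) - w x * (S x * ‖z x‖) := by
    filter_upwards [hle, hw0] with x h1 h2
    have h3 := mul_le_mul_of_nonneg_right (hS x) (norm_nonneg (z x))
    simp only [Pi.zero_apply]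
    rw [← mul_sub]
    exact mul_nonneg h2.le (by linarith)
  filter_upwards [(integral_eq_zero_iff_of_nonneg_ae hnn (hi1.sub hi2)).1 hzero, hle, hw0] with
    x h0 h1 h2
  have h3 : ∫ y, k (x, y) * ‖z y‖ ∂μ = S x * ‖z x‖ := by
    simp only [Pi.zero_apply, ← mul_sub] at h0
    linarith [(mul_eq_zero.1 h0).resolve_left h2.ne']
  have h4 := mul_le_mul_of_nonneg_right (hS x) (norm_nonneg (z x))
  exact ⟨h3, le_antisymm (by linarith) h4⟩

/-- A nonnegative null vector of an irreducible kernel vanishes almost everywhere or almost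
nowhere. -/
lemma ae_eq_zero_or_ae_pos_of_nonneg (hk : IsBoundedKernel k C μ) (hirr : IsIrreducibleKernel k μ)
    {u : α → ℝ} (hu : Integrable u μ) (hu0 : ∀ᵐ x ∂μ, 0 ≤ u x)
    (heq : ∀ᵐ x ∂μ, ∫ y, k (x, y) * u y ∂μ = S x * u x) :
    (∀ᵐ x ∂μ, u x = 0) ∨ ∀ᵐ x ∂μ, 0 < u x := by
  set u' := hu.aestronglyMeasurable.mk u
  have hu' : u =ᵐ[μ] u' := hu.aestronglyMeasurable.ae_eq_mk
  have hmeas : MeasurableSet {x | u' x = 0} :=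
    hu.aestronglyMeasurable.stronglyMeasurable_mk.measurable (measurableSet_singleton 0)
  set B := {x | u' x = 0}
  have hB : ∫ p in B ×ˢ Bᶜ, k p ∂(μ.prod μ) = 0 := by
    rw [setIntegral_prod _ hk.integrable.integrableOn]
    refine setIntegral_eq_zero_of_ae_eq_zero ?_
    filter_upwards [heq, hu', hk.ae_integrable_smul hu, Measure.ae_ae_of_ae_prod hk.nonneg] with
      x h1 h2 h3 h4 hxB
    have hnn : 0 ≤ᵐ[μ] fun y => k (x, y) * u y := by
      filter_upwards [h4, hu0] with y h5 h6 using mul_nonneg h5 h6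
    have hux : u x = 0 := h2.trans hxB
    rw [hux, mul_zero] at h1
    refine setIntegral_eq_zero_of_ae_eq_zero ?_
    filter_upwards [(integral_eq_zero_iff_of_nonneg_ae hnn h3).1 h1, hu'] with y h7 h8 hyB
    have huy : u y ≠ 0 := by rw [h8]; exact hyB
    exact (mul_eq_zero.1 h7).resolve_right huy
  rcases hirr B hmeas hB with h | h
  · right
    have h' : ∀ᵐ x ∂μ, x ∉ B := measure_eq_zero_iff_ae_notMem.1 h
    filter_upwards [h', hu', hu0] with x h1 h2 h3
    exact lt_of_le_of_ne h3 (by rw [h2]; exact fun h0 => h1 h0.symm)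
  · left
    have h' : ∀ᵐ x ∂μ, x ∉ Bᶜ := measure_eq_zero_iff_ae_notMem.1 h
    filter_upwards [h', hu'] with x h1 h2
    rw [h2]
    exact not_not.1 h1

/-- A real null vector of an irreducible kernel which has a positive left null vector has a constant
sign. -/
lemma ae_sign_of_integral_kernel_eq (hk : IsBoundedKernel k C μ) (hirr : IsIrreducibleKernel k μ)
    (hw : Integrable w μ) (hw0 : ∀ᵐ x ∂μ, 0 < w x)
    (hleft : ∀ᵐ y ∂μ, ∫ x, k (x, y) * w x ∂μ = S y * w y)
    {z : α → ℝ} (hz : Integrable z μ) (heq : ∀ᵐ x ∂μ, ∫ y, k (x, y) * z y ∂μ = S x * z x) :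
    (∀ᵐ x ∂μ, z x = 0) ∨ (∀ᵐ x ∂μ, 0 < z x) ∨ ∀ᵐ x ∂μ, z x < 0 := by
  have habs := ae_integral_kernel_norm_eq (𝕜 := ℝ) hk hw hw0 hleft hz (l := 0) (by simp)
    (by simpa using heq)
  have hsum : (∀ᵐ x ∂μ, |z x| + z x = 0) ∨ ∀ᵐ x ∂μ, 0 < |z x| + z x := by
    refine ae_eq_zero_or_ae_pos_of_nonneg hk hirr (S := S) (hz.abs.add hz)
      (Eventually.of_forall fun x => ?_) ?_
    · exact by linarith [neg_abs_le (z x)]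
    · filter_upwards [habs, heq, hk.ae_integrable_smul hz, hk.ae_integrable_smul hz.abs] with
        x h1 h2 h3 h4
      simp only [smul_eq_mul] at h3 h4
      simp only [mul_add, Real.norm_eq_abs] at h1 ⊢
      rw [integral_add h4 h3, h1.1, h2]
  have hdiff : (∀ᵐ x ∂μ, |z x| - z x = 0) ∨ ∀ᵐ x ∂μ, 0 < |z x| - z x := by
    refine ae_eq_zero_or_ae_pos_of_nonneg hk hirr (S := S) (hz.abs.sub hz)
      (Eventually.of_forall fun x => ?_) ?_
    · exact by linarith [le_abs_self (z x)]
    · filter_upwards [habs, heq, hk.ae_integrable_smul hz, hk.ae_integrable_smul hz.abs] with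
        x h1 h2 h3 h4
      simp only [smul_eq_mul] at h3 h4
      simp only [mul_sub, Real.norm_eq_abs] at h1 ⊢
      rw [integral_sub h4 h3, h1.1, h2]
  rcases hsum with h | h
  · rcases hdiff with h' | h'
    · left
      filter_upwards [h, h'] with x h1 h2
      linarith
    · right; right
      filter_upwards [h, h'] with x h1 h2
      linarith
  · right; left
    filter_upwards [h] with x h1
    by_contra hle
    rw [abs_of_nonpos (not_lt.1 hle)] at h1
    linarith

omit [IsFiniteMeasure μ] in
lemma integral_pos_of_ae_pos [NeZero μ] {z : α → ℝ} (hz : Integrable z μ)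
    (h : ∀ᵐ x ∂μ, 0 < z x) : 0 < ∫ x, z x ∂μ := by
  have h0 : 0 ≤ᵐ[μ] z := h.mono fun x hx => hx.le
  refine lt_of_le_of_ne (integral_nonneg_of_ae h0) fun h1 => ?_
  have h2 := (integral_eq_zero_iff_of_nonneg_ae h0 hz).1 h1.symm
  obtain ⟨x, hx1, hx2⟩ := (h.and h2).exists
  exact hx1.ne' hx2

/-- A null vector of constant sign and zero mean vanishes. -/
lemma ae_eq_zero_of_integral_eq_zero [NeZero μ] (hk : IsBoundedKernel k C μ)
    (hirr : IsIrreducibleKernel k μ) (hw : Integrable w μ) (hw0 : ∀ᵐ x ∂μ, 0 < w x)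
    (hleft : ∀ᵐ y ∂μ, ∫ x, k (x, y) * w x ∂μ = S y * w y)
    {z : α → ℝ} (hz : Integrable z μ) (heq : ∀ᵐ x ∂μ, ∫ y, k (x, y) * z y ∂μ = S x * z x)
    (hmean : ∫ x, z x ∂μ = 0) : ∀ᵐ x ∂μ, z x = 0 := by
  rcases ae_sign_of_integral_kernel_eq hk hirr hw hw0 hleft hz heq with h | h | h
  · exact h
  · exact absurd hmean (integral_pos_of_ae_pos hz h).ne'
  · have := integral_pos_of_ae_pos hz.neg (h.mono fun x hx => neg_pos.2 hx)
    simp only [Pi.neg_apply, integral_neg] at this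
    linarith

/-- The null vectors of `z ↦ ∫ k(x, y) (z(y) - z(x)) dy` are the constants. -/
lemma ae_eq_const_of_integral_kernel_eq [NeZero μ] (hk : IsBoundedKernel k C μ)
    (hirr : IsIrreducibleKernel k μ) (hw : Integrable w μ) (hw0 : ∀ᵐ x ∂μ, 0 < w x)
    (hleft : ∀ᵐ y ∂μ, ∫ x, k (x, y) * w x ∂μ = S y * w y)
    (hS : ∀ᵐ x ∂μ, ∫ y, k (x, y) ∂μ = S x)
    {z : α → ℝ} (hz : Integrable z μ) (heq : ∀ᵐ x ∂μ, ∫ y, k (x, y) * z y ∂μ = S x * z x) :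
    ∃ c : ℝ, ∀ᵐ x ∂μ, z x = c := by
  have hμ : μ.real Set.univ ≠ 0 := by
    simp [measureReal_def, ENNReal.toReal_eq_zero_iff, NeZero.ne μ]
  set c := (∫ x, z x ∂μ) / μ.real Set.univ
  refine ⟨c, ?_⟩
  have h := ae_eq_zero_of_integral_eq_zero hk hirr hw hw0 hleft (hz.sub (integrable_const c)) ?_ ?_
  · filter_upwards [h] with x hx
    simpa [sub_eq_zero] using hx
  · filter_upwards [heq, hS, hk.ae_integrable_smul hz,
      hk.ae_integrable_smul (integrable_const c)] with x h1 h2 h3 h4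
    simp only [smul_eq_mul] at h3 h4
    simp only [Pi.sub_apply, mul_sub]
    rw [integral_sub h3 h4, h1, integral_mul_const, h2]
  · simp only [Pi.sub_apply]
    rw [integral_sub hz (integrable_const c), integral_const, smul_eq_mul,
      mul_div_cancel₀ _ hμ, sub_self]

/-- The only eigenvalue with nonnegative real part is zero. -/
lemma ae_eq_zero_of_re_nonneg (hk : IsBoundedKernel k C μ)
    (hw : Integrable w μ) (hw0 : ∀ᵐ x ∂μ, 0 < w x)
    (hleft : ∀ᵐ y ∂μ, ∫ x, k (x, y) * w x ∂μ = S y * w y) (hS : ∀ᵐ x ∂μ, 0 ≤ S x)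
    {z : α → ℂ} (hz : Integrable z μ) {l : ℂ} (hl : 0 ≤ l.re) (hl0 : l ≠ 0)
    (heq : ∀ᵐ x ∂μ, ∫ y, k (x, y) • z y ∂μ = ((S x : ℂ) + l) * z x) :
    ∀ᵐ x ∂μ, z x = 0 := by
  filter_upwards [ae_integral_kernel_norm_eq (𝕜 := ℂ) hk hw hw0 hleft hz hl heq, hS] with x h1 h2
  by_contra hzx
  have h3 : ‖(S x : ℂ) + l‖ = S x := mul_right_cancel₀ (norm_ne_zero_iff.2 hzx) h1.2
  have h4 : ‖(S x : ℂ) + l‖ ^ 2 = (S x) ^ 2 := by rw [h3]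
  rw [← Complex.normSq_eq_norm_sq, Complex.normSq_apply] at h4
  simp only [Complex.add_re, Complex.ofReal_re, Complex.add_im, Complex.ofReal_im, zero_add] at h4
  have h5 : l.re = 0 := by nlinarith [mul_nonneg h2 hl, sq_nonneg l.im, sq_nonneg l.re]
  have h6 : l.im = 0 := by
    rw [h5] at h4
    nlinarith
  exact hl0 (Complex.ext h5 h6)

end Positivity

/-! ### Real operators and their complexification -/

section ConsensusPair

variable {X H : Type*} [NormedAddCommGroup X] [InnerProductSpace ℝ X]
  [NormedAddCommGroup H] [NormedSpace ℂ H]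

namespace Complexification

variable (c : Complexification X H) {A : X →L[ℝ] X} {T : H →L[ℂ] H}
  (hT : ∀ x, T (c.ofReal x) = c.ofReal (A x))
include hT

lemma apply_eq (z : H) : T z = c.ofReal (A (c.re z)) + Complex.I • c.ofReal (A (c.im z)) := by
  conv_lhs => rw [c.decomp z]
  rw [map_add, map_smul, hT, hT]

lemma re_apply (z : H) : c.re (T z) = A (c.re z) := by
  rw [c.apply_eq hT, map_add, c.re_ofReal, c.re_I_smul_ofReal, add_zero]

lemma apply_re_im_eq_zero {z : H} (hz : T z = 0) : A (c.re z) = 0 ∧ A (c.im z) = 0 := by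
  have h1 : A (c.re z) = 0 := by rw [← c.re_apply hT, hz, map_zero]
  refine ⟨h1, ?_⟩
  have := c.apply_eq hT z
  rw [hz, h1, map_zero, zero_add] at this
  exact c.ofReal.injective (by
    rw [map_zero]
    exact (smul_eq_zero.1 this.symm).resolve_left Complex.I_ne_zero)

end Complexification

/-- The operator `T` is the complexification of the real operator `A`, whose kernel is spanned by `e`;
`v` is a left null vector of `A` with `⟨e, v⟩ = 1`, and `φ` is the form `⟨·, v⟩` on the
complexification. -/
structure IsConsensusPair (c : Complexification X H) (A : X →L[ℝ] X) (T : H →L[ℂ] H) (e v : X)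
    (φ : H →L[ℂ] ℂ) : Prop where
  map_ofReal : ∀ x, T (c.ofReal x) = c.ofReal (A x)
  form_ofReal : ∀ x, φ (c.ofReal x) = (inner ℝ x v : ℝ)
  apply_eq_zero : A e = 0
  inner_apply : ∀ x, inner ℝ (A x) v = 0
  inner_eq_one : inner ℝ e v = 1
  eq_smul_of_apply_eq_zero : ∀ x, A x = 0 → ∃ a : ℝ, x = a • e

namespace IsConsensusPair

variable {c : Complexification X H} {A : X →L[ℝ] X} {T : H →L[ℂ] H} {e v : X} {φ : H →L[ℂ] ℂ}
  (h : IsConsensusPair c A T e v φ)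
include h

lemma re_apply (z : H) : c.re (T z) = A (c.re z) := c.re_apply h.map_ofReal z

lemma form_apply (z : H) : φ (T z) = 0 := by
  rw [c.apply_eq h.map_ofReal, map_add, map_smul, h.form_ofReal, h.form_ofReal, h.inner_apply, h.inner_apply]
  simp

lemma form_ofReal_eq_one : φ (c.ofReal e) = 1 := by
  rw [h.form_ofReal, h.inner_eq_one, Complex.ofReal_one]

lemma apply_ofReal_eq_zero : T (c.ofReal e) = 0 := by
  rw [h.map_ofReal, h.apply_eq_zero, map_zero]

lemma ker (z : H) (hz : T z = 0) : ∃ a : ℂ, z = a • c.ofReal e := by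
  obtain ⟨h1, h2⟩ := c.apply_re_im_eq_zero h.map_ofReal hz
  obtain ⟨a, ha⟩ := h.eq_smul_of_apply_eq_zero _ h1
  obtain ⟨b, hb⟩ := h.eq_smul_of_apply_eq_zero _ h2
  refine ⟨a + Complex.I * b, ?_⟩
  rw [c.decomp z, ha, hb, map_smul, map_smul, add_smul, mul_smul, Complex.coe_smul, Complex.coe_smul]

lemma weightedMean_eq {y : ℝ → X} (hy : IsSolution A y) {t : ℝ} (ht : 0 ≤ t) :
    weightedMean e v (y t) = weightedMean e v (y 0) := by
  rw [weightedMean, weightedMean, inner_eq_of_isSolution h.inner_apply hy ht]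

variable
  (hF : Function.Injective (T + φ.smulRight (c.ofReal e)) →
    Function.Surjective (T + φ.smulRight (c.ofReal e)))
include hF

lemma mem_range_iff (z : H) : z ∈ T.range ↔ φ z = 0 :=
  mem_range_iff_of_surjective_of_injective h.form_apply h.form_ofReal_eq_one h.ker hF z

lemma exists_coe_eq_iff (z : H) : (∃ w, T.range.subtypeₗᵢ w = z) ↔ φ z = 0 := by
  rw [← h.mem_range_iff hF]
  exact ⟨fun ⟨w, hw⟩ => hw ▸ w.2, fun hz => ⟨⟨z, hz⟩, rfl⟩⟩

variable [CompleteSpace H]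

lemma completeSpace_range : CompleteSpace T.range :=
  completeSpace_range_of_mem_iff (h.mem_range_iff hF)

lemma ne_zero_of_mem_spectrum {l : ℂ} (hl : l ∈ spectrum ℂ (restrictToImage T)) : l ≠ 0 := by
  have := h.completeSpace_range hF
  rintro rfl
  exact zero_notMem_spectrum_restriction (S := restrictToImage T) (j := T.range.subtypeₗᵢ)
    (fun _ => rfl) (h.exists_coe_eq_iff hF) h.form_ofReal_eq_one h.apply_ofReal_eq_zero h.ker
    (h.mem_range_iff hF) hl

lemma mem_spectrum_restrictToImage {l : ℂ} (hl : l ≠ 0) :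
    l ∈ spectrum ℂ (restrictToImage T) ↔ l ∈ spectrum ℂ T := by
  have := h.completeSpace_range hF
  exact mem_spectrum_restriction (S := restrictToImage T) (j := T.range.subtypeₗᵢ)
    (fun _ => rfl) (h.exists_coe_eq_iff hF) h.form_apply hl

omit [CompleteSpace H] in
lemma isEigenvalue_restrictToImage {l : ℂ} (hl : l ≠ 0) :
    IsEigenvalue (restrictToImage T) l ↔ IsEigenvalue T l :=
  isEigenvalue_restriction (S := restrictToImage T) (j := T.range.subtypeₗᵢ)
    (fun _ => rfl) (h.exists_coe_eq_iff hF) h.form_apply hl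

lemma convergesAtRate [Nontrivial T.range] :
    ConvergesAtRate A e v (-spectralBound (restrictToImage T)) := by
  have := h.completeSpace_range hF
  exact convergesAtRate_neg_spectralBound (S := restrictToImage T) c h.map_ofReal h.form_ofReal
    T.range.subtypeₗᵢ (fun _ => rfl) (h.exists_coe_eq_iff hF) h.apply_eq_zero h.inner_eq_one

lemma noBetterRate [Nontrivial T.range] (hneg : spectralBound (restrictToImage T) < 0) :
    NoBetterRate A e v (-spectralBound (restrictToImage T)) := by
  have := h.completeSpace_range hF
  exact noBetterRate_neg_spectralBound (S := restrictToImage T) c h.map_ofReal h.re_apply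
    h.form_ofReal T.range.subtypeₗᵢ (fun _ => rfl) (h.exists_coe_eq_iff hF) hneg

end IsConsensusPair

end ConsensusPair

/-! ### Sets closed under the arcs of a strongly connected graph -/

lemma Digraph.StronglyConnected.mem_of_forall_adj {V : Type*} {G : Digraph V}
    (hG : G.StronglyConnected) {s : Set V} (hs : ∀ a b, a ∈ s → G.Adj a b → b ∈ s) {i : V}
    (hi : i ∈ s) (j : V) : j ∈ s := by
  rcases eq_or_ne i j with rfl | hij
  · exact hi
  obtain ⟨r, -, p, -, h0, hr, hadj⟩ := hG i j hij
  have hall : ∀ n : Fin (r + 1), p n ∈ s := by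
    intro n
    induction n using Fin.induction with
    | zero => rwa [h0]
    | succ n ih => exact hs _ _ ih (hadj n)
  rw [← hr]
  exact hall _

/-! ### The finite-dimensional model -/

section FiniteModel

variable {N : ℕ} {σ : Matrix (Fin N) (Fin N) ℝ}

lemma consensusMatrix_eq (σ : Matrix (Fin N) (Fin N) ℝ) :
    consensusMatrix σ = σ - Matrix.diagonal fun i => ∑ j, σ i j := by
  rw [consensusMatrix]
  congr 2
  ext i
  simp [Matrix.mulVec, dotProduct]

lemma finiteOperator_apply (𝕜 : Type*) [RCLike 𝕜] (σ : Matrix (Fin N) (Fin N) ℝ)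
    (z : EuclideanSpace 𝕜 (Fin N)) (i : Fin N) :
    finiteOperator 𝕜 σ z i = ∑ j, (σ i j : 𝕜) * z j - ((∑ j, σ i j : ℝ) : 𝕜) * z i := by
  rw [finiteOperator, Matrix.ofLp_toEuclideanCLM, Matrix.mulVec, dotProduct]
  simp only [consensusMatrix_eq, Matrix.map_apply, Matrix.sub_apply, map_sub, sub_mul,
    Finset.sum_sub_distrib, Matrix.diagonal_apply]
  congr 1
  rw [Finset.sum_eq_single i (fun j _ hj => by simp [hj.symm]) (by simp)]
  simp

/-- `ℂ ^ N` as the complexification of `ℝ ^ N`. -/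
def euclideanComplexification (N : ℕ) :
    Complexification (EuclideanSpace ℝ (Fin N)) (EuclideanSpace ℂ (Fin N)) where
  ofReal :=
    { toFun := fun x => WithLp.toLp 2 fun i => (x i : ℂ)
      map_add' := fun x y => by ext i; simp
      map_smul' := fun a x => by ext i; simp
      norm_map' := fun x => by simp [EuclideanSpace.norm_eq] }
  re := LinearMap.toContinuousLinearMap
    { toFun := fun z => WithLp.toLp 2 fun i => (z i).re
      map_add' := fun x y => by ext i; simp
      map_smul' := fun a x => by ext i; simp }
  im := LinearMap.toContinuousLinearMap
    { toFun := fun z => WithLp.toLp 2 fun i => (z i).im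
      map_add' := fun x y => by ext i; simp
      map_smul' := fun a x => by ext i; simp }
  re_ofReal := fun x => by ext i; simp
  re_I_smul_ofReal := fun x => by ext i; simp
  decomp := fun z => by
    ext i
    simpa [mul_comm] using (Complex.re_add_im (z i)).symm

lemma euclideanComplexification_ofReal_apply (x : EuclideanSpace ℝ (Fin N)) (i : Fin N) :
    (euclideanComplexification N).ofReal x i = (x i : ℂ) := rfl

lemma adjoint_finiteOperator_eq_zero_iff {v : EuclideanSpace ℝ (Fin N)} :
    ContinuousLinearMap.adjoint (finiteOperator ℝ σ) v = 0 ↔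
      ∀ j, ∑ i, σ i j * v i = (∑ i, σ j i) * v j := by
  have h : ∀ x, inner ℝ (ContinuousLinearMap.adjoint (finiteOperator ℝ σ) v) x =
      ∑ j, (∑ i, σ i j * v i - (∑ i, σ j i) * v j) * x j := by
    intro x
    rw [ContinuousLinearMap.adjoint_inner_left, PiLp.inner_apply]
    simp only [finiteOperator_apply, sub_mul, Finset.sum_sub_distrib, RCLike.inner_apply,
      conj_trivial, RCLike.ofReal_real_eq_id, id]
    congr 1
    · simp only [Finset.sum_mul]
      rw [Finset.sum_comm]
      refine Finset.sum_congr rfl fun i _ => Finset.sum_congr rfl fun j _ => by ring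
    · refine Finset.sum_congr rfl fun i _ => by ring
  constructor
  · intro h0 j
    have := h (EuclideanSpace.single j 1)
    rw [h0, inner_zero_left] at this
    simp only [PiLp.single_apply, mul_ite, mul_one, mul_zero, Finset.sum_ite_eq',
      Finset.mem_univ, if_true] at this
    linarith
  · intro h0
    refine ext_inner_right ℝ fun x => ?_
    rw [h, inner_zero_left]
    exact Finset.sum_eq_zero fun j _ => by rw [h0 j, sub_self, zero_mul]

lemma inner_finiteOnes (v : EuclideanSpace ℝ (Fin N)) : inner ℝ v (finiteOnes N) = ∑ i, v i := by
  simp [PiLp.inner_apply, finiteOnes]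

/-- The kernel on `{1, …, N}` with the counting measure. -/
def finiteKernel (σ : Matrix (Fin N) (Fin N) ℝ) : Fin N × Fin N → ℝ := fun p => σ p.1 p.2

lemma isBoundedKernel_finiteKernel (hσ : ∀ i j, 0 ≤ σ i j) :
    IsBoundedKernel (finiteKernel σ) (∑ i, ∑ j, σ i j) Measure.count where
  aestronglyMeasurable := (measurable_of_countable _).aestronglyMeasurable
  nonneg := Eventually.of_forall fun _ => hσ _ _
  le := Eventually.of_forall fun p =>
    (Finset.single_le_sum (f := fun j => σ p.1 j) (fun j _ => hσ _ j) (Finset.mem_univ p.2)).trans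
      (Finset.single_le_sum (f := fun i => ∑ j, σ i j)
        (fun i _ => Finset.sum_nonneg fun j _ => hσ i j) (Finset.mem_univ p.1))

lemma isIrreducibleKernel_finiteKernel (hσ : ∀ i j, 0 ≤ σ i j)
    (hG : (interactionGraph σ).StronglyConnected) :
    IsIrreducibleKernel (finiteKernel σ) Measure.count := by
  intro B hB h
  have hk := isBoundedKernel_finiteKernel hσ
  have hmeas : MeasurableSet (B ×ˢ Bᶜ) := hB.prod hB.compl
  have h1 := (setIntegral_eq_zero_iff_of_nonneg_ae (ae_restrict_of_ae hk.nonneg)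
    hk.integrable.integrableOn).1 h
  have h2 := Measure.ae_ae_of_ae_prod ((ae_restrict_iff' hmeas).1 h1)
  simp only [Measure.ae_count_iff] at h2
  by_contra! hcon
  obtain ⟨i, hi⟩ : B.Nonempty := Set.nonempty_iff_ne_empty.2 fun h0 => hcon.1 (by simp [h0])
  obtain ⟨j, hj⟩ : Bᶜ.Nonempty := Set.nonempty_iff_ne_empty.2 fun h0 => hcon.2 (by simp [h0])
  refine hj (hG.mem_of_forall_adj (fun a b ha hab => ?_) hi j)
  by_contra hb
  exact (show 0 < σ a b from hab).ne' (h2 a b ⟨ha, hb⟩)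

variable (hN : 2 ≤ N) (hσ : ∀ i j, 0 ≤ σ i j) (hG : (interactionGraph σ).StronglyConnected)

include hN in
lemma neZero_count : NeZero (Measure.count : Measure (Fin N)) := by
  have : NeZero N := ⟨by omega⟩
  infer_instance

include hN hσ hG in
/-- A null vector of `A*` with zero sum vanishes. -/
lemma eq_zero_of_left_null {u : Fin N → ℝ} (hu : ∀ j, ∑ i, σ i j * u i = (∑ i, σ j i) * u j)
    (hsum : ∑ i, u i = 0) (i : Fin N) : u i = 0 := by
  have := neZero_count hN
  have h := ae_eq_zero_of_integral_eq_zero (isBoundedKernel_finiteKernel hσ).swap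
    (isIrreducibleKernel_finiteKernel hσ hG).swap (S := fun i => ∑ j, σ i j) (w := fun _ => 1)
    (z := u) (integrable_const _) (by simp) ?_ Integrable.of_finite ?_ ?_
  · exact Measure.ae_count_iff.1 h i
  · simp [Measure.ae_count_iff, finiteKernel, integral_count]
  · simpa [Measure.ae_count_iff, finiteKernel, integral_count] using hu
  · simpa [integral_count] using hsum

include hN hσ hG in
lemma exists_isFiniteWeight : ∃ v, IsFiniteWeight σ v := by
  have := neZero_count hN
  have : NeZero N := ⟨by omega⟩
  obtain ⟨u, hu0, hu⟩ : ∃ u, u ≠ 0 ∧ Matrix.vecMul u (consensusMatrix σ) = 0 := by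
    rw [Matrix.exists_vecMul_eq_zero_iff, ← Matrix.exists_mulVec_eq_zero_iff]
    refine ⟨1, one_ne_zero, ?_⟩
    ext i
    simp [consensusMatrix, Matrix.sub_mulVec, Matrix.mulVec_diagonal]
  have hu' : ∀ j, ∑ i, σ i j * u i = (∑ i, σ j i) * u j := by
    intro j
    have := congrFun hu j
    rw [consensusMatrix_eq, Matrix.vecMul_sub, Pi.sub_apply, Matrix.vecMul_diagonal,
      Pi.zero_apply, Matrix.vecMul, dotProduct, sub_eq_zero] at this
    simp only [mul_comm _ (u _)]
    exact this
  have hs : ∑ i, u i ≠ 0 := fun h0 => hu0 (funext (eq_zero_of_left_null hN hσ hG hu' h0))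
  have hsign := ae_sign_of_integral_kernel_eq (isBoundedKernel_finiteKernel hσ).swap
    (isIrreducibleKernel_finiteKernel hσ hG).swap (S := fun i => ∑ j, σ i j) (w := fun _ => 1)
    (z := u) (integrable_const _) (by simp)
    (by simp [Measure.ae_count_iff, finiteKernel, integral_count]) Integrable.of_finite
    (by simpa [Measure.ae_count_iff, finiteKernel, integral_count] using hu')
  simp only [Measure.ae_count_iff] at hsign
  have hpos : ∀ i, 0 < (∑ i, u i)⁻¹ * u i := by
    intro i
    rcases hsign with h | h | h
    · exact absurd (funext h) hu0
    · exact mul_pos (inv_pos.2 (Finset.sum_pos (fun i _ => h i) ⟨i, Finset.mem_univ i⟩)) (h i)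
    · exact mul_pos_of_neg_of_neg
        (inv_lt_zero.2 (Finset.sum_neg (fun i _ => h i) ⟨i, Finset.mem_univ i⟩)) (h i)
  refine ⟨WithLp.toLp 2 fun i => (∑ i, u i)⁻¹ * u i, ?_, hpos, ?_⟩
  · rw [adjoint_finiteOperator_eq_zero_iff]
    intro j
    simp only [mul_left_comm _ (∑ i, u i)⁻¹, ← Finset.mul_sum, hu' j]
  · rw [inner_finiteOnes, ← Finset.mul_sum, inv_mul_cancel₀ hs]

include hN hσ hG in
lemma isFiniteWeight_unique {v w : EuclideanSpace ℝ (Fin N)} (hv : IsFiniteWeight σ v)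
    (hw : IsFiniteWeight σ w) : w = v := by
  have hv1 := adjoint_finiteOperator_eq_zero_iff.1 hv.mem_ker
  have hw1 := adjoint_finiteOperator_eq_zero_iff.1 hw.mem_ker
  have hv2 := hv.normalized
  have hw2 := hw.normalized
  rw [inner_finiteOnes] at hv2 hw2
  ext i
  rw [← sub_eq_zero]
  refine eq_zero_of_left_null hN hσ hG (u := fun i => w i - v i) (fun j => ?_) ?_ i
  · simp only [mul_sub, Finset.sum_sub_distrib, hv1, hw1]
  · rw [Finset.sum_sub_distrib, hv2, hw2, sub_self]

variable {v : EuclideanSpace ℝ (Fin N)} (hv : IsFiniteWeight σ v)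

include hN hσ hG hv in
lemma isConsensusPair_finiteOperator :
    IsConsensusPair (euclideanComplexification N) (finiteOperator ℝ σ) (finiteOperator ℂ σ)
      (finiteOnes N) v (innerSL ℂ ((euclideanComplexification N).ofReal v)) where
  map_ofReal := fun x => by
    ext i
    rw [euclideanComplexification_ofReal_apply, finiteOperator_apply, finiteOperator_apply]
    simp [euclideanComplexification_ofReal_apply]
  form_ofReal := fun x => by
    simp [PiLp.inner_apply, euclideanComplexification_ofReal_apply]
    exact Finset.sum_congr rfl fun i _ => mul_comm _ _
  apply_eq_zero := by
    ext i
    rw [finiteOperator_apply]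
    simp [finiteOnes]
  inner_apply := fun x => by
    rw [real_inner_comm, ← ContinuousLinearMap.adjoint_inner_left, hv.mem_ker, inner_zero_left]
  inner_eq_one := by rw [real_inner_comm, hv.normalized]
  eq_smul_of_apply_eq_zero := fun x hx => by
    have := neZero_count hN
    obtain ⟨a, ha⟩ := ae_eq_const_of_integral_kernel_eq (isBoundedKernel_finiteKernel hσ)
      (isIrreducibleKernel_finiteKernel hσ hG) (S := fun i => ∑ j, σ i j) (w := fun i => v i)
      (z := fun i => x i) Integrable.of_finite (Measure.ae_count_iff.2 hv.pos)
      (by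
        simpa [Measure.ae_count_iff, finiteKernel, integral_count] using
          adjoint_finiteOperator_eq_zero_iff.1 hv.mem_ker)
      (by simp [Measure.ae_count_iff, finiteKernel, integral_count])
      Integrable.of_finite
      (by
        simp only [Measure.ae_count_iff, finiteKernel, integral_count]
        intro i
        have := congrArg (fun z => z.ofLp i) hx
        simp only [finiteOperator_apply] at this
        simpa [sub_eq_zero] using this)
    rw [Measure.ae_count_iff] at ha
    refine ⟨a, ?_⟩
    ext i
    simp [ha i, finiteOnes]

include hσ hv in
/-- The nonzero eigenvalues of `A` have negative real part. -/
lemma re_neg_of_isEigenvalue_finiteOperator {l : ℂ} (hl : IsEigenvalue (finiteOperator ℂ σ) l)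
    (hl0 : l ≠ 0) : l.re < 0 := by
  obtain ⟨z, hz, hzl⟩ := isEigenvalue_iff.1 hl
  by_contra! hre
  refine hz ?_
  have h := ae_eq_zero_of_re_nonneg (isBoundedKernel_finiteKernel hσ) (S := fun i => ∑ j, σ i j)
    (w := fun i => v i) (z := fun i => z i) Integrable.of_finite (Measure.ae_count_iff.2 hv.pos)
      (by
        simpa [Measure.ae_count_iff, finiteKernel, integral_count] using
          adjoint_finiteOperator_eq_zero_iff.1 hv.mem_ker)
      (Measure.ae_count_iff.2 fun i => Finset.sum_nonneg fun j _ => hσ i j)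
      Integrable.of_finite hre hl0
      (by
        simp only [Measure.ae_count_iff, finiteKernel, integral_count]
        intro i
        have := congrArg (fun z => z.ofLp i) hzl
        simp only [finiteOperator_apply] at this
        simp only [add_mul, Complex.real_smul]
        rw [sub_eq_iff_eq_add'] at this
        simpa using this)
  ext i
  exact Measure.ae_count_iff.1 h i

include hN hσ hG in
lemma exists_consensus_finite :
    ∃ v : EuclideanSpace ℝ (Fin N), IsFiniteWeight σ v ∧ (∀ w, IsFiniteWeight σ w → w = v) ∧
      ∃ ρ : ℝ, 0 < ρ ∧
        (∀ y : ℝ → EuclideanSpace ℝ (Fin N), IsSolution (finiteOperator ℝ σ) y → ∀ t, 0 ≤ t →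
          weightedMean (finiteOnes N) v (y t) = weightedMean (finiteOnes N) v (y 0)) ∧
        ConvergesAtRate (finiteOperator ℝ σ) (finiteOnes N) v ρ ∧
        NoBetterRate (finiteOperator ℝ σ) (finiteOnes N) v ρ ∧
        ρ = -spectralBound (restrictToImage (finiteOperator ℂ σ)) ∧
        ∃ μ₂ : ℂ, IsEigenvalue (finiteOperator ℂ σ) μ₂ ∧ μ₂ ≠ 0 ∧
          (∀ μ : ℂ, IsEigenvalue (finiteOperator ℂ σ) μ → μ ≠ 0 → μ.re ≤ μ₂.re) ∧
          ρ = |μ₂.re| := by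
  obtain ⟨v, hv⟩ := exists_isFiniteWeight hN hσ hG
  have h := isConsensusPair_finiteOperator hN hσ hG hv
  have hF : Function.Injective (finiteOperator ℂ σ +
        (innerSL ℂ ((euclideanComplexification N).ofReal v)).smulRight
          ((euclideanComplexification N).ofReal (finiteOnes N))) →
      Function.Surjective (finiteOperator ℂ σ +
        (innerSL ℂ ((euclideanComplexification N).ofReal v)).smulRight
          ((euclideanComplexification N).ofReal (finiteOnes N))) :=
    fun hi => LinearMap.surjective_of_injective (f := ((finiteOperator ℂ σ +
        (innerSL ℂ ((euclideanComplexification N).ofReal v)).smulRight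
          ((euclideanComplexification N).ofReal (finiteOnes N)) :
          EuclideanSpace ℂ (Fin N) →L[ℂ] EuclideanSpace ℂ (Fin N)) :
          EuclideanSpace ℂ (Fin N) →ₗ[ℂ] EuclideanSpace ℂ (Fin N))) hi
  have := h.completeSpace_range hF
  have hnt : Nontrivial (finiteOperator ℂ σ).range := by
    let i : Fin N := ⟨0, by omega⟩
    let j : Fin N := ⟨1, by omega⟩
    refine ⟨⟨finiteOperator ℂ σ (EuclideanSpace.single i 1), ⟨_, rfl⟩⟩, 0, fun h0 => ?_⟩
    obtain ⟨a, ha⟩ := h.ker _ (congrArg Subtype.val h0)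
    have hij : j ≠ i := by simp [i, j]
    have h1 := congrArg (fun z => z.ofLp i) ha
    have h2 := congrArg (fun z => z.ofLp j) ha
    simp [euclideanComplexification_ofReal_apply, finiteOnes, hij] at h1 h2
    exact one_ne_zero (h1.trans h2.symm)
  obtain ⟨μ₂, hμ₂, hre⟩ :=
    exists_mem_spectrum_re_eq_spectralBound (restrictToImage (finiteOperator ℂ σ))
  have heig : IsEigenvalue (restrictToImage (finiteOperator ℂ σ)) μ₂ := by
    have := (Module.End.hasEigenvalue_iff_mem_spectrum (K := ℂ)
      (f := ((restrictToImage (finiteOperator ℂ σ)) :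
        (finiteOperator ℂ σ).range →ₗ[ℂ] (finiteOperator ℂ σ).range)) (μ := μ₂)).2
    rw [← ContinuousLinearMap.spectrum_eq] at this
    exact this hμ₂
  have hμ0 := h.ne_zero_of_mem_spectrum hF hμ₂
  have heigA := (h.isEigenvalue_restrictToImage hF hμ0).1 heig
  have hneg : spectralBound (restrictToImage (finiteOperator ℂ σ)) < 0 := by
    rw [← hre]
    exact re_neg_of_isEigenvalue_finiteOperator hσ hv heigA hμ0
  refine ⟨v, hv, fun w hw => isFiniteWeight_unique hN hσ hG hv hw,
    -spectralBound (restrictToImage (finiteOperator ℂ σ)), neg_pos.2 hneg,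
    fun y hy t ht => h.weightedMean_eq hy ht, h.convergesAtRate hF, h.noBetterRate hF hneg, rfl,
    μ₂, heigA, hμ0, fun μ hμ hμ1 => ?_, ?_⟩
  · rw [hre]
    exact re_le_spectralBound _ ((h.isEigenvalue_restrictToImage hF hμ1).2 hμ).mem_spectrum
  · rw [hre, abs_of_neg hneg]

end FiniteModel

/-! ### Hilbert–Schmidt integral operators -/

section HilbertSchmidt

variable {α : Type*} [MeasurableSpace α] {μ : Measure α} [IsFiniteMeasure μ] {𝕜 : Type*} [RCLike 𝕜]

lemma eLpNorm_integral_mul_le {τ : α × α → 𝕜} {z : α → 𝕜}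
    (hτ : AEStronglyMeasurable τ (μ.prod μ)) (hz : AEStronglyMeasurable z μ) :
    eLpNorm (fun x => ∫ y, τ (x, y) * z y ∂μ) 2 μ ≤
      eLpNorm τ 2 (μ.prod μ) * eLpNorm z 2 μ := by
  have hpow : AEMeasurable (fun p => ‖τ p‖ₑ ^ (2 : ℝ)) (μ.prod μ) := hτ.enorm.pow_const _
  rw [eLpNorm_eq_lintegral_rpow_enorm_toReal two_ne_zero ENNReal.ofNat_ne_top,
    eLpNorm_eq_lintegral_rpow_enorm_toReal two_ne_zero ENNReal.ofNat_ne_top,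
    eLpNorm_eq_lintegral_rpow_enorm_toReal two_ne_zero ENNReal.ofNat_ne_top, ENNReal.toReal_ofNat,
    ← ENNReal.mul_rpow_of_nonneg _ _ (by norm_num : (0 : ℝ) ≤ 1 / 2), lintegral_prod _ hpow]
  refine ENNReal.rpow_le_rpow ?_ (by norm_num)
  rw [← lintegral_mul_const'' _ hpow.lintegral_prod_right']
  refine lintegral_mono_ae ?_
  filter_upwards [hτ.prodMk_left] with x hx
  calc ‖∫ y, τ (x, y) * z y ∂μ‖ₑ ^ (2 : ℝ)
      ≤ (∫⁻ y, ‖τ (x, y)‖ₑ * ‖z y‖ₑ ∂μ) ^ (2 : ℝ) := by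
        refine ENNReal.rpow_le_rpow ((enorm_integral_le_lintegral_enorm _).trans_eq ?_) (by norm_num)
        simp only [enorm_mul]
    _ ≤ ((∫⁻ y, ‖τ (x, y)‖ₑ ^ (2 : ℝ) ∂μ) ^ (1 / 2 : ℝ) *
          (∫⁻ y, ‖z y‖ₑ ^ (2 : ℝ) ∂μ) ^ (1 / 2 : ℝ)) ^ (2 : ℝ) := by
        refine ENNReal.rpow_le_rpow ?_ (by norm_num)
        exact ENNReal.lintegral_mul_le_Lp_mul_Lq μ Real.HolderConjugate.two_two hx.enorm hz.enorm
    _ = _ := by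
        rw [ENNReal.mul_rpow_of_nonneg _ _ (by norm_num : (0 : ℝ) ≤ 2), ← ENNReal.rpow_mul,
          ← ENNReal.rpow_mul]
        norm_num

lemma memLp_integral_mul {τ : α × α → 𝕜} {z : α → 𝕜} (hτ : MemLp τ 2 (μ.prod μ))
    (hz : MemLp z 2 μ) : MemLp (fun x => ∫ y, τ (x, y) * z y ∂μ) 2 μ :=
  ⟨(hτ.1.mul hz.1.comp_snd).integral_prod_right',
    (eLpNorm_integral_mul_le hτ.1 hz.1).trans_lt (ENNReal.mul_lt_top hτ.2 hz.2)⟩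

lemma ae_integrable_mul {τ : α × α → 𝕜} {z : α → 𝕜} (hτ : MemLp τ 2 (μ.prod μ))
    (hz : MemLp z 2 μ) : ∀ᵐ x ∂μ, Integrable (fun y => τ (x, y) * z y) μ :=
  (MemLp.integrable_mul hτ (hz.comp_snd μ)).prod_right_ae

variable (𝕜 μ) in
/-- The integral operator `(K z)(x) = ∫ τ(x, y) z(y) dy` on `L²(μ; 𝕜)`, as a bilinear function of the
kernel `τ ∈ L²(μ ⊗ μ; 𝕜)` and of `z`. -/
def integralOperator : Lp 𝕜 2 (μ.prod μ) →L[𝕜] Lp 𝕜 2 μ →L[𝕜] Lp 𝕜 2 μ :=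
  LinearMap.mkContinuous₂
    (LinearMap.mk₂ 𝕜
      (fun τ z => (memLp_integral_mul (Lp.memLp τ) (Lp.memLp z)).toLp
        fun x => ∫ y, τ (x, y) * z y ∂μ)
      (fun τ τ' z => by
        rw [← MemLp.toLp_add]
        refine MemLp.toLp_congr _ _ ?_
        filter_upwards [Measure.ae_ae_of_ae_prod (Lp.coeFn_add τ τ'),
          ae_integrable_mul (Lp.memLp τ) (Lp.memLp z),
          ae_integrable_mul (Lp.memLp τ') (Lp.memLp z)] with x h h1 h2
        rw [Pi.add_apply, ← integral_add h1 h2]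
        refine integral_congr_ae ?_
        filter_upwards [h] with y hy
        rw [hy, Pi.add_apply, add_mul])
      (fun a τ z => by
        rw [← MemLp.toLp_const_smul]
        refine MemLp.toLp_congr _ _ ?_
        filter_upwards [Measure.ae_ae_of_ae_prod (Lp.coeFn_smul a τ)] with x h
        rw [Pi.smul_apply, ← integral_smul]
        refine integral_congr_ae ?_
        filter_upwards [h] with y hy
        rw [hy, Pi.smul_apply, smul_mul_assoc])
      (fun τ z z' => by
        rw [← MemLp.toLp_add]
        refine MemLp.toLp_congr _ _ ?_
        filter_upwards [ae_integrable_mul (Lp.memLp τ) (Lp.memLp z),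
          ae_integrable_mul (Lp.memLp τ) (Lp.memLp z')] with x h1 h2
        rw [Pi.add_apply, ← integral_add h1 h2]
        refine integral_congr_ae ?_
        filter_upwards [Lp.coeFn_add z z'] with y hy
        rw [hy, Pi.add_apply, mul_add])
      (fun a τ z => by
        rw [← MemLp.toLp_const_smul]
        refine MemLp.toLp_congr _ _ (Eventually.of_forall fun x => ?_)
        rw [Pi.smul_apply, ← integral_smul]
        refine integral_congr_ae ?_
        filter_upwards [Lp.coeFn_smul a z] with y hy
        rw [hy, Pi.smul_apply, mul_smul_comm]))
    1 fun τ z => by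
      rw [one_mul, LinearMap.mk₂_apply, Lp.norm_toLp, Lp.norm_def, Lp.norm_def, ← ENNReal.toReal_mul]
      exact ENNReal.toReal_mono (ENNReal.mul_ne_top (Lp.memLp τ).2.ne (Lp.memLp z).2.ne)
        (eLpNorm_integral_mul_le (Lp.memLp τ).1 (Lp.memLp z).1)

lemma coeFn_integralOperator (τ : Lp 𝕜 2 (μ.prod μ)) (z : Lp 𝕜 2 μ) :
    integralOperator μ 𝕜 τ z =ᵐ[μ] fun x => ∫ y, τ (x, y) * z y ∂μ :=
  (memLp_integral_mul (Lp.memLp τ) (Lp.memLp z)).coeFn_toLp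

lemma isClosed_isCompactOperator_integralOperator :
    IsClosed {τ : Lp 𝕜 2 (μ.prod μ) | IsCompactOperator (integralOperator μ 𝕜 τ)} :=
  isClosed_setOfPred_isCompactOperator.preimage (integralOperator μ 𝕜).continuous

/-- The integral operator of the indicator of a rectangle has rank one. -/
lemma isCompactOperator_integralOperator_indicator_prod {s t : Set α} (hs : MeasurableSet s)
    (ht : MeasurableSet t) (c : 𝕜) :
    IsCompactOperator (integralOperator μ 𝕜
      (indicatorConstLp 2 (hs.prod ht) (measure_ne_top (μ.prod μ) _) c)) := by
  let g : Lp 𝕜 2 μ := indicatorConstLp 2 hs (measure_ne_top μ s) 1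
  let h : Lp 𝕜 2 μ := indicatorConstLp 2 ht (measure_ne_top μ t) (starRingEnd 𝕜 c)
  let L : Lp 𝕜 2 μ →L[𝕜] Lp 𝕜 2 μ := (innerSL 𝕜 h).smulRight g
  have hL : integralOperator μ 𝕜
      (indicatorConstLp 2 (hs.prod ht) (measure_ne_top (μ.prod μ) _) c) = L := by
    ext1 z
    refine Lp.ext ?_
    filter_upwards [coeFn_integralOperator
      (indicatorConstLp 2 (hs.prod ht) (measure_ne_top (μ.prod μ) _) c) z,
      Lp.coeFn_smul (inner 𝕜 h z) g,
      Measure.ae_ae_of_ae_prod (indicatorConstLp_coeFn (p := 2) (hs := hs.prod ht)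
        (hμs := measure_ne_top (μ.prod μ) _) (c := c)),
      indicatorConstLp_coeFn (p := 2) (hs := hs) (hμs := measure_ne_top μ s) (c := (1 : 𝕜))] with
      x h1 h2 h3 h4
    have e1 : L z = inner 𝕜 h z • g := rfl
    rw [h1, e1, h2, Pi.smul_apply, h4, L2.inner_def, smul_eq_mul, ← integral_mul_const]
    refine integral_congr_ae ?_
    filter_upwards [h3, indicatorConstLp_coeFn (p := 2) (hs := ht) (hμs := measure_ne_top μ t)
      (c := starRingEnd 𝕜 c)] with y h5 h6
    rw [h5, h6, RCLike.inner_apply]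
    by_cases hx : x ∈ s <;> by_cases hy : y ∈ t <;> simp [hx, hy, mul_comm]
  rw [hL]
  have hid : IsCompactOperator (ContinuousLinearMap.toSpanSingleton 𝕜 g) :=
    isCompactOperator_of_locallyCompactSpace_rng _
  exact hid.comp_clm (innerSL 𝕜 h)

lemma isCompactOperator_integralOperator_indicator {s : Set (α × α)} (hs : MeasurableSet s) (c : 𝕜) :
    IsCompactOperator (integralOperator μ 𝕜
      (indicatorConstLp 2 hs (measure_ne_top (μ.prod μ) _) c)) := by
  induction s, hs using MeasurableSpace.induction_on_inter generateFrom_prod.symm isPiSystem_prod with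
  | empty =>
    rw [indicatorConstLp_empty, map_zero]
    exact isCompactOperator_zero
  | basic t ht =>
    obtain ⟨a, ha, b, hb, rfl⟩ := ht
    exact isCompactOperator_integralOperator_indicator_prod ha hb c
  | compl t ht ih =>
    have huniv := isCompactOperator_integralOperator_indicator_prod (μ := μ)
      MeasurableSet.univ MeasurableSet.univ c
    have h := indicatorConstLp_disjoint_union (p := 2) ht ht.compl
      (measure_ne_top (μ.prod μ) _) (measure_ne_top (μ.prod μ) _) disjoint_compl_right c
    have h' : integralOperator μ 𝕜 (indicatorConstLp 2 ht.compl (measure_ne_top (μ.prod μ) _) c) =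
        integralOperator μ 𝕜 (indicatorConstLp 2 (MeasurableSet.univ.prod MeasurableSet.univ)
          (measure_ne_top (μ.prod μ) _) c) -
        integralOperator μ 𝕜 (indicatorConstLp 2 ht (measure_ne_top (μ.prod μ) _) c) := by
      rw [eq_sub_iff_add_eq', ← map_add, ← h]
      congr 2
      simp
    rw [h']
    exact huniv.sub ih
  | iUnion f hd hf ih =>
    have hacc : ∀ n, MeasurableSet (Set.accumulate f n) := fun n =>
      MeasurableSet.biUnion (Set.to_countable _) fun i _ => hf i
    have hfin : ∀ n, IsCompactOperator (integralOperator μ 𝕜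
        (indicatorConstLp 2 (hacc n) (measure_ne_top (μ.prod μ) _) c)) := by
      intro n
      induction n with
      | zero => simpa using ih 0
      | succ n ihn =>
        have hdis : Disjoint (Set.accumulate f n) (f (n + 1)) :=
          Set.disjoint_accumulate hd n.lt_succ_self
        have h := indicatorConstLp_disjoint_union (p := 2) (hacc n) (hf (n + 1))
          (measure_ne_top (μ.prod μ) _) (measure_ne_top (μ.prod μ) _) hdis c
        have h' : indicatorConstLp 2 (hacc (n + 1)) (measure_ne_top (μ.prod μ) _) c =
            indicatorConstLp 2 (hacc n) (measure_ne_top (μ.prod μ) _) c +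
            indicatorConstLp 2 (hf (n + 1)) (measure_ne_top (μ.prod μ) _) c := by
          rw [← h]
          congr 1
          exact Set.accumulate_succ f n
        rw [h', map_add]
        exact ihn.add (ih (n + 1))
    refine isClosed_isCompactOperator_integralOperator.mem_of_tendsto
      (tendsto_indicatorConstLp_set (p := 2) (by norm_num) ?_)
      (Eventually.of_forall (f := atTop) hfin)
    have hsub : ∀ n, Set.accumulate f n ⊆ ⋃ i, f i := fun n => Set.accumulate_subset_iUnion n
    have h1 : ∀ n, (μ.prod μ) (symmDiff (Set.accumulate f n) (⋃ i, f i)) =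
        (μ.prod μ) (⋃ i, f i) - (μ.prod μ) (Set.accumulate f n) := by
      intro n
      rw [symmDiff_of_le (hsub n), measure_sdiff (hsub n) (hacc n).nullMeasurableSet
        (measure_ne_top _ _)]
    simp only [h1]
    have h2 := ENNReal.Tendsto.sub (tendsto_const_nhds (x := (μ.prod μ) (⋃ i, f i)) (f := atTop))
      (tendsto_measure_iUnion_accumulate (μ := μ.prod μ) (f := f))
      (Or.inl (measure_ne_top _ _))
    simpa using h2

/-- Integral operators with square integrable kernels are compact: the kernels with this property form
a closed subspace that contains the indicators of rectangles, hence those of measurable sets. -/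
lemma isCompactOperator_integralOperator (τ : Lp 𝕜 2 (μ.prod μ)) :
    IsCompactOperator (integralOperator μ 𝕜 τ) := by
  refine Lp.induction (by norm_num) (motive := fun τ => IsCompactOperator (integralOperator μ 𝕜 τ))
    (fun c s hs hμs => isCompactOperator_integralOperator_indicator hs c)
    (fun f g hf hg _ h1 h2 => ?_) isClosed_isCompactOperator_integralOperator τ
  rw [map_add]
  exact h1.add h2

end HilbertSchmidt

/-! ### Interaction operators as compact perturbations of multiplication operators -/

section MulOperator

variable {α : Type*} [MeasurableSpace α] {μ : Measure α} {𝕜 : Type*} [RCLike 𝕜] {g : α → 𝕜}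

/-- The operator of multiplication by the bounded function `g` on `L²(μ; 𝕜)`. -/
def mulOperator (hg : MemLp g ⊤ μ) : Lp 𝕜 2 μ →L[𝕜] Lp 𝕜 2 μ :=
  (ContinuousLinearMap.mul 𝕜 𝕜).holderL μ ⊤ 2 2 (hg.toLp g)

lemma coeFn_mulOperator (hg : MemLp g ⊤ μ) (z : Lp 𝕜 2 μ) :
    mulOperator hg z =ᵐ[μ] fun x => g x * z x := by
  filter_upwards [(ContinuousLinearMap.mul 𝕜 𝕜).coeFn_holder (r := 2) (hg.toLp g) z,
    hg.coeFn_toLp] with x h1 h2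
  have : mulOperator hg z x = (ContinuousLinearMap.mul 𝕜 𝕜).holder 2 (hg.toLp g) z x := rfl
  rw [this, h1, h2]
  rfl

/-- A point at a positive distance from the essential range of `-g` is in the resolvent set of
the multiplication by `-g`. -/
lemma mem_resolventSet_neg_mulOperator {g : α → ℂ} (hg : MemLp g ⊤ μ) {l : ℂ} {c : ℝ} (hc : 0 < c)
    (h : ∀ᵐ x ∂μ, c ≤ ‖l + g x‖) : l ∈ resolventSet ℂ (-mulOperator hg) := by
  have hinv : MemLp (fun x => (l + g x)⁻¹) ⊤ μ := by
    refine memLp_top_of_bound ((aestronglyMeasurable_const.add hg.1).aemeasurable.inv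
      |>.aestronglyMeasurable) c⁻¹ ?_
    filter_upwards [h] with x hx
    rw [norm_inv]
    exact inv_anti₀ hc hx
  have hev : ∀ z : Lp ℂ 2 μ, (algebraMap ℂ (Lp ℂ 2 μ →L[ℂ] Lp ℂ 2 μ) l - -mulOperator hg) z =ᵐ[μ]
      fun x => (l + g x) * z x := fun z => by
    have h1 : (algebraMap ℂ (Lp ℂ 2 μ →L[ℂ] Lp ℂ 2 μ) l - -mulOperator hg) z =
        l • z + mulOperator hg z := by
      rw [sub_neg_eq_add]; rfl
    rw [h1]
    filter_upwards [Lp.coeFn_add (l • z) (mulOperator hg z), Lp.coeFn_smul l z,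
      coeFn_mulOperator hg z] with x h2 h3 h4
    rw [h2, Pi.add_apply, h3, h4, Pi.smul_apply, smul_eq_mul, add_mul]
  rw [spectrum.mem_resolventSet_iff]
  refine ⟨⟨_, mulOperator hinv, ?_, ?_⟩, rfl⟩
  · ext1 z
    refine Lp.ext ?_
    change (algebraMap ℂ (Lp ℂ 2 μ →L[ℂ] Lp ℂ 2 μ) l - -mulOperator hg) (mulOperator hinv z) =ᵐ[μ] z
    filter_upwards [hev (mulOperator hinv z), coeFn_mulOperator hinv z, h] with x h1 h2 h3
    have : l + g x ≠ 0 := norm_pos_iff.1 (hc.trans_le h3)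
    rw [h1, h2, mul_inv_cancel_left₀ this]
  · ext1 z
    refine Lp.ext ?_
    change mulOperator hinv ((algebraMap ℂ (Lp ℂ 2 μ →L[ℂ] Lp ℂ 2 μ) l - -mulOperator hg) z) =ᵐ[μ] z
    filter_upwards [coeFn_mulOperator hinv
      ((algebraMap ℂ (Lp ℂ 2 μ →L[ℂ] Lp ℂ 2 μ) l - -mulOperator hg) z), hev z, h] with x h1 h2 h3
    have : l + g x ≠ 0 := norm_pos_iff.1 (hc.trans_le h3)
    rw [h1, h2, inv_mul_cancel_left₀ this]

end MulOperator

section KernelOperator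

variable {α : Type*} [MeasurableSpace α] {μ : Measure α} [IsProbabilityMeasure μ]
  {𝕜 : Type*} [RCLike 𝕜] {σ : α × α → ℝ}

variable (𝕜) in
lemma memLp_two_ofReal (hσ : MemLp σ ⊤ (μ.prod μ)) :
    MemLp (fun p => (σ p : 𝕜)) 2 (μ.prod μ) :=
  (hσ.mono_exponent le_top).ofReal

lemma memLp_swap (hσ : MemLp σ ⊤ (μ.prod μ)) : MemLp (σ ∘ Prod.swap) ⊤ (μ.prod μ) :=
  hσ.comp_measurePreserving Measure.measurePreserving_swap

lemma memLp_rowSum (hσ : MemLp σ ⊤ (μ.prod μ)) : MemLp (fun x => ∫ y, σ (x, y) ∂μ) ⊤ μ := by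
  refine memLp_top_of_bound hσ.1.integral_prod_right' (eLpNorm σ ⊤ (μ.prod μ)).toReal ?_
  filter_upwards [kernel_ae_bound hσ] with x hx
  simpa using norm_integral_le_of_norm_le_const hx

variable (𝕜) in
/-- The integral operator with kernel `σ`. -/
def gainOperator (hσ : MemLp σ ⊤ (μ.prod μ)) : Lp 𝕜 2 μ →L[𝕜] Lp 𝕜 2 μ :=
  integralOperator μ 𝕜 ((memLp_two_ofReal 𝕜 hσ).toLp _)

variable (𝕜) in
/-- The multiplication by `-S`, where `S(x) = ∫ σ(x, y) dy`. -/
def lossOperator (hσ : MemLp σ ⊤ (μ.prod μ)) : Lp 𝕜 2 μ →L[𝕜] Lp 𝕜 2 μ :=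
  -mulOperator ((memLp_rowSum hσ).ofReal (K := 𝕜))

variable (𝕜) in
lemma isCompactOperator_gainOperator (hσ : MemLp σ ⊤ (μ.prod μ)) :
    IsCompactOperator (gainOperator 𝕜 hσ) :=
  isCompactOperator_integralOperator _

lemma coeFn_gainOperator (hσ : MemLp σ ⊤ (μ.prod μ)) (z : Lp 𝕜 2 μ) :
    gainOperator 𝕜 hσ z =ᵐ[μ] fun x => ∫ y, σ (x, y) • z y ∂μ := by
  filter_upwards [coeFn_integralOperator ((memLp_two_ofReal 𝕜 hσ).toLp _) z,
    Measure.ae_ae_of_ae_prod (memLp_two_ofReal 𝕜 hσ).coeFn_toLp] with x h1 h2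
  refine h1.trans (integral_congr_ae ?_)
  filter_upwards [h2] with y hy
  rw [hy, RCLike.real_smul_eq_coe_mul]

lemma coeFn_lossOperator (hσ : MemLp σ ⊤ (μ.prod μ)) (z : Lp 𝕜 2 μ) :
    lossOperator 𝕜 hσ z =ᵐ[μ] fun x => -(((∫ y, σ (x, y) ∂μ : ℝ) : 𝕜) * z x) := by
  filter_upwards [Lp.coeFn_neg (mulOperator ((memLp_rowSum hσ).ofReal (K := 𝕜)) z),
    coeFn_mulOperator ((memLp_rowSum hσ).ofReal (K := 𝕜)) z] with x h1 h2
  have : lossOperator 𝕜 hσ z x = (-mulOperator ((memLp_rowSum hσ).ofReal (K := 𝕜)) z : Lp 𝕜 2 μ) x :=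
    rfl
  rw [this, h1, Pi.neg_apply, h2]

lemma ae_integrable_kernel_smul (hσ : MemLp σ ⊤ (μ.prod μ)) {E : Type*} [NormedAddCommGroup E]
    [NormedSpace ℝ E] {z : α → E} (hz : Integrable z μ) :
    ∀ᵐ x ∂μ, Integrable (fun y => σ (x, y) • z y) μ := by
  filter_upwards [kernel_ae_bound hσ, kernel_section_aestronglyMeasurable hσ] with x hb hm
  exact hz.bdd_smul _ hm hb

lemma kernelOperator_eq_add (hσ : MemLp σ ⊤ (μ.prod μ)) :
    kernelOperator 𝕜 hσ = lossOperator 𝕜 hσ + gainOperator 𝕜 hσ := by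
  ext1 z
  refine Lp.ext ?_
  have hz : Integrable z μ := (Lp.memLp z).integrable (by norm_num)
  filter_upwards [(kernel_memLp hσ z).coeFn_toLp, coeFn_lossOperator hσ z, coeFn_gainOperator hσ z,
    Lp.coeFn_add (lossOperator 𝕜 hσ z) (gainOperator 𝕜 hσ z), ae_integrable_kernel_smul hσ hz,
    ae_integrable_kernel_smul hσ (integrable_const (1 : ℝ))] with x h1 h2 h3 h4 h5 h6
  have e1 : kernelOperator 𝕜 hσ z x =
    (kernel_memLp hσ z).toLp (fun x => ∫ x', σ (x, x') • (z x' - z x) ∂μ) x := rfl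
  have e2 : ((lossOperator 𝕜 hσ + gainOperator 𝕜 hσ) z : Lp 𝕜 2 μ) x =
    (lossOperator 𝕜 hσ z + gainOperator 𝕜 hσ z : Lp 𝕜 2 μ) x := rfl
  rw [e1, h1, e2, h4, Pi.add_apply, h2, h3]
  simp only [smul_eq_mul, mul_one] at h6
  simp only [smul_sub]
  rw [integral_sub h5 (h6.smul_const _), integral_smul_const, RCLike.real_smul_eq_coe_mul]
  ring

lemma coeFn_lossOperator_add_gainOperator (hσ : MemLp σ ⊤ (μ.prod μ)) {τ : α × α → ℝ}
    (hτ : MemLp τ ⊤ (μ.prod μ)) (z : Lp 𝕜 2 μ) :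
    ((lossOperator 𝕜 hσ + gainOperator 𝕜 hτ) z : Lp 𝕜 2 μ) =ᵐ[μ]
      fun x => (∫ y, τ (x, y) • z y ∂μ) - ((∫ y, σ (x, y) ∂μ : ℝ) : 𝕜) * z x := by
  filter_upwards [coeFn_lossOperator hσ z, coeFn_gainOperator hτ z,
    Lp.coeFn_add (lossOperator 𝕜 hσ z) (gainOperator 𝕜 hτ z)] with x h2 h3 h4
  have e2 : ((lossOperator 𝕜 hσ + gainOperator 𝕜 hτ) z : Lp 𝕜 2 μ) x =
    (lossOperator 𝕜 hσ z + gainOperator 𝕜 hτ z : Lp 𝕜 2 μ) x := rfl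
  rw [e2, h4, Pi.add_apply, h2, h3]
  ring

lemma inner_gainOperator_swap (hσ : MemLp σ ⊤ (μ.prod μ)) (z w : Lp 𝕜 2 μ) :
    inner 𝕜 (gainOperator 𝕜 (memLp_swap hσ) z) w = inner 𝕜 z (gainOperator 𝕜 hσ w) := by
  have hz : Integrable z μ := (Lp.memLp z).integrable (by norm_num)
  have hw : Integrable w μ := (Lp.memLp w).integrable (by norm_num)
  have hzc : Integrable (fun x => (starRingEnd 𝕜) (z x)) μ :=
    (RCLike.conjCLE (K := 𝕜)).toContinuousLinearMap.integrable_comp hz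
  have hb : ∀ᵐ p ∂(μ.prod μ), ‖σ p‖ ≤ (eLpNorm σ ⊤ (μ.prod μ)).toReal := by
    filter_upwards [ae_le_eLpNormEssSup (f := σ) (μ := μ.prod μ)] with p hp
    rw [← toReal_enorm]
    exact ENNReal.toReal_mono hσ.2.ne (by rwa [eLpNorm_exponent_top])
  have hint : Integrable (fun p : α × α => σ p • ((starRingEnd 𝕜) (z p.1) * w p.2)) (μ.prod μ) :=
    (hzc.mul_prod hw).bdd_smul _ hσ.1 hb
  rw [L2.inner_def, L2.inner_def]
  have h1 : ∫ x, inner 𝕜 (gainOperator 𝕜 (memLp_swap hσ) z x) (w x) ∂μ =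
      ∫ x, ∫ y, σ (y, x) • ((starRingEnd 𝕜) (z y) * w x) ∂μ ∂μ := by
    refine integral_congr_ae ?_
    filter_upwards [coeFn_gainOperator (memLp_swap hσ) z] with x hx
    rw [hx, RCLike.inner_apply, ← integral_conj, mul_comm, ← integral_mul_const]
    refine integral_congr_ae (Eventually.of_forall fun y => ?_)
    simp [RCLike.real_smul_eq_coe_mul, mul_assoc]
  have h2 : ∫ y, inner 𝕜 (z y) (gainOperator 𝕜 hσ w y) ∂μ =
      ∫ y, ∫ x, σ (y, x) • ((starRingEnd 𝕜) (z y) * w x) ∂μ ∂μ := by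
    refine integral_congr_ae ?_
    filter_upwards [coeFn_gainOperator hσ w] with y hy
    rw [hy, RCLike.inner_apply, mul_comm, ← integral_const_mul]
    refine integral_congr_ae (Eventually.of_forall fun x => ?_)
    simp only [mul_smul_comm]
  rw [h1, h2]
  exact (integral_integral_swap hint).symm

lemma inner_lossOperator (hσ : MemLp σ ⊤ (μ.prod μ)) (z w : Lp 𝕜 2 μ) :
    inner 𝕜 (lossOperator 𝕜 hσ z) w = inner 𝕜 z (lossOperator 𝕜 hσ w) := by
  rw [L2.inner_def, L2.inner_def]
  refine integral_congr_ae ?_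
  filter_upwards [coeFn_lossOperator hσ z, coeFn_lossOperator hσ w] with x h1 h2
  rw [h1, h2, RCLike.inner_apply, RCLike.inner_apply]
  simp only [map_neg, map_mul, RCLike.conj_ofReal]
  ring

lemma adjoint_kernelOperator (hσ : MemLp σ ⊤ (μ.prod μ)) :
    ContinuousLinearMap.adjoint (kernelOperator 𝕜 hσ) =
      lossOperator 𝕜 hσ + gainOperator 𝕜 (memLp_swap hσ) := by
  refine ((ContinuousLinearMap.eq_adjoint_iff _ _).2 fun z w => ?_).symm
  rw [kernelOperator_eq_add, add_apply, add_apply, inner_add_left, inner_add_right,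
    inner_gainOperator_swap, inner_lossOperator]

end KernelOperator

/-! ### The complexification of a real `L²` space -/

section LpComplexification

variable {α : Type*} [MeasurableSpace α] (μ : Measure α)

/-- Composition with a real linear form `L` on `ℂ`, as a map `L²(μ; ℂ) → L²(μ; ℝ)` that is linear for
the real structure underlying the complex one. -/
def lpRealForm (L : ℂ →L[ℝ] ℝ) : Lp ℂ 2 μ →L[ℝ] Lp ℝ 2 μ :=
  LinearMap.mkContinuous
    { toFun := fun f => L.compLp f
      map_add' := fun f g => by
        refine Lp.ext ?_
        filter_upwards [L.coeFn_compLp (f + g), L.coeFn_compLp f, L.coeFn_compLp g,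
          Lp.coeFn_add f g, Lp.coeFn_add (L.compLp f) (L.compLp g)] with x h1 h2 h3 h4 h5
        rw [h1, h5, Pi.add_apply, h2, h3, h4, Pi.add_apply, map_add]
      map_smul' := fun a f => by
        refine Lp.ext ?_
        change L.compLp ((a : ℂ) • f) =ᵐ[μ] (a • L.compLp f : Lp ℝ 2 μ)
        filter_upwards [L.coeFn_compLp ((a : ℂ) • f), L.coeFn_compLp f,
          Lp.coeFn_smul (a : ℂ) f, Lp.coeFn_smul a (L.compLp f)] with x h1 h2 h3 h4
        rw [h1, h4, Pi.smul_apply, h2, h3, Pi.smul_apply, Complex.coe_smul, map_smul] }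
    ‖L‖ fun f => by
      refine Lp.norm_le_mul_norm_of_ae_le_mul ?_
      filter_upwards [L.coeFn_compLp f] with x h1
      change ‖L.compLp f x‖ ≤ _
      rw [h1]
      exact L.le_opNorm _

lemma coeFn_lpRealForm (L : ℂ →L[ℝ] ℝ) (f : Lp ℂ 2 μ) :
    lpRealForm μ L f =ᵐ[μ] fun x => L (f x) :=
  L.coeFn_compLp f

/-- The inclusion of `L²(μ; ℝ)` in `L²(μ; ℂ)`. -/
def lpOfReal : Lp ℝ 2 μ →ₗᵢ[ℝ] Lp ℂ 2 μ where
  toFun := fun f => Complex.ofRealCLM.compLp f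
  map_add' := fun f g => by
    refine Lp.ext ?_
    filter_upwards [Complex.ofRealCLM.coeFn_compLp (f + g), Complex.ofRealCLM.coeFn_compLp f,
      Complex.ofRealCLM.coeFn_compLp g, Lp.coeFn_add f g,
      Lp.coeFn_add (Complex.ofRealCLM.compLp f) (Complex.ofRealCLM.compLp g)] with
      x h1 h2 h3 h4 h5
    rw [h1, h5, Pi.add_apply, h2, h3, h4, Pi.add_apply, map_add]
  map_smul' := fun a f => by
    refine Lp.ext ?_
    change Complex.ofRealCLM.compLp (a • f) =ᵐ[μ] ((a : ℂ) • Complex.ofRealCLM.compLp f : Lp ℂ 2 μ)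
    filter_upwards [Complex.ofRealCLM.coeFn_compLp (a • f), Complex.ofRealCLM.coeFn_compLp f,
      Lp.coeFn_smul a f, Lp.coeFn_smul (a : ℂ) (Complex.ofRealCLM.compLp f)] with x h1 h2 h3 h4
    rw [h1, h3, h4, Pi.smul_apply, Pi.smul_apply, h2, map_smul, Complex.coe_smul]
  norm_map' := fun f => by
    change ‖Complex.ofRealCLM.compLp f‖ = ‖f‖
    rw [Lp.norm_def, Lp.norm_def]
    congr 1
    refine eLpNorm_congr_norm_ae ?_
    filter_upwards [Complex.ofRealCLM.coeFn_compLp f] with x h1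
    rw [h1]
    simp

lemma coeFn_lpOfReal (f : Lp ℝ 2 μ) : lpOfReal μ f =ᵐ[μ] fun x => ((f x : ℝ) : ℂ) :=
  Complex.ofRealCLM.coeFn_compLp f

/-- `L²(μ; ℂ)` as the complexification of `L²(μ; ℝ)`. -/
def lpComplexification : Complexification (Lp ℝ 2 μ) (Lp ℂ 2 μ) where
  ofReal := lpOfReal μ
  re := lpRealForm μ Complex.reCLM
  im := lpRealForm μ Complex.imCLM
  re_ofReal := fun f => by
    refine Lp.ext ?_
    filter_upwards [coeFn_lpRealForm μ Complex.reCLM (lpOfReal μ f), coeFn_lpOfReal μ f] with x h1 h2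
    exact h1.trans (by rw [h2]; simp)
  re_I_smul_ofReal := fun f => by
    refine Lp.ext ?_
    filter_upwards [coeFn_lpRealForm μ Complex.reCLM (Complex.I • lpOfReal μ f),
      Lp.coeFn_smul Complex.I (lpOfReal μ f), coeFn_lpOfReal μ f, Lp.coeFn_zero ℝ 2 μ] with
      x h1 h2 h3 h4
    exact h1.trans (by rw [h2, h4, Pi.smul_apply, h3]; simp)
  decomp := fun f => by
    refine Lp.ext ?_
    filter_upwards [Lp.coeFn_add (lpOfReal μ (lpRealForm μ Complex.reCLM f))
      (Complex.I • lpOfReal μ (lpRealForm μ Complex.imCLM f)),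
      Lp.coeFn_smul Complex.I (lpOfReal μ (lpRealForm μ Complex.imCLM f)),
      coeFn_lpOfReal μ (lpRealForm μ Complex.reCLM f),
      coeFn_lpOfReal μ (lpRealForm μ Complex.imCLM f),
      coeFn_lpRealForm μ Complex.reCLM f, coeFn_lpRealForm μ Complex.imCLM f] with x h1 h2 h3 h4 h5 h6
    refine Eq.trans ?_ h1.symm
    rw [Pi.add_apply, h2, Pi.smul_apply, h3, h4, h5, h6]
    simpa [mul_comm] using (Complex.re_add_im (f x)).symm

end LpComplexification

/-! ### Null vectors of interaction operators -/

section KernelNull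

variable {α : Type*} [MeasurableSpace α] {μ : Measure α} [IsProbabilityMeasure μ]
  {𝕜 : Type*} [RCLike 𝕜] {σ τ : α × α → ℝ}

omit [IsProbabilityMeasure μ] in
lemma isBoundedKernel_of_memLp (hσ : MemLp σ ⊤ (μ.prod μ)) (hσ0 : ∀ᵐ p ∂(μ.prod μ), 0 ≤ σ p) :
    IsBoundedKernel σ (eLpNorm σ ⊤ (μ.prod μ)).toReal μ where
  aestronglyMeasurable := hσ.1
  nonneg := hσ0
  le := by
    filter_upwards [ae_le_eLpNormEssSup (f := σ) (μ := μ.prod μ)] with p hp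
    refine (Real.le_norm_self _).trans ?_
    rw [← toReal_enorm]
    exact ENNReal.toReal_mono hσ.2.ne (by rwa [eLpNorm_exponent_top])

lemma lossOperator_add_gainOperator_eq_smul_iff (hσ : MemLp σ ⊤ (μ.prod μ))
    (hτ : MemLp τ ⊤ (μ.prod μ)) {z : Lp 𝕜 2 μ} {l : 𝕜} :
    (lossOperator 𝕜 hσ + gainOperator 𝕜 hτ) z = l • z ↔
      ∀ᵐ x ∂μ, ∫ y, τ (x, y) • z y ∂μ = (((∫ y, σ (x, y) ∂μ : ℝ) : 𝕜) + l) * z x := by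
  rw [Lp.ext_iff]
  constructor
  · intro h
    filter_upwards [h, coeFn_lossOperator_add_gainOperator hσ hτ z, Lp.coeFn_smul l z] with
      x h1 h2 h3
    rw [h2, h3, Pi.smul_apply, smul_eq_mul, sub_eq_iff_eq_add] at h1
    rw [h1]
    ring
  · intro h
    filter_upwards [h, coeFn_lossOperator_add_gainOperator hσ hτ z, Lp.coeFn_smul l z] with
      x h1 h2 h3
    rw [h2, h3, Pi.smul_apply, smul_eq_mul, h1]
    ring

lemma lossOperator_add_gainOperator_eq_zero_iff (hσ : MemLp σ ⊤ (μ.prod μ))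
    (hτ : MemLp τ ⊤ (μ.prod μ)) {z : Lp ℝ 2 μ} :
    (lossOperator ℝ hσ + gainOperator ℝ hτ) z = 0 ↔
      ∀ᵐ x ∂μ, ∫ y, τ (x, y) * z y ∂μ = (∫ y, σ (x, y) ∂μ) * z x := by
  have h := lossOperator_add_gainOperator_eq_smul_iff (𝕜 := ℝ) hσ hτ (z := z) (l := 0)
  simpa using h

lemma lossOperator_add_gainOperator_ofReal (hσ : MemLp σ ⊤ (μ.prod μ))
    (hτ : MemLp τ ⊤ (μ.prod μ)) (z : Lp ℝ 2 μ) :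
    (lossOperator ℂ hσ + gainOperator ℂ hτ) (lpOfReal μ z) =
      lpOfReal μ ((lossOperator ℝ hσ + gainOperator ℝ hτ) z) := by
  refine Lp.ext ?_
  filter_upwards [coeFn_lossOperator_add_gainOperator hσ hτ (lpOfReal μ z),
    coeFn_lossOperator_add_gainOperator hσ hτ z, coeFn_lpOfReal μ z,
    coeFn_lpOfReal μ ((lossOperator ℝ hσ + gainOperator ℝ hτ) z)] with x h1 h2 h3 h4
  rw [h1, h4, h2, h3]
  have h5 : ∫ y, τ (x, y) • lpOfReal μ z y ∂μ = ((∫ y, τ (x, y) • z y ∂μ : ℝ) : ℂ) := by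
    rw [← integral_complex_ofReal]
    refine integral_congr_ae ?_
    filter_upwards [coeFn_lpOfReal μ z] with y hy
    rw [hy]
    simp
  rw [h5]
  simp

lemma kernelOperator_const (hσ : MemLp σ ⊤ (μ.prod μ)) (c : 𝕜) :
    kernelOperator 𝕜 hσ (Lp.const 2 μ c) = 0 := by
  refine Lp.ext ?_
  filter_upwards [(kernel_memLp hσ (Lp.const 2 μ c)).coeFn_toLp, Lp.coeFn_const (p := 2) (μ := μ) c,
    Lp.coeFn_zero 𝕜 2 μ] with x h1 h2 h3
  rw [h3]
  refine h1.trans (integral_eq_zero_of_ae ?_)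
  filter_upwards [Lp.coeFn_const (p := 2) (μ := μ) c] with y hy
  rw [h2, hy]
  simp

lemma mem_resolventSet_lossOperator (hσ : MemLp σ ⊤ (μ.prod μ)) {δ : ℝ}
    (hδ : ∀ᵐ x ∂μ, δ ≤ ∫ y, σ (x, y) ∂μ) {l : ℂ} (hl : -δ < l.re) :
    l ∈ resolventSet ℂ (lossOperator ℂ hσ) := by
  refine mem_resolventSet_neg_mulOperator _ (c := l.re + δ) (by linarith) ?_
  filter_upwards [hδ] with x hx
  refine le_trans ?_ (Complex.re_le_norm _)
  rw [Complex.add_re]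
  simpa using hx

lemma integrable_coeFn (z : Lp 𝕜 2 μ) : Integrable z μ := (Lp.memLp z).integrable (by norm_num)

lemma inner_const (v : Lp ℝ 2 μ) : inner ℝ v (Lp.const 2 μ (1 : ℝ)) = ∫ x, v x ∂μ := by
  rw [L2.inner_def]
  refine integral_congr_ae ?_
  filter_upwards [Lp.coeFn_const (p := 2) (μ := μ) (1 : ℝ)] with x hx
  rw [hx]
  simp

variable (hσ : MemLp σ ⊤ (μ.prod μ)) (hσ0 : ∀ᵐ p ∂(μ.prod μ), 0 ≤ σ p)
  (hirr : IsIrreducibleKernel σ μ) {δ : ℝ} (hδ0 : 0 < δ)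
  (hδ : ∀ᵐ x ∂μ, δ ≤ ∫ y, σ (x, y) ∂μ)

lemma adjoint_kernelOperator_eq_zero_iff {v : Lp ℝ 2 μ} :
    ContinuousLinearMap.adjoint (kernelOperator ℝ hσ) v = 0 ↔
      ∀ᵐ y ∂μ, ∫ x, σ (x, y) * v x ∂μ = (∫ x, σ (y, x) ∂μ) * v y := by
  rw [adjoint_kernelOperator, lossOperator_add_gainOperator_eq_zero_iff]
  rfl

include hσ0 hirr in
/-- A null vector of the adjoint has a constant sign. -/
lemma ae_sign_of_adjoint_kernelOperator_eq_zero {v : Lp ℝ 2 μ}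
    (hv : ContinuousLinearMap.adjoint (kernelOperator ℝ hσ) v = 0) :
    (∀ᵐ x ∂μ, v x = 0) ∨ (∀ᵐ x ∂μ, 0 < v x) ∨ ∀ᵐ x ∂μ, v x < 0 :=
  -- For the transposed kernel the constant function `1` is a positive left null vector.
  ae_sign_of_integral_kernel_eq (k := σ ∘ Prod.swap) (w := fun _ => 1)
    (isBoundedKernel_of_memLp hσ hσ0).swap hirr.swap (integrable_const 1)
    (Eventually.of_forall fun _ => one_pos) (Eventually.of_forall fun y => by simp)
    (integrable_coeFn v) ((adjoint_kernelOperator_eq_zero_iff hσ).1 hv)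

include hδ0 hδ in
/-- The adjoint of the interaction operator has a nonzero null vector: otherwise it is surjective by
the Fredholm alternative, whereas its range is orthogonal to the constants. -/
lemma exists_adjoint_kernelOperator_eq_zero :
    ∃ v : Lp ℝ 2 μ, v ≠ 0 ∧ ContinuousLinearMap.adjoint (kernelOperator ℝ hσ) v = 0 := by
  have hcomplex : ∃ z : Lp ℂ 2 μ, z ≠ 0 ∧
      (lossOperator ℂ hσ + gainOperator ℂ (memLp_swap hσ)) z = 0 := by
    by_contra! hcon
    have hinj : Function.Injective (lossOperator ℂ hσ + gainOperator ℂ (memLp_swap hσ)) :=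
      (injective_iff_map_eq_zero _).2 fun z hz => by_contra fun h0 => hcon z h0 hz
    obtain ⟨g, hg⟩ := surjective_add_of_injective (isCompactOperator_gainOperator ℂ (memLp_swap hσ))
      (mem_resolventSet_lossOperator hσ hδ (by simpa using hδ0)) hinj (Lp.const 2 μ (1 : ℂ))
    have h1 : inner ℂ (Lp.const 2 μ (1 : ℂ)) (Lp.const 2 μ (1 : ℂ)) = 0 := by
      conv_lhs => arg 2; rw [← hg]
      rw [← adjoint_kernelOperator, ContinuousLinearMap.adjoint_inner_left, kernelOperator_const,
        inner_zero_right]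
    rw [inner_self_eq_zero, Lp.ext_iff] at h1
    obtain ⟨x, hx1, hx2, hx3⟩ := (h1.and ((Lp.coeFn_const (p := 2) (μ := μ) (1 : ℂ)).and
      (Lp.coeFn_zero ℂ 2 μ))).exists
    rw [hx2, hx3] at hx1
    simp at hx1
  obtain ⟨z, hz, hz0⟩ := hcomplex
  obtain ⟨h1, h2⟩ := (lpComplexification μ).apply_re_im_eq_zero
    (lossOperator_add_gainOperator_ofReal hσ (memLp_swap hσ)) hz0
  rw [← adjoint_kernelOperator] at h1 h2
  by_cases hre : (lpComplexification μ).re z = 0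
  · refine ⟨_, fun him => hz ?_, h2⟩
    rw [(lpComplexification μ).decomp z, hre, him, map_zero, smul_zero, add_zero]
  · exact ⟨_, hre, h1⟩

include hσ0 hirr hδ0 hδ in
lemma exists_adjoint_kernelOperator_eq_zero_pos :
    ∃ v : Lp ℝ 2 μ, ContinuousLinearMap.adjoint (kernelOperator ℝ hσ) v = 0 ∧
      (∀ᵐ x ∂μ, 0 < v x) ∧ inner ℝ v (Lp.const 2 μ (1 : ℝ)) = 1 := by
  obtain ⟨u, hu0, hu⟩ := exists_adjoint_kernelOperator_eq_zero hσ hδ0 hδ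
  have hpos : ∃ u : Lp ℝ 2 μ, ContinuousLinearMap.adjoint (kernelOperator ℝ hσ) u = 0 ∧
      ∀ᵐ x ∂μ, 0 < u x := by
    rcases ae_sign_of_adjoint_kernelOperator_eq_zero hσ hσ0 hirr hu with h | h | h
    · refine absurd (Lp.ext ?_) hu0
      filter_upwards [h, Lp.coeFn_zero ℝ 2 μ] with x h1 h2
      rw [h1, h2]
      rfl
    · exact ⟨u, hu, h⟩
    · refine ⟨-u, by rw [map_neg, hu, neg_zero], ?_⟩
      filter_upwards [h, Lp.coeFn_neg u] with x h1 h2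
      rw [h2, Pi.neg_apply]
      linarith
  obtain ⟨u, hu, hpos⟩ := hpos
  have hm := integral_pos_of_ae_pos (integrable_coeFn u) hpos
  refine ⟨(∫ x, u x ∂μ)⁻¹ • u, by rw [map_smul, hu, smul_zero], ?_, ?_⟩
  · filter_upwards [hpos, Lp.coeFn_smul (∫ x, u x ∂μ)⁻¹ u] with x h1 h2
    rw [h2]
    exact mul_pos (inv_pos.2 hm) h1
  · rw [real_inner_smul_left, inner_const, inv_mul_cancel₀ hm.ne']

include hσ0 hirr in
lemma adjoint_kernelOperator_unique {v w : Lp ℝ 2 μ}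
    (hv : ContinuousLinearMap.adjoint (kernelOperator ℝ hσ) v = 0)
    (hv1 : inner ℝ v (Lp.const 2 μ (1 : ℝ)) = 1)
    (hw : ContinuousLinearMap.adjoint (kernelOperator ℝ hσ) w = 0)
    (hw1 : inner ℝ w (Lp.const 2 μ (1 : ℝ)) = 1) : w = v := by
  have h0 : ContinuousLinearMap.adjoint (kernelOperator ℝ hσ) (w - v) = 0 := by
    rw [map_sub, hv, hw, sub_zero]
  have h1 : ∫ x, (w - v : Lp ℝ 2 μ) x ∂μ = 0 := by
    rw [← inner_const, inner_sub_left, hv1, hw1, sub_self]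
  rw [← sub_eq_zero]
  refine Lp.ext ?_
  filter_upwards [ae_eq_zero_of_integral_eq_zero (k := σ ∘ Prod.swap) (w := fun _ => 1)
    (isBoundedKernel_of_memLp hσ hσ0).swap hirr.swap (integrable_const 1)
    (Eventually.of_forall fun _ => one_pos) (Eventually.of_forall fun y => by simp)
    (integrable_coeFn _) ((adjoint_kernelOperator_eq_zero_iff hσ).1 h0) h1,
    Lp.coeFn_zero ℝ 2 μ] with x h2 h3
  rw [h2, h3]
  rfl

variable {v : Lp ℝ 2 μ} (hv : ContinuousLinearMap.adjoint (kernelOperator ℝ hσ) v = 0)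
  (hv0 : ∀ᵐ x ∂μ, 0 < v x) (hv1 : inner ℝ v (Lp.const 2 μ (1 : ℝ)) = 1)

include hσ0 hirr hv hv0 hv1 in
lemma isConsensusPair_kernelOperator :
    IsConsensusPair (lpComplexification μ) (kernelOperator ℝ hσ) (kernelOperator ℂ hσ)
      (Lp.const 2 μ (1 : ℝ)) v (innerSL ℂ ((lpComplexification μ).ofReal v)) where
  map_ofReal := fun x => by
    rw [kernelOperator_eq_add, kernelOperator_eq_add]
    exact lossOperator_add_gainOperator_ofReal hσ hσ x
  form_ofReal := fun x => by
    rw [innerSL_apply_apply, L2.inner_def, L2.inner_def, ← integral_complex_ofReal]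
    refine integral_congr_ae ?_
    filter_upwards [coeFn_lpOfReal μ x, coeFn_lpOfReal μ v] with y h1 h2
    have h1' : (lpComplexification μ).ofReal x y = ((x y : ℝ) : ℂ) := h1
    have h2' : (lpComplexification μ).ofReal v y = ((v y : ℝ) : ℂ) := h2
    rw [h1', h2']
    simp [mul_comm]
  apply_eq_zero := kernelOperator_const hσ 1
  inner_apply := fun x => by
    rw [real_inner_comm, ← ContinuousLinearMap.adjoint_inner_left, hv, inner_zero_left]
  inner_eq_one := by rw [real_inner_comm, hv1]
  eq_smul_of_apply_eq_zero := fun x hx => by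
    rw [kernelOperator_eq_add, lossOperator_add_gainOperator_eq_zero_iff] at hx
    obtain ⟨c, hc⟩ := ae_eq_const_of_integral_kernel_eq (isBoundedKernel_of_memLp hσ hσ0) hirr
      (integrable_coeFn v) hv0 ((adjoint_kernelOperator_eq_zero_iff hσ).1 hv)
      (Eventually.of_forall fun x => rfl) (integrable_coeFn x) hx
    refine ⟨c, Lp.ext ?_⟩
    filter_upwards [hc, Lp.coeFn_smul c (Lp.const 2 μ (1 : ℝ)),
      Lp.coeFn_const (p := 2) (μ := μ) (1 : ℝ)] with y h1 h2 h3
    rw [h1, h2, Pi.smul_apply, h3]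
    simp

include hδ0 hδ in
/-- The Fredholm alternative for rank one perturbations of the interaction operator. -/
lemma surjective_kernelOperator_add_smulRight (φ : Lp ℂ 2 μ →L[ℂ] ℂ) (e : Lp ℂ 2 μ)
    (hinj : Function.Injective (kernelOperator ℂ hσ + φ.smulRight e)) :
    Function.Surjective (kernelOperator ℂ hσ + φ.smulRight e) := by
  rw [kernelOperator_eq_add, add_assoc] at hinj ⊢
  have hid : IsCompactOperator (ContinuousLinearMap.toSpanSingleton ℂ e) :=
    isCompactOperator_of_locallyCompactSpace_rng _
  exact surjective_add_of_injective ((isCompactOperator_gainOperator ℂ hσ).add (hid.comp_clm φ))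
    (mem_resolventSet_lossOperator hσ hδ (by simpa using hδ0)) hinj

include hσ0 hδ0 hδ hv hv0 in
lemma re_neg_of_isEigenvalue_kernelOperator {l : ℂ} (hl : IsEigenvalue (kernelOperator ℂ hσ) l)
    (hl0 : l ≠ 0) : l.re < 0 := by
  by_contra! hre
  obtain ⟨z, hz, hzl⟩ := isEigenvalue_iff.1 hl
  rw [kernelOperator_eq_add, lossOperator_add_gainOperator_eq_smul_iff] at hzl
  refine hz (Lp.ext ?_)
  filter_upwards [ae_eq_zero_of_re_nonneg (isBoundedKernel_of_memLp hσ hσ0) (integrable_coeFn v) hv0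
    ((adjoint_kernelOperator_eq_zero_iff hσ).1 hv) (hδ.mono fun x hx => hδ0.le.trans hx)
    (integrable_coeFn z) hre hl0 hzl, Lp.coeFn_zero ℂ 2 μ] with x h1 h2
  rw [h1, h2]
  rfl

end KernelNull

/-! ### Strong connectivity and irreducibility -/

namespace ContinuumModel

variable {d : ℕ} (P : ContinuumModel d)

lemma ball_ae_eq_closedBall (x : EuclideanSpace ℝ (Fin d)) {r : ℝ} (hr : 0 < r) :
    Metric.ball x r =ᵐ[P.measure] Metric.closedBall x r := by
  refine ae_restrict_of_ae ?_
  have h : volume (Metric.closedBall x r \ Metric.ball x r) = 0 := by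
    rw [Metric.closedBall_sdiff_ball]
    exact Measure.addHaar_sphere_of_ne_zero volume x hr.ne'
  exact (Metric.ball_subset_closedBall.eventuallyLE).antisymm (ae_le_set.2 h)

/-- Lebesgue differentiation along balls, for `Ω`-averages. -/
lemma ae_tendsto_lintegral_ball_div {g : EuclideanSpace ℝ (Fin d) → ENNReal}
    (hg : AEMeasurable g P.measure) (hg' : ∫⁻ x, g x ∂P.measure ≠ ⊤) :
    ∀ᵐ x ∂P.measure, Tendsto (fun r : ℝ => (∫⁻ y in Metric.ball x r, g y ∂P.measure) /
      P.measure (Metric.ball x r)) (𝓝[>] 0) (𝓝 (g x)) := by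
  filter_upwards [(Besicovitch.vitaliFamily P.measure).ae_tendsto_lintegral_div hg hg'] with x hx
  refine (hx.comp (Besicovitch.tendsto_filterAt P.measure x)).congr' ?_
  filter_upwards [self_mem_nhdsWithin] with r hr
  simp only [Function.comp_apply]
  rw [measure_congr (P.ball_ae_eq_closedBall x hr),
    setLIntegral_congr (P.ball_ae_eq_closedBall x hr)]

lemma ae_tendsto_measure_inter_ball_div {B : Set (EuclideanSpace ℝ (Fin d))}
    (hB : MeasurableSet B) :
    ∀ᵐ x ∂P.measure, Tendsto (fun r : ℝ => P.measure (B ∩ Metric.ball x r) /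
      P.measure (Metric.ball x r)) (𝓝[>] 0) (𝓝 (B.indicator 1 x)) := by
  have hfin : ∫⁻ x, B.indicator 1 x ∂P.measure ≠ ⊤ := by
    rw [lintegral_indicator_one hB]
    exact measure_ne_top _ _
  filter_upwards [P.ae_tendsto_lintegral_ball_div
    (measurable_one.indicator hB).aemeasurable hfin] with x hx
  refine hx.congr fun r => ?_
  rw [lintegral_indicator_one hB, Measure.restrict_apply hB]

lemma aemeasurable_enorm_sub {f : EuclideanSpace ℝ (Fin d) → ℝ}
    (hf : AEStronglyMeasurable f P.measure) :
    AEMeasurable (fun p : EuclideanSpace ℝ (Fin d) × EuclideanSpace ℝ (Fin d) =>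
      ‖P.σ p - f p.2‖ₑ) (P.measure.prod P.measure) :=
  (P.memLp.1.sub hf.comp_snd).enorm

lemma aemeasurable_lintegral_enorm_sub {f : EuclideanSpace ℝ (Fin d) → ℝ}
    (hf : AEStronglyMeasurable f P.measure) :
    AEMeasurable (fun x => ∫⁻ z, ‖P.σ (x, z) - f z‖ₑ ∂P.measure) P.measure :=
  (P.aemeasurable_enorm_sub hf).lintegral_prod_right'

/-- Almost every point is a Lebesgue point of `x ↦ σ(x, ·)`. Lebesgue differentiation applies to the
distances from `σ(x, ·)` to the elements of a countable dense subset of `L¹`. -/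
lemma ae_isSectionAt : ∀ᵐ x ∂P.measure, P.IsSectionAt x fun z => P.σ (x, z) := by
  have hone : Fact ((1 : ENNReal) ≠ ⊤) := ⟨ENNReal.one_ne_top⟩
  have hσi : Integrable P.σ (P.measure.prod P.measure) := P.memLp.integrable le_top
  let g : ℕ → Lp ℝ 1 P.measure := TopologicalSpace.denseSeq (Lp ℝ 1 P.measure)
  have hgi : ∀ n, Integrable (g n) P.measure := fun n => L1.integrable_coeFn (g n)
  have hlim : ∀ᵐ x ∂P.measure, ∀ n, Tendsto (fun r : ℝ =>
      (∫⁻ x' in Metric.ball x r, (∫⁻ z, ‖P.σ (x', z) - g n z‖ₑ ∂P.measure) ∂P.measure) /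
        P.measure (Metric.ball x r)) (𝓝[>] 0)
      (𝓝 (∫⁻ z, ‖P.σ (x, z) - g n z‖ₑ ∂P.measure)) := by
    refine ae_all_iff.2 fun n => P.ae_tendsto_lintegral_ball_div
      (P.aemeasurable_lintegral_enorm_sub (hgi n).1) ?_
    rw [← lintegral_prod _ (P.aemeasurable_enorm_sub (hgi n).1)]
    exact (hσi.sub ((hgi n).comp_snd P.measure)).2.ne
  filter_upwards [hlim, hσi.prod_right_ae] with x hx hxi
  refine ⟨hxi, ENNReal.tendsto_nhds_zero.2 fun ε hε => ?_⟩
  rcases eq_or_ne ε ⊤ with rfl | hε'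
  · exact Eventually.of_forall fun _ => le_top
  have hε2 : 0 < ε / 2 := ENNReal.half_pos hε.ne'
  obtain ⟨n, hn⟩ : ∃ n, ∫⁻ z, ‖P.σ (x, z) - g n z‖ₑ ∂P.measure < ε / 2 := by
    have hd := (TopologicalSpace.denseRange_denseSeq (Lp ℝ 1 P.measure)).exists_mem_open
      (Metric.isOpen_eball (x := hxi.toL1 _) (ε := ε / 2)) ⟨_, Metric.mem_eball_self hε2⟩
    obtain ⟨n, hn⟩ := hd
    refine ⟨n, lt_of_eq_of_lt ?_ hn⟩
    rw [edist_comm, Lp.edist_def, eLpNorm_one_eq_lintegral_enorm]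
    refine lintegral_congr_ae ?_
    filter_upwards [hxi.coeFn_toL1] with z hz
    simp only [Pi.sub_apply]
    rw [hz]
  filter_upwards [(hx n).eventually (gt_mem_nhds hn)] with r hr
  calc (∫⁻ x' in Metric.ball x r, (∫⁻ z, ‖P.σ (x', z) - P.σ (x, z)‖ₑ ∂P.measure) ∂P.measure) /
        P.measure (Metric.ball x r)
      ≤ (∫⁻ x' in Metric.ball x r, ((∫⁻ z, ‖P.σ (x', z) - g n z‖ₑ ∂P.measure) + ε / 2) ∂P.measure) /
        P.measure (Metric.ball x r) := by
        gcongr with x'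
        calc ∫⁻ z, ‖P.σ (x', z) - P.σ (x, z)‖ₑ ∂P.measure
            ≤ ∫⁻ z, (‖P.σ (x', z) - g n z‖ₑ + ‖P.σ (x, z) - g n z‖ₑ) ∂P.measure := by
              refine lintegral_mono fun z => ?_
              have : P.σ (x', z) - P.σ (x, z) =
                (P.σ (x', z) - g n z) - (P.σ (x, z) - g n z) := by ring
              rw [this]
              exact enorm_sub_le
          _ = (∫⁻ z, ‖P.σ (x', z) - g n z‖ₑ ∂P.measure) +
                ∫⁻ z, ‖P.σ (x, z) - g n z‖ₑ ∂P.measure :=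
              lintegral_add_right' _ (hxi.1.sub (hgi n).1).enorm
          _ ≤ _ := by gcongr
    _ = (∫⁻ x' in Metric.ball x r, (∫⁻ z, ‖P.σ (x', z) - g n z‖ₑ ∂P.measure) ∂P.measure) /
          P.measure (Metric.ball x r) +
          ε / 2 * P.measure (Metric.ball x r) / P.measure (Metric.ball x r) := by
        rw [lintegral_add_right _ measurable_const, setLIntegral_const, ENNReal.add_div]
    _ ≤ ε / 2 + ε / 2 := by
        refine add_le_add hr.le ?_
        rw [mul_div_assoc]
        exact mul_le_of_le_one_right' ENNReal.div_self_le_one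
    _ = ε := ENNReal.add_halves ε

lemma ae_mem_Ω : ∀ᵐ x ∂P.measure, x ∈ P.Ω := ae_restrict_mem P.isOpen.measurableSet

/-- If `B` does not interact with its complement, then neither does a point at which `B` does not have
density zero. -/
lemma ae_eq_zero_of_isSectionAt {B : Set (EuclideanSpace ℝ (Fin d))} (hB : MeasurableSet B)
    (hint : ∫ p in B ×ˢ Bᶜ, P.σ p ∂(P.measure.prod P.measure) = 0)
    {x : EuclideanSpace ℝ (Fin d)}
    (hx : ¬ Tendsto (fun r : ℝ => P.measure (B ∩ Metric.ball x r) /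
      P.measure (Metric.ball x r)) (𝓝[>] 0) (𝓝 0))
    {f : EuclideanSpace ℝ (Fin d) → ℝ} (hf : P.IsSectionAt x f) :
    ∀ᵐ z ∂P.measure, z ∉ B → f z = 0 := by
  have hσi : Integrable P.σ (P.measure.prod P.measure) := P.memLp.integrable le_top
  have h0 : ∀ᵐ p ∂((P.measure.restrict B).prod (P.measure.restrict Bᶜ)), P.σ p = 0 := by
    rw [Measure.prod_restrict]
    exact (setIntegral_eq_zero_iff_of_nonneg_ae (ae_restrict_of_ae P.nonneg)
      hσi.integrableOn).1 hint
  have h1 := Measure.ae_ae_of_ae_prod h0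
  set c := ∫⁻ z in Bᶜ, ‖f z‖ₑ ∂P.measure with hc
  have hctop : c ≠ ⊤ := hf.1.integrableOn.2.ne
  have hc0 : c = 0 := by
    by_contra hc0
    refine hx ?_
    have hlow : ∀ r : ℝ, P.measure (B ∩ Metric.ball x r) / P.measure (Metric.ball x r) ≤
        c⁻¹ * ((∫⁻ x' in Metric.ball x r, (∫⁻ z, ‖P.σ (x', z) - f z‖ₑ ∂P.measure) ∂P.measure) /
          P.measure (Metric.ball x r)) := by
      intro r
      rw [← mul_div_assoc]
      refine ENNReal.div_le_div_right ?_ _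
      rw [← ENNReal.mul_le_iff_le_inv hc0 hctop]
      calc c * P.measure (B ∩ Metric.ball x r)
          = ∫⁻ _ in B ∩ Metric.ball x r, c ∂P.measure := by rw [setLIntegral_const]
        _ ≤ ∫⁻ x' in B ∩ Metric.ball x r, (∫⁻ z, ‖P.σ (x', z) - f z‖ₑ ∂P.measure) ∂P.measure := by
            refine lintegral_mono_ae ?_
            filter_upwards [ae_mono (Measure.restrict_mono Set.inter_subset_left le_rfl) h1] with x' hx'
            calc c = ∫⁻ z in Bᶜ, ‖P.σ (x', z) - f z‖ₑ ∂P.measure := by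
                  refine lintegral_congr_ae ?_
                  filter_upwards [hx'] with z hz
                  rw [hz, zero_sub, enorm_neg]
              _ ≤ _ := setLIntegral_le_lintegral _ _
        _ ≤ _ := lintegral_mono_set Set.inter_subset_right
    refine tendsto_of_tendsto_of_tendsto_of_le_of_le tendsto_const_nhds ?_ (fun _ => zero_le) hlow
    have := ENNReal.Tendsto.const_mul hf.2 (a := c⁻¹) (Or.inr (ENNReal.inv_ne_top.2 hc0))
    rwa [mul_zero] at this
  rw [hc, lintegral_eq_zero_iff' hf.1.1.enorm.restrict] at hc0
  have := (ae_restrict_iff' hB.compl).1 hc0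
  filter_upwards [this] with z hz hzB
  simpa using hz hzB

/-- The interaction function of a strongly connected graph is irreducible: if `B` does not interact
with its complement, the set of the points at which `B` does not have density zero is closed under
the arcs of the graph. -/
lemma isIrreducibleKernel (hG : P.graph.StronglyConnected) :
    IsIrreducibleKernel P.σ P.measure := by
  intro B hB hint
  by_contra! hcon
  let s : Set P.Vertex := {x | ¬ Tendsto (fun r : ℝ => P.measure (B ∩ Metric.ball x.1 r) /
      P.measure (Metric.ball x.1 r)) (𝓝[>] 0) (𝓝 0)}
  have hs : ∀ a b, a ∈ s → P.graph.Adj a b → b ∈ s := by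
    rintro a b ha ⟨-, f, hf, hb⟩ hlim
    refine hb.2 (tendsto_of_tendsto_of_tendsto_of_le_of_le tendsto_const_nhds hlim
      (fun _ => zero_le) fun r => ENNReal.div_le_div_right (measure_mono_ae ?_) _)
    filter_upwards [P.ae_eq_zero_of_isSectionAt hB hint ha hf] with z hz hzr
    exact ⟨by_contra fun hzB => hzr.1 (hz hzB), hzr.2⟩
  have hae : ∀ᵐ x ∂P.measure, (x ∈ P.Ω ∧ ∃ f, P.IsSectionAt x f) ∧
      Tendsto (fun r : ℝ => P.measure (B ∩ Metric.ball x r) / P.measure (Metric.ball x r))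
        (𝓝[>] 0) (𝓝 (B.indicator 1 x)) := by
    filter_upwards [P.ae_mem_Ω, P.ae_isSectionAt, P.ae_tendsto_measure_inter_ball_div hB] with
      x h1 h2 h3 using ⟨⟨h1, _, h2⟩, h3⟩
  obtain ⟨x, hxB, hx, hxlim⟩ := ((frequently_ae_mem_iff.2 hcon.1).and_eventually hae).exists
  obtain ⟨y, hyB, hy, hylim⟩ := ((frequently_ae_mem_iff.2 hcon.2).and_eventually hae).exists
  rw [Set.indicator_of_mem hxB] at hxlim
  rw [Set.indicator_of_notMem hyB] at hylim
  have hxs : (⟨x, hx⟩ : P.Vertex) ∈ s := fun h => one_ne_zero (tendsto_nhds_unique hxlim h)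
  exact hG.mem_of_forall_adj hs hxs ⟨y, hy⟩ hylim

end ContinuumModel

/-! ### The essential infimum of the interaction rate -/

section SmallSets

variable {α : Type*} [MeasurableSpace α] {μ : Measure α} [IsProbabilityMeasure μ] {σ : α × α → ℝ}

lemma norm_gainOperator_indicator_le (hσ : MemLp σ ⊤ (μ.prod μ)) {E : Set α}
    (hE : MeasurableSet E) :
    ‖gainOperator ℂ hσ (indicatorConstLp 2 hE (measure_ne_top μ E) 1)‖ ≤
      (eLpNorm σ ⊤ (μ.prod μ)).toReal *
        ‖indicatorConstLp 2 hE (measure_ne_top μ E) (1 : ℂ)‖ ^ 2 := by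
  set C := (eLpNorm σ ⊤ (μ.prod μ)).toReal with hC
  have hC0 : 0 ≤ C := ENNReal.toReal_nonneg
  have hnorm : ‖indicatorConstLp 2 hE (measure_ne_top μ E) (1 : ℂ)‖ ^ 2 = μ.real E := by
    rw [norm_indicatorConstLp two_ne_zero ENNReal.ofNat_ne_top, norm_one, one_mul,
      ENNReal.toReal_ofNat, ← Real.sqrt_eq_rpow, Real.sq_sqrt measureReal_nonneg]
  rw [hnorm]
  have hb : ∀ᵐ x ∂μ, ‖gainOperator ℂ hσ (indicatorConstLp 2 hE (measure_ne_top μ E) 1) x‖ ≤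
      C * μ.real E := by
    filter_upwards [coeFn_gainOperator hσ (indicatorConstLp 2 hE (measure_ne_top μ E) (1 : ℂ)),
      kernel_ae_bound hσ] with x h1 h2
    rw [h1]
    have h3 : ∫ y, σ (x, y) • indicatorConstLp 2 hE (measure_ne_top μ E) (1 : ℂ) y ∂μ =
        ∫ y in E, (σ (x, y) : ℂ) ∂μ := by
      rw [← integral_indicator hE]
      refine integral_congr_ae ?_
      filter_upwards [indicatorConstLp_coeFn (p := 2) (hs := hE) (hμs := measure_ne_top μ E)
        (c := (1 : ℂ))] with y hy
      rw [hy]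
      by_cases hyE : y ∈ E <;> simp [hyE]
    rw [h3]
    refine norm_setIntegral_le_of_norm_le_const_ae (measure_lt_top μ E) ?_
    filter_upwards [ae_restrict_of_ae h2] with y hy
    rwa [Complex.norm_real]
  refine (Lp.norm_le_of_ae_bound (by positivity) hb).trans ?_
  simp [measureUnivNNReal]

lemma norm_smul_sub_lossOperator_indicator_le (hσ : MemLp σ ⊤ (μ.prod μ)) {E : Set α}
    (hE : MeasurableSet E) {δ ε : ℝ} (hS : ∀ᵐ x ∂μ, x ∈ E → |(∫ y, σ (x, y) ∂μ) - δ| ≤ ε) :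
    ‖(-δ : ℂ) • indicatorConstLp 2 hE (measure_ne_top μ E) (1 : ℂ) -
      lossOperator ℂ hσ (indicatorConstLp 2 hE (measure_ne_top μ E) 1)‖ ≤
      ε * ‖indicatorConstLp 2 hE (measure_ne_top μ E) (1 : ℂ)‖ := by
  set z := indicatorConstLp 2 hE (measure_ne_top μ E) (1 : ℂ) with hz
  refine Lp.norm_le_mul_norm_of_ae_le_mul ?_
  filter_upwards [Lp.coeFn_sub ((-δ : ℂ) • z) (lossOperator ℂ hσ z), Lp.coeFn_smul (-δ : ℂ) z,
    coeFn_lossOperator hσ z, hS, indicatorConstLp_coeFn (p := 2) (hs := hE)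
      (hμs := measure_ne_top μ E) (c := (1 : ℂ))] with x h1 h2 h3 h4 h5
  rw [h1, Pi.sub_apply, h2, Pi.smul_apply, h3]
  by_cases hx : x ∈ E
  · have h6 : (-δ : ℂ) • z x - -((((∫ y, σ (x, y) ∂μ : ℝ)) : ℂ) * z x) =
        (((∫ y, σ (x, y) ∂μ) - δ : ℝ) : ℂ) * z x := by
      rw [smul_eq_mul]
      push_cast
      ring
    refine (congrArg norm h6).trans_le ?_
    rw [norm_mul, Complex.norm_real]
    exact mul_le_mul_of_nonneg_right (h4 hx) (norm_nonneg _)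
  · rw [h5, Set.indicator_of_notMem hx]
    simp

/-- If the total rate `S` is close to `δ` on arbitrarily small sets of positive measure, their
normalised indicators are approximate eigenvectors for `-δ`: the integral part of the operator is
negligible on functions concentrated on small sets. -/
lemma neg_mem_spectrum_kernelOperator (hσ : MemLp σ ⊤ (μ.prod μ)) {δ : ℝ}
    (hsmall : ∀ ε : ℝ, 0 < ε → ∃ E : Set α, MeasurableSet E ∧ 0 < μ E ∧ μ.real E ≤ ε ^ 2 ∧
      ∀ᵐ x ∂μ, x ∈ E → |(∫ y, σ (x, y) ∂μ) - δ| ≤ ε) :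
    (-δ : ℂ) ∈ spectrum ℂ (kernelOperator ℂ hσ) := by
  intro hres
  set T := kernelOperator ℂ hσ with hT
  set R := resolvent T (-δ : ℂ)
  set C := (eLpNorm σ ⊤ (μ.prod μ)).toReal with hC
  have hC0 : 0 ≤ C := ENNReal.toReal_nonneg
  have hR : ∀ z, ‖z‖ ≤ ‖R‖ * ‖(-δ : ℂ) • z - T z‖ := fun z => by
    have h1 : R * (algebraMap ℂ (Lp ℂ 2 μ →L[ℂ] Lp ℂ 2 μ) (-δ : ℂ) - T) = 1 :=
      Ring.inverse_mul_cancel _ hres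
    have h2 : R ((-δ : ℂ) • z - T z) = z := congrArg (fun f => f z) h1
    conv_lhs => rw [← h2]
    exact R.le_opNorm _
  -- Chosen so that `‖R‖ (1 + C) ε < 1`, which contradicts the bound of `‖z‖` below.
  set ε : ℝ := (2 * (‖R‖ + 1) * (1 + C))⁻¹ with hε
  have hε0 : 0 < ε := by positivity
  obtain ⟨E, hE, hE0, hEε, hS⟩ := hsmall ε hε0
  set z := indicatorConstLp 2 hE (measure_ne_top μ E) (1 : ℂ) with hz
  have hnorm : ‖z‖ = Real.sqrt (μ.real E) := by
    rw [hz, norm_indicatorConstLp two_ne_zero ENNReal.ofNat_ne_top, norm_one, one_mul,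
      ENNReal.toReal_ofNat, ← Real.sqrt_eq_rpow]
  have hz0 : 0 < ‖z‖ := by
    rw [hnorm]
    exact Real.sqrt_pos.2 (ENNReal.toReal_pos hE0.ne' (measure_ne_top μ E))
  have hzε : ‖z‖ ≤ ε := by
    rw [hnorm, ← Real.sqrt_sq hε0.le]
    exact Real.sqrt_le_sqrt hEε
  have h1 : ‖(-δ : ℂ) • z - T z‖ ≤ (1 + C) * ε * ‖z‖ := by
    have h2 : (-δ : ℂ) • z - T z = ((-δ : ℂ) • z - lossOperator ℂ hσ z) - gainOperator ℂ hσ z := by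
      rw [hT, kernelOperator_eq_add, add_apply, sub_sub]
    rw [h2]
    refine (norm_sub_le _ _).trans ((add_le_add (norm_smul_sub_lossOperator_indicator_le hσ hE hS)
      (norm_gainOperator_indicator_le hσ hE)).trans ?_)
    have : C * ‖z‖ ^ 2 ≤ C * (ε * ‖z‖) := by
      rw [sq]
      gcongr
    linarith
  have h3 : ‖z‖ ≤ ‖R‖ * ((1 + C) * ε * ‖z‖) :=
    (hR z).trans (mul_le_mul_of_nonneg_left h1 (norm_nonneg R))
  have h4 : ‖R‖ * ((1 + C) * ε) ≤ 1 / 2 := by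
    have : (‖R‖ + 1) * ((1 + C) * ε) = 1 / 2 := by
      rw [hε]
      field_simp
    rw [← this]
    gcongr
    linarith
  nlinarith

end SmallSets

namespace ContinuumModel

variable {d : ℕ} (P : ContinuumModel d)

lemma S_nonneg : ∀ᵐ x ∂P.measure, 0 ≤ P.S x := by
  filter_upwards [Measure.ae_ae_of_ae_prod P.nonneg] with x hx using integral_nonneg_of_ae hx

lemma ae_δ_le : ∀ᵐ x ∂P.measure, P.δ ≤ ∫ x', P.σ (x, x') ∂P.measure :=
  ae_essInf_le ⟨0, P.S_nonneg⟩

lemma le_δ {c : ℝ} (h : ∀ᵐ x ∂P.measure, c ≤ P.S x) : c ≤ P.δ := by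
  refine le_essInf_of_ae_le c h (IsBoundedUnder.isCoboundedUnder_ge
    ⟨(eLpNorm P.σ ⊤ (P.measure.prod P.measure)).toReal, ?_⟩)
  rw [eventually_map]
  filter_upwards [kernel_ae_bound P.memLp] with x hx
  have h := norm_integral_le_of_norm_le_const hx
  rw [probReal_univ, mul_one] at h
  exact (Real.le_norm_self _).trans h

/-- In positive dimension the essential infimum of `S` is approached on sets of arbitrarily small
positive measure, because Lebesgue measure has no atoms. -/
lemma exists_small_measure_S_near_δ (hd : 1 ≤ d) {ε : ℝ} (hε : 0 < ε) :
    ∃ E, MeasurableSet E ∧ 0 < P.measure E ∧ P.measure.real E ≤ ε ^ 2 ∧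
      ∀ᵐ x ∂P.measure, x ∈ E → |(∫ x', P.σ (x, x') ∂P.measure) - P.δ| ≤ ε := by
  have : Nonempty (Fin d) := ⟨⟨0, hd⟩⟩
  have hSm : AEStronglyMeasurable P.S P.measure := (memLp_rowSum P.memLp).1
  set S' := hSm.mk P.S with hS'
  set D := {x | S' x < P.δ + ε} with hD
  have hDm : MeasurableSet D :=
    hSm.stronglyMeasurable_mk.measurable measurableSet_Iio
  have hD0 : P.measure D ≠ 0 := by
    intro h0
    have : P.δ + ε ≤ P.δ := by
      refine P.le_δ ?_
      filter_upwards [measure_eq_zero_iff_ae_notMem.1 h0, hSm.ae_eq_mk] with x h1 h2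
      rw [h2]
      exact not_lt.1 h1
    linarith
  obtain ⟨x, -, hx⟩ := exists_mem_forall_mem_nhdsWithin_pos_measure hD0
  obtain ⟨U, hxU, hU, hUε⟩ := Set.exists_isOpen_lt_of_lt (μ := P.measure) {x}
    (ENNReal.ofReal (ε ^ 2)) (by
      rw [measure_singleton]
      exact ENNReal.ofReal_pos.2 (by positivity))
  refine ⟨U ∩ D, hU.measurableSet.inter hDm, ?_, ?_, ?_⟩
  · exact hx _ (inter_mem (mem_nhdsWithin_of_mem_nhds (hU.mem_nhds (hxU rfl))) self_mem_nhdsWithin)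
  · exact ENNReal.toReal_le_of_le_ofReal (by positivity)
      ((measure_mono Set.inter_subset_left).trans hUε.le)
  · filter_upwards [P.ae_δ_le, hSm.ae_eq_mk] with y h1 h2 hy
    have h3 : P.S y < P.δ + ε := by
      rw [h2]
      exact hy.2
    rw [abs_of_nonneg (by linarith)]
    change P.S y - P.δ ≤ ε
    linarith

lemma neg_δ_mem_spectrum (hd : 1 ≤ d) : (-P.δ : ℂ) ∈ spectrum ℂ (P.operator ℂ) :=
  neg_mem_spectrum_kernelOperator P.memLp fun _ hε => P.exists_small_measure_S_near_δ hd hε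

end ContinuumModel

/-! ### The infinite-dimensional model -/

section RightmostEigenvalue

variable {X H : Type*} [NormedAddCommGroup X] [InnerProductSpace ℝ X]
  [NormedAddCommGroup H] [InnerProductSpace ℂ H] [CompleteSpace H]
  {c : Complexification X H} {A : X →L[ℝ] X} {B K : H →L[ℂ] H} {e v : X} {φ : H →L[ℂ] ℂ}

/-- Outside the spectrum of `B`, the points of the spectrum of `B + K` on the vertical line through the
spectral bound are discrete eigenvalues, because they are boundary points of the spectrum. -/
lemma IsConsensusPair.mem_discreteSpectrum {T : H →L[ℂ] H} (h : IsConsensusPair c A T e v φ)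
    (hF : Function.Injective (T + φ.smulRight (c.ofReal e)) →
      Function.Surjective (T + φ.smulRight (c.ofReal e)))
    (hT : T = B + K) (hK : IsCompactOperator K) {l : ℂ} (hlB : l ∈ resolventSet ℂ B)
    (hl : l ∈ spectrum ℂ (restrictToImage T))
    (hre : l.re = spectralBound (restrictToImage T)) :
    l ∈ discreteSpectrum (restrictToImage T) := by
  subst hT
  have := h.completeSpace_range hF
  have hl0 := h.ne_zero_of_mem_spectrum hF hl
  have hres : ∀ z : ℂ, z ≠ 0 →
      (z ∈ resolventSet ℂ (restrictToImage (B + K)) ↔ z ∈ resolventSet ℂ (B + K)) := fun z hz =>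
    not_iff_not.1 (h.mem_spectrum_restrictToImage hF hz)
  have hfreq : ∃ᶠ z in 𝓝 l, z ∈ resolventSet ℂ (B + K) := by
    have ht : Tendsto (fun t : ℝ => l + t) (𝓝[>] 0) (𝓝 l) := by
      have : Tendsto (fun t : ℝ => l + t) (𝓝 0) (𝓝 (l + (0 : ℝ))) :=
        (continuous_const.add Complex.continuous_ofReal).tendsto 0
      rw [Complex.ofReal_zero, add_zero] at this
      exact this.mono_left nhdsWithin_le_nhds
    refine ht.frequently (Eventually.frequently ?_)
    filter_upwards [self_mem_nhdsWithin, ht.eventually_ne hl0] with t ht0 hne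
    refine (hres _ hne).1 (not_not.1 fun hmem => ?_)
    have h1 := re_le_spectralBound _ hmem
    rw [← hre, Complex.add_re, Complex.ofReal_re] at h1
    have : (0 : ℝ) < t := ht0
    linarith
  have hBev : ∀ᶠ z in 𝓝 l, z ∈ resolventSet ℂ B :=
    (spectrum.isOpen_resolventSet B).mem_nhds hlB
  have hev : ∀ᶠ z in 𝓝 l, (z ≠ l → z ∈ resolventSet ℂ (B + K)) ∧ z ∈ resolventSet ℂ B ∧ z ≠ 0 :=
    (eventually_nhdsWithin_iff.1 (eventually_mem_resolventSet_add hK hlB hfreq)).and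
      (hBev.and (eventually_ne_nhds hl0))
  obtain ⟨r, hr, hball⟩ := Metric.nhds_basis_closedBall.eventually_iff.1 hev
  have hsph : ∀ z ∈ Metric.sphere l r, z ∈ resolventSet ℂ (B + K) ∧ z ≠ 0 := fun z hz => by
    have hz' := hball (Metric.sphere_subset_closedBall hz)
    exact ⟨hz'.1 (Metric.ne_of_mem_sphere hz hr.ne'), hz'.2.2⟩
  refine ⟨r, hr, ?_, ?_⟩
  · ext z
    constructor
    · rintro ⟨hz, hzr⟩
      by_contra hne
      exact hz ((hres z (hball hzr).2.2).2 ((hball hzr).1 hne))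
    · rintro rfl
      exact ⟨hl, Metric.mem_closedBall_self hr.le⟩
  · refine finiteDimensional_range_rieszProjector_restriction (T := B + K)
      (B + K).range.subtypeₗᵢ hr (fun z hz => (hsph z hz).1)
      (fun z hz => (hres z (hsph z hz).2).2 (hsph z hz).1) (fun z hz w => ?_)
      (finiteDimensional_range_rieszProjector_add hK hr (fun z hz => (hball hz).2.1)
        fun z hz hne => (hball hz).1 hne)
    exact map_resolvent_restriction (S := restrictToImage (B + K)) (fun _ => rfl)
      (h.exists_coe_eq_iff hF) h.form_apply (hsph z hz).2 (hsph z hz).1 w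

end RightmostEigenvalue

namespace ContinuumModel

variable {d : ℕ} (P : ContinuumModel d)

lemma exists_consensus (hd : 1 ≤ d) (hP : P.StronglyConnected) :
    ∃ v : Lp ℝ 2 P.measure, P.IsWeight v ∧ (∀ w, P.IsWeight w → w = v) ∧
      ∃ ρ : ℝ, 0 < ρ ∧
        (∀ y : ℝ → Lp ℝ 2 P.measure, IsSolution (P.operator ℝ) y → ∀ t, 0 ≤ t →
          weightedMean P.ones v (y t) = weightedMean P.ones v (y 0)) ∧
        ConvergesAtRate (P.operator ℝ) P.ones v ρ ∧
        NoBetterRate (P.operator ℝ) P.ones v ρ ∧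
        ρ = -spectralBound (restrictToImage (P.operator ℂ)) ∧
        ((¬ ∃ μ : ℂ, IsEigenvalue (restrictToImage (P.operator ℂ)) μ ∧
            -P.δ < μ.re ∧ μ.re < 0) → -ρ = -P.δ) ∧
        ((∃ μ : ℂ, IsEigenvalue (restrictToImage (P.operator ℂ)) μ ∧
            -P.δ < μ.re ∧ μ.re < 0) →
          ∃ μ₂ : ℂ, μ₂ ∈ discreteSpectrum (restrictToImage (P.operator ℂ)) ∧
            IsEigenvalue (restrictToImage (P.operator ℂ)) μ₂ ∧
            (∀ μ : ℂ, IsEigenvalue (restrictToImage (P.operator ℂ)) μ → μ.re ≤ μ₂.re) ∧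
            -ρ = μ₂.re) := by
  obtain ⟨hG, hδ0⟩ := hP
  have hirr := P.isIrreducibleKernel hG
  have hδ := P.ae_δ_le
  obtain ⟨v, hv, hv0, hv1⟩ :=
    exists_adjoint_kernelOperator_eq_zero_pos P.memLp P.nonneg hirr hδ0 hδ
  have h : IsConsensusPair (lpComplexification P.measure) (P.operator ℝ) (P.operator ℂ) P.ones v
      (innerSL ℂ ((lpComplexification P.measure).ofReal v)) :=
    isConsensusPair_kernelOperator P.memLp P.nonneg hirr hv hv0 hv1
  have hF := surjective_kernelOperator_add_smulRight P.memLp hδ0 hδ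
    (innerSL ℂ ((lpComplexification P.measure).ofReal v))
    ((lpComplexification P.measure).ofReal P.ones)
  have := h.completeSpace_range hF
  -- The point `-δ` is in the spectrum on the image, which is therefore not trivial.
  have hδspec : (-P.δ : ℂ) ∈ spectrum ℂ (restrictToImage (P.operator ℂ)) :=
    (h.mem_spectrum_restrictToImage hF (by simpa using hδ0.ne')).2 (P.neg_δ_mem_spectrum hd)
  have hnt : Nontrivial (P.operator ℂ).range := by
    by_contra hnt
    rw [not_nontrivial_iff_subsingleton] at hnt
    rw [spectrum.of_subsingleton] at hδspec
    exact hδspec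
  set s := spectralBound (restrictToImage (P.operator ℂ)) with hs
  have hδs : -P.δ ≤ s := by simpa using re_le_spectralBound _ hδspec
  -- To the right of `-δ` the spectrum consists of eigenvalues.
  have heig : ∀ l ∈ spectrum ℂ (restrictToImage (P.operator ℂ)), -P.δ < l.re →
      IsEigenvalue (restrictToImage (P.operator ℂ)) l := by
    intro l hl hlδ
    have hl0 := h.ne_zero_of_mem_spectrum hF hl
    have hlT := (h.mem_spectrum_restrictToImage hF hl0).1 hl
    rw [h.isEigenvalue_restrictToImage hF hl0]
    rw [operator, kernelOperator_eq_add] at hlT ⊢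
    exact isEigenvalue_of_mem_spectrum_add (isCompactOperator_gainOperator ℂ P.memLp)
      (mem_resolventSet_lossOperator P.memLp hδ hlδ) hlT
  have hneg : ∀ l, IsEigenvalue (restrictToImage (P.operator ℂ)) l → l.re < 0 := by
    intro l hl
    have hl0 := h.ne_zero_of_mem_spectrum hF hl.mem_spectrum
    exact re_neg_of_isEigenvalue_kernelOperator P.memLp P.nonneg hδ0 hδ hv hv0
      ((h.isEigenvalue_restrictToImage hF hl0).1 hl) hl0
  obtain ⟨μ₂, hμ₂, hre⟩ :=
    exists_mem_spectrum_re_eq_spectralBound (restrictToImage (P.operator ℂ))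
  rw [← hs] at hre
  have hs0 : s < 0 := by
    rcases hδs.eq_or_lt with heq | hlt
    · linarith
    · rw [← hre] at hlt ⊢
      exact hneg _ (heig _ hμ₂ hlt)
  refine ⟨v, ⟨hv, hv0, hv1⟩, fun w hw => adjoint_kernelOperator_unique P.memLp P.nonneg hirr
      hv hv1 hw.mem_ker hw.normalized, -s, neg_pos.2 hs0, fun y hy t ht => h.weightedMean_eq hy ht,
      h.convergesAtRate hF, h.noBetterRate hF hs0, rfl, fun hno => ?_, ?_⟩
  · rw [neg_neg]
    refine le_antisymm (not_lt.1 fun hlt => hno ⟨μ₂, ?_⟩) hδs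
    rw [← hre] at hlt hs0
    exact ⟨heig _ hμ₂ hlt, hlt, hs0⟩
  · rintro ⟨l, hl, hlδ, -⟩
    have hlt : -P.δ < μ₂.re := by
      rw [hre]
      exact hlδ.trans_le (re_le_spectralBound _ hl.mem_spectrum)
    refine ⟨μ₂, ?_, heig _ hμ₂ hlt, fun m hm => ?_, by rw [neg_neg, hre]⟩
    · exact h.mem_discreteSpectrum hF (kernelOperator_eq_add P.memLp)
        (isCompactOperator_gainOperator ℂ P.memLp)
        (mem_resolventSet_lossOperator P.memLp hδ hlt) hμ₂ hre
    · rw [hre]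
      exact re_le_spectralBound _ hm.mem_spectrum

end ContinuumModel

end

theorem theorem2 :
    -- finite dimension
    (∀ (N : ℕ) (_ : 2 ≤ N) (σ : Matrix (Fin N) (Fin N) ℝ) (_ : ∀ i j, 0 ≤ σ i j)
        (_ : (interactionGraph σ).StronglyConnected),
      ∃ v : EuclideanSpace ℝ (Fin N), IsFiniteWeight σ v ∧ (∀ w, IsFiniteWeight σ w → w = v) ∧
      ∃ ρ : ℝ, 0 < ρ ∧
        -- the consensus value does not depend on time
        (∀ y : ℝ → EuclideanSpace ℝ (Fin N), IsSolution (finiteOperator ℝ σ) y → ∀ t, 0 ≤ t →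
          weightedMean (finiteOnes N) v (y t) = weightedMean (finiteOnes N) v (y 0)) ∧
        ConvergesAtRate (finiteOperator ℝ σ) (finiteOnes N) v ρ ∧
        NoBetterRate (finiteOperator ℝ σ) (finiteOnes N) v ρ ∧
        ρ = -spectralBound (restrictToImage (finiteOperator ℂ σ)) ∧
        ∃ μ₂ : ℂ, IsEigenvalue (finiteOperator ℂ σ) μ₂ ∧ μ₂ ≠ 0 ∧
          (∀ μ : ℂ, IsEigenvalue (finiteOperator ℂ σ) μ → μ ≠ 0 → μ.re ≤ μ₂.re) ∧
          ρ = |μ₂.re|) ∧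
    -- infinite dimension
    (∀ (d : ℕ) (_ : 1 ≤ d) (P : ContinuumModel d) (_ : P.StronglyConnected),
      ∃ v : Lp ℝ 2 P.measure, P.IsWeight v ∧ (∀ w, P.IsWeight w → w = v) ∧
      ∃ ρ : ℝ, 0 < ρ ∧
        -- the consensus value does not depend on time
        (∀ y : ℝ → Lp ℝ 2 P.measure, IsSolution (P.operator ℝ) y → ∀ t, 0 ≤ t →
          weightedMean P.ones v (y t) = weightedMean P.ones v (y 0)) ∧
        ConvergesAtRate (P.operator ℝ) P.ones v ρ ∧
        NoBetterRate (P.operator ℝ) P.ones v ρ ∧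
        ρ = -spectralBound (restrictToImage (P.operator ℂ)) ∧
        -- without eigenvalue of real part in `(-δ, 0)`, the spectral bound is `-δ`
        ((¬ ∃ μ : ℂ, IsEigenvalue (restrictToImage (P.operator ℂ)) μ ∧
            -P.δ < μ.re ∧ μ.re < 0) → -ρ = -P.δ) ∧
        -- otherwise it is the real part of a discrete eigenvalue of highest real part
        ((∃ μ : ℂ, IsEigenvalue (restrictToImage (P.operator ℂ)) μ ∧
            -P.δ < μ.re ∧ μ.re < 0) →
          ∃ μ₂ : ℂ, μ₂ ∈ discreteSpectrum (restrictToImage (P.operator ℂ)) ∧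
            IsEigenvalue (restrictToImage (P.operator ℂ)) μ₂ ∧
            (∀ μ : ℂ, IsEigenvalue (restrictToImage (P.operator ℂ)) μ → μ.re ≤ μ₂.re) ∧
            -ρ = μ₂.re)) := by
  exact ⟨fun _ hN _ hσ hG => exists_consensus_finite hN hσ hG,
    fun _ hd P hP => P.exists_consensus hd hP⟩
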